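/- Let $k$ be a field of characteristic different from $2$ and $3$, with algebraic closure $\overline k$. Let $V$ be a nontrivial Severi–Brauer surface over $k$, that is, a $k$-scheme such that $V\times_k\overline k\cong\mathbf P^2_{\overline k}$ over $\overline k$ but $V\not\cong\mathbf P^2_k$ over $k$. Fix an isomorphism $V\times_k\overline k\cong\mathbf P^2_{\overline k}$ over $\overline k$ and let $p\colon\mathbf P^2_{\overline k}\to V$ be the resulting projection. Let $x\in V$ be a closed point of degree $6$, that is, with $[\kappa(x):k]=6$. Then $p^{-1}(x)$ consists of exactly six distinct closed points $x_0,\dots,x_5$ of $\mathbf P^2_{\overline k}$; no three of them lie on a line, and the six do not all lie on a conic (where a conic is the zero locus of a nonzero quadratic form, possibly degenerate). -/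

import Mathlib

open CategoryTheory CategoryTheory.Limits AlgebraicGeometry

attribute [local instance] MvPolynomial.gradedAlgebra

universe u

noncomputable section

namespace SeveriBrauer

/-- The projective plane over a field `K`, as a `K`-scheme: `Proj K[X₀, X₁, X₂]` with its
structure morphism to `Spec K`. -/
def projPlane (K : Type u) [Field K] : Over (Spec (CommRingCat.of K)) :=
  Over.mk (Y := Proj (MvPolynomial.homogeneousSubmodule (Fin 3) K))
    (Proj.toSpecZero (MvPolynomial.homogeneousSubmodule (Fin 3) K) ≫
      Spec.map (CommRingCat.ofHom
        (algebraMap K (MvPolynomial.homogeneousSubmodule (Fin 3) K 0))))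

/-- `C` is a plane curve of degree `d` in the projective plane over `K`: the zero locus of a
nonzero form of degree `d` in `X₀, X₁, X₂`. It may be reducible or non-reduced. -/
def IsPlaneCurve {K : Type u} [Field K] (d : ℕ) (C : Set (projPlane K).left) : Prop :=
  ∃ f : MvPolynomial (Fin 3) K, f ≠ 0 ∧ f.IsHomogeneous d ∧
    C = ProjectiveSpectrum.zeroLocus (MvPolynomial.homogeneousSubmodule (Fin 3) K) {f}

/-- A line in the projective plane over `K`. -/
def IsLine {K : Type u} [Field K] (L : Set (projPlane K).left) : Prop :=
  IsPlaneCurve 1 L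

/-- A conic, possibly degenerate, in the projective plane over `K`. -/
def IsConic {K : Type u} [Field K] (C : Set (projPlane K).left) : Prop :=
  IsPlaneCurve 2 C

variable {k : Type u} [Field k]

/-- The morphism `Spec k̄ ⟶ Spec k`. -/
def specAlgClosure (k : Type u) [Field k] :
    Spec (CommRingCat.of (AlgebraicClosure k)) ⟶ Spec (CommRingCat.of k) :=
  Spec.map (CommRingCat.ofHom (algebraMap k (AlgebraicClosure k)))

/-- The base change `V ×ₖ k̄`, as a scheme over the algebraic closure `k̄`. -/
def geometricFibre (V : Over (Spec (CommRingCat.of k))) :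
    Over (Spec (CommRingCat.of (AlgebraicClosure k))) :=
  Over.mk (pullback.snd V.hom (specAlgClosure k))

/-- The projection `V ×ₖ k̄ ⟶ V`. -/
def geometricProj (V : Over (Spec (CommRingCat.of k))) : (geometricFibre V).left ⟶ V.left :=
  pullback.fst V.hom (specAlgClosure k)

/-- A Severi–Brauer surface over `k`: a `k`-scheme that becomes isomorphic to the projective
plane over the algebraic closure of `k`. -/
def IsSeveriBrauerSurface (V : Over (Spec (CommRingCat.of k))) : Prop :=
  Nonempty (geometricFibre V ≅ projPlane (AlgebraicClosure k))

/-- The `k`-scheme `V` is trivial if it is isomorphic over `k` to the projective plane. -/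
def IsTrivial (V : Over (Spec (CommRingCat.of k))) : Prop :=
  Nonempty (V ≅ projPlane k)

/-- The homomorphism from `k` to the residue field of a point `x` of a `k`-scheme `V`. -/
def residueFieldHom (V : Over (Spec (CommRingCat.of k))) (x : V.left) :
    k →+* V.left.residueField x :=
  (Spec.preimage (V.left.fromSpecResidueField x ≫ V.hom)).hom

/-- The degree `[κ(x) : k]` of a point `x` of a `k`-scheme `V` (`0` if it is infinite). -/
def pointDegree (V : Over (Spec (CommRingCat.of k))) (x : V.left) : ℕ :=
  letI : Algebra k (V.left.residueField x) := (residueFieldHom V x).toAlgebra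
  Module.finrank k (V.left.residueField x)

end SeveriBrauer

end

/-! Write `K` for the algebraic closure of `k`, `L` for the function field of the plane over `K` and
`F` for that of `V`, so that `L = K ⊗ F`. The claim is proved by contraposition: if the six points
are in special position, then `V` is trivial.

The six points correspond to the `k`-embeddings of the residue field into `K`. There are six because
the characteristic is not 2 or 3, so the residue field is separable, and the Galois group permutes
them transitively. If three are collinear, the conjugates of their line form a configuration whose
number of lines an incidence count shows to be prime to 3. If no three are collinear but all lie on
a conic, that conic is unique. Either way there is a Galois-invariant curve `f = 0` of degree `d`
prime to 3 (`exists_invariant`).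

The anticanonical bundle O(3) always descends to `V`. Concretely, global bivector fields on the
plane (alternating biderivations of `L`, regular on all charts) are given by cubic forms. Regularity
can be tested on the preimages of affine opens of `V`, hence these fields are spanned by those
defined over `F`. So after multiplication by one function `h₀` the cubic forms are spanned by
elements of `F` (`IsProjCoord.exists_span_cubic`). It follows that Galois acts on the homogeneous
coordinates by linear substitutions (`exists_isTwist`).

Since 3 does not divide `d`, O(1) is a combination of O(3) and O(`d`). With `d * j + 1 = 3 * N`, the
space of all `f ^ j * h₀ ^ N * l`, with `l` a linear form, is Galois-stable, hence spanned by
Galois-fixed elements. When `k` is imperfect such elements only have a `p`-power in `F`, and a colon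
argument with forms of degrees `3 * Q` and `3 * Q + 1` removes the Frobenius
(`isDefinedOver_formSpace_of_pow`). The result is three independent linear forms with ratios in `F`
(`exists_coord_of_invariant`).

These forms define a morphism from the plane over `K` to the plane over `k` which is a base change
of `Spec K ⟶ Spec k`. It is generically defined over `V`, so by faithfully flat descent it comes
from an isomorphism of `V` with the plane (`exists_isIso_of_linearForms`). -/

namespace SeveriBrauer

/-! ### Linear and Galois descent for subspaces of `K ⊗ F`. -/

section Descent

variable {k K F L : Type*} [Field k] [Field K] [Field F] [Field L] [Algebra k K] [Algebra k F]
  [Algebra K L] [Algebra F L] [Algebra k L] [IsScalarTower k K L] [IsScalarTower k F L]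

variable (F L) in
/-- The `F`-basis of `K ⊗ F` obtained from a basis of `K` over `k`. -/
noncomputable def pushoutBasis [Algebra.IsPushout k F K L] {ι : Type*} (κ : Module.Basis ι k K) :
    Module.Basis ι F L :=
  IsBaseChange.basis κ (Algebra.IsPushout.out (R := k) (S := F) (R' := K) (S' := L))

lemma pushoutBasis_apply [Algebra.IsPushout k F K L] {ι : Type*} (κ : Module.Basis ι k K) (i : ι) :
    pushoutBasis F L κ i = algebraMap K L (κ i) :=
  IsBaseChange.basis_apply _ _ _

lemma pushoutBasis_repr_mul [Algebra.IsPushout k F K L] {ι : Type*} (κ : Module.Basis ι k K)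
    (c : K) (r : F) (i : ι) :
    (pushoutBasis F L κ).repr (algebraMap K L c * algebraMap F L r) i =
      algebraMap k F (κ.repr c i) * r := by
  have h : algebraMap K L c * algebraMap F L r =
      r • (IsScalarTower.toAlgHom k K L).toLinearMap c := by
    rw [Algebra.smul_def, mul_comm]; rfl
  rw [h, map_smul, Finsupp.smul_apply, smul_eq_mul, mul_comm]
  congr 1
  exact IsBaseChange.basis_repr_comp_apply _ _ _ _

lemma pushoutBasis_sum [Algebra.IsPushout k F K L] {ι : Type*} (κ : Module.Basis ι k K) (w : L) :
    w = ((pushoutBasis F L κ).repr w).sum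
      (fun i r => algebraMap K L (κ i) * algebraMap F L r) := by
  conv_lhs => rw [← (pushoutBasis F L κ).linearCombination_repr w]
  rw [Finsupp.linearCombination_apply]
  refine Finsupp.sum_congr fun i _ => ?_
  rw [Algebra.smul_def, mul_comm, pushoutBasis_apply]

variable (F) in
/-- A `K`-subspace of `K ⊗ F` is defined over `F` if it is spanned by elements of `F`. -/
def IsDefinedOver (T : Submodule K L) : Prop :=
  T ≤ Submodule.span K {w | w ∈ T ∧ w ∈ Set.range (algebraMap F L)}

/-- An element is the combination of its `F`-coordinates with coefficients `κ i` in `K`, so a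
subspace that contains these coordinates is spanned by them. Together with
`repr_mem_of_isDefinedOver` this turns being defined over `F` into a condition on coordinates. -/
lemma isDefinedOver_of_repr_mem [Algebra.IsPushout k F K L] {ι : Type*} (κ : Module.Basis ι k K)
    {T : Submodule K L}
    (h : ∀ w ∈ T, ∀ i, algebraMap F L ((pushoutBasis F L κ).repr w i) ∈ T) :
    IsDefinedOver F T := by
  intro w hw
  rw [pushoutBasis_sum (F := F) κ w]
  refine Submodule.sum_mem _ fun i _ => ?_
  dsimp only
  rw [← Algebra.smul_def]
  exact Submodule.smul_mem _ _ (Submodule.subset_span ⟨h w hw i, _, rfl⟩)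

/-- The coordinates of `c * r`, for `c` in `K` and `r` in `F`, are multiples of `r` by elements of
`k`, so they stay in `T`. -/
lemma repr_mem_of_mem_span [Algebra.IsPushout k F K L] {ι : Type*} (κ : Module.Basis ι k K)
    {T : Submodule k F} {w : L} (hw : w ∈ Submodule.span K (algebraMap F L '' T)) :
    ∀ i, (pushoutBasis F L κ).repr w i ∈ T := by
  induction hw using Submodule.span_induction with
  | mem x hx =>
    obtain ⟨r, hr, rfl⟩ := hx
    intro i
    have := pushoutBasis_repr_mul (F := F) (L := L) κ 1 r i
    rw [map_one, one_mul] at this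
    rw [this, ← Algebra.smul_def]
    exact T.smul_mem _ hr
  | zero => simp
  | add x y _ _ hx hy =>
    intro i
    rw [map_add]; exact T.add_mem (hx i) (hy i)
  | smul c x _ hx =>
    intro i
    rw [pushoutBasis_sum (F := F) κ x, Finsupp.sum, Finset.smul_sum, map_sum,
      Finsupp.finsetSum_apply]
    refine T.sum_mem fun j _ => ?_
    rw [Algebra.smul_def, ← mul_assoc, ← map_mul, pushoutBasis_repr_mul, ← Algebra.smul_def]
    exact T.smul_mem _ (hx j)

lemma repr_mem_of_isDefinedOver [Algebra.IsPushout k F K L] {ι : Type*} (κ : Module.Basis ι k K)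
    {T : Submodule K L} (hT : IsDefinedOver F T) {w : L} (hw : w ∈ T) (i : ι) :
    algebraMap F L ((pushoutBasis F L κ).repr w i) ∈ T := by
  let T' : Submodule k F := (T.restrictScalars k).comap (IsScalarTower.toAlgHom k F L).toLinearMap
  refine repr_mem_of_mem_span (T := T') κ (Submodule.span_mono ?_ (hT hw)) i
  rintro _ ⟨h, r, rfl⟩
  exact ⟨r, h, rfl⟩

/-- The action of `σ` on `K ⊗ F` through the first factor. -/
noncomputable def conj (F L : Type*) [Field F] [Field L] [Algebra k F] [Algebra K L] [Algebra F L]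
    [Algebra k L] [IsScalarTower k K L] [IsScalarTower k F L] [Algebra.IsPushout k F K L]
    (σ : K ≃ₐ[k] K) : L →ₐ[k] L :=
  Algebra.pushoutDesc L (IsScalarTower.toAlgHom k F L)
    ((IsScalarTower.toAlgHom k K L).comp σ.toAlgHom) fun _ _ => mul_comm _ _

@[simp]
lemma conj_left [Algebra.IsPushout k F K L] (σ : K ≃ₐ[k] K) (r : F) :
    conj F L σ (algebraMap F L r) = algebraMap F L r :=
  Algebra.pushoutDesc_left _ _ _ _ _

@[simp]
lemma conj_right [Algebra.IsPushout k F K L] (σ : K ≃ₐ[k] K) (c : K) :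
    conj F L σ (algebraMap K L c) = algebraMap K L (σ c) :=
  Algebra.pushoutDesc_right _ _ _ _ _

lemma conj_smul [Algebra.IsPushout k F K L] (σ : K ≃ₐ[k] K) (c : K) (w : L) :
    conj F L σ (c • w) = σ c • conj F L σ w := by
  rw [Algebra.smul_def, map_mul, conj_right, Algebra.smul_def]

instance isPushout_symm [h : Algebra.IsPushout k F K L] : Algebra.IsPushout k K F L := h.symm

/-- Here the basis comes from `F`, on which the action is trivial, so the coordinates lie in `K` and
`σ` acts on them one by one. -/
lemma pushoutBasis_repr_conj [Algebra.IsPushout k F K L] {ι : Type*} (b : Module.Basis ι k F)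
    (σ : K ≃ₐ[k] K) (w : L) (i : ι) :
    (pushoutBasis K L b).repr (conj F L σ w) i = σ ((pushoutBasis K L b).repr w i) := by
  classical
  conv_lhs => rw [pushoutBasis_sum (F := K) b w, Finsupp.sum]
  rw [map_sum, map_sum, Finsupp.finsetSum_apply]
  simp only [map_mul, conj_left, conj_right, pushoutBasis_repr_mul, b.repr_self,
    Finsupp.single_apply]
  by_cases hi : i ∈ ((pushoutBasis K L b).repr w).support
  · rw [Finset.sum_eq_single_of_mem i hi]
    · simp
    · intro j _ hj
      simp [hj]
  · rw [Finset.sum_eq_zero, Finsupp.notMem_support_iff.mp hi, map_zero]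
    intro j hj
    have : j ≠ i := fun h => hi (h ▸ hj)
    simp [this]

/-- Galois descent for finite-dimensional subspaces of `K ⊗ F`. -/
lemma le_span_fixed_of_conj_mem [Algebra.IsPushout k F K L] (n : ℕ) (T : Submodule K L)
    [FiniteDimensional K T] (hn : Module.finrank K T = n)
    (hT : ∀ σ : K ≃ₐ[k] K, ∀ w ∈ T, conj F L σ w ∈ T) :
    T ≤ Submodule.span K {w | w ∈ T ∧ ∀ σ : K ≃ₐ[k] K, conj F L σ w = w} := by
  classical
  induction n using Nat.strong_induction_on generalizing T with
  | _ n ih =>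
  let b := Module.Basis.ofVectorSpace k F
  let B := pushoutBasis K L b
  have hB : ∀ σ w i, B.repr (conj F L σ w) i = σ (B.repr w i) := pushoutBasis_repr_conj b
  by_cases hbot : ∀ w ∈ T, w = 0
  · intro w hw
    rw [hbot w hw]; exact Submodule.zero_mem _
  push Not at hbot
  -- The classical minimal-support argument: take a nonzero vector of `T` with as few nonzero
  -- coordinates as possible and scale one coordinate to 1.
  have hex : ∃ m, ∃ w ∈ T, w ≠ 0 ∧ (B.repr w).support.card = m := by
    obtain ⟨w, hw, hw0⟩ := hbot
    exact ⟨_, w, hw, hw0, rfl⟩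
  obtain ⟨w, hw, hw0, hm⟩ := Nat.find_spec hex
  have hmin : ∀ v ∈ T, (B.repr v).support.card < (B.repr w).support.card → v = 0 := by
    intro v hv hlt
    by_contra hv0
    exact Nat.find_min hex (hm ▸ hlt) ⟨v, hv, hv0, rfl⟩
  obtain ⟨i, hi⟩ : (B.repr w).support.Nonempty := by
    rw [Finsupp.support_nonempty_iff]
    simpa using hw0
  have hi' : B.repr w i ≠ 0 := Finsupp.mem_support_iff.mp hi
  let v : L := (B.repr w i)⁻¹ • w
  have hvT : v ∈ T := T.smul_mem _ hw
  have hvi : B.repr v i = 1 := by simp [v, hi']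
  have hvsupp : (B.repr v).support ⊆ (B.repr w).support := by
    simp only [v, map_smul]; exact Finsupp.support_smul
  -- The difference loses the coordinate `i`, which is 1 on both sides, and gains none; by
  -- minimality it is zero.
  have hvfix : ∀ σ : K ≃ₐ[k] K, conj F L σ v = v := by
    intro σ
    refine sub_eq_zero.mp (hmin _ (T.sub_mem (hT σ v hvT) hvT) ?_)
    refine Finset.card_lt_card ((Finset.ssubset_iff_of_subset ?_).mpr ⟨i, hi, ?_⟩)
    · intro j hj
      by_contra hj'
      have h0 : B.repr v j = 0 := by
        by_contra h; exact hj' (hvsupp (Finsupp.mem_support_iff.mpr h))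
      exact Finsupp.mem_support_iff.mp hj (by simp [hB, h0])
    · simp [hB, hvi]
  -- The coordinate `i` splits off the line of `v`; the complement is again stable, so the induction
  -- on the dimension applies.
  let T' : Submodule K L := T ⊓ LinearMap.ker (B.coord i)
  have hT'le : T' ≤ T := inf_le_left
  have hlt : T' < T := by
    refine lt_of_le_of_ne hT'le fun h => ?_
    have : v ∈ T' := h ▸ hvT
    have h2 : B.repr v i = 0 := this.2
    rw [hvi] at h2; exact one_ne_zero h2
  have : FiniteDimensional K T' := Submodule.finiteDimensional_of_le hT'le
  have hrec := ih _ (hn ▸ Submodule.finrank_lt_finrank_of_lt hlt) T' rfl (by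
    intro σ u hu
    refine ⟨hT σ u hu.1, ?_⟩
    have h2 : B.repr u i = 0 := hu.2
    change B.repr (conj F L σ u) i = 0
    rw [hB, h2, map_zero])
  intro u hu
  have hu' : u - B.repr u i • v ∈ T' :=
    ⟨T.sub_mem hu (T.smul_mem _ hvT), by
      change B.repr (u - B.repr u i • v) i = 0
      simp [hvi]⟩
  rw [← sub_add_cancel u (B.repr u i • v)]
  refine Submodule.add_mem _ (Submodule.span_mono ?_ (hrec hu'))
    (Submodule.smul_mem _ _ (Submodule.subset_span ⟨hvT, hvfix⟩))
  rintro x ⟨hx, hx'⟩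
  exact ⟨hT'le hx, hx'⟩

/-- An element of an algebraically closed algebraic extension that is fixed by all automorphisms is
purely inseparable. -/
lemma exists_pow_mem_range_of_fixed [IsAlgClosure k K] (q : ℕ) [ExpChar k q] {c : K}
    (hc : ∀ σ : K ≃ₐ[k] K, σ c = c) : ∃ n, c ^ q ^ n ∈ (algebraMap k K).range := by
  classical
  have : IsAlgClosed K := IsAlgClosure.isAlgClosed k
  have : Normal k K := IsAlgClosure.normal k K
  have hint : IsIntegral k c := Algebra.IsIntegral.isIntegral c
  -- Pure inseparability means that the minimal polynomial has only one root in `K`. All its roots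
  -- are conjugate to `c`, and `c` is fixed.
  rw [← minpoly.natSepDegree_eq_one_iff_pow_mem q, Polynomial.natSepDegree_eq_of_isAlgClosed K,
    Finset.card_eq_one]
  refine ⟨c, Finset.eq_singleton_iff_unique_mem.mpr ⟨?_, ?_⟩⟩
  · rw [Multiset.mem_toFinset, Polynomial.mem_aroots]
    exact ⟨minpoly.ne_zero hint, minpoly.aeval k c⟩
  · intro y hy
    rw [Multiset.mem_toFinset, Polynomial.mem_aroots] at hy
    have : minpoly k y = minpoly k c :=
      (minpoly.eq_of_irreducible_of_monic (minpoly.irreducible hint) hy.2 (minpoly.monic hint)).symm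
    obtain ⟨σ, hσ⟩ := (Normal.minpoly_eq_iff_mem_orbit K).mp this
    rw [← hσ]
    exact hc σ

/-- The finitely many nonzero coordinates are fixed, hence purely inseparable over `k`, and
Frobenius is additive, so one exponent serves them all. The conclusion holds for every larger
exponent, which later permits choosing one with `p ^ m` congruent to 1 modulo 3. -/
lemma exists_pow_mem_range_of_conj_eq [Algebra.IsPushout k F K L] [IsAlgClosure k K] (q : ℕ)
    [ExpChar k q] {w : L} (hw : ∀ σ : K ≃ₐ[k] K, conj F L σ w = w) :
    ∃ n, ∀ m, n ≤ m → w ^ q ^ m ∈ Set.range (algebraMap F L) := by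
  classical
  let b := Module.Basis.ofVectorSpace k F
  let B := pushoutBasis K L b
  have hfix : ∀ i, ∀ σ : K ≃ₐ[k] K, σ (B.repr w i) = B.repr w i := by
    intro i σ
    rw [← pushoutBasis_repr_conj b, hw σ]
  choose n hn using fun i => exists_pow_mem_range_of_fixed q (hfix i)
  have : ExpChar F q := expChar_of_injective_algebraMap (algebraMap k F).injective q
  have : ExpChar L q := expChar_of_injective_algebraMap (algebraMap k L).injective q
  refine ⟨(B.repr w).support.sup n, fun m hm => ?_⟩
  rw [pushoutBasis_sum (F := K) b w, Finsupp.sum, sum_pow_char_pow]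
  refine (algebraMap F L).range.sum_mem fun i hi => ?_
  obtain ⟨s, hs⟩ := Nat.exists_eq_add_of_le ((Finset.le_sup hi).trans hm : n i ≤ m)
  obtain ⟨c, hc⟩ := hn i
  rw [mul_pow]
  refine (algebraMap F L).range.mul_mem ⟨b i ^ q ^ m, by rw [map_pow]⟩ ?_
  refine ⟨algebraMap k F (c ^ q ^ s), ?_⟩
  rw [hs, ← IsScalarTower.algebraMap_apply, IsScalarTower.algebraMap_apply k K L, map_pow, hc,
    ← pow_mul, ← pow_add]
  exact map_pow _ _ _

end Descent

end SeveriBrauer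

/-! ### Homogeneous coordinates on the function field of a plane. -/

namespace SeveriBrauer

open MvPolynomial

/-- `t` is the system of affine coordinates `X₁ / X₀`, `X₂ / X₀` (and `t 0 = 1`) on the function
field `L` of the projective plane over `K`. -/
structure IsProjCoord (K : Type*) {L : Type*} [Field K] [Field L] [Algebra K L] (t : Fin 3 → L) :
    Prop where
  zero : t 0 = 1
  inj : ∀ d (f : MvPolynomial (Fin 3) K), f.IsHomogeneous d → aeval t f = 0 → f = 0
  frac : ∀ h : L, ∃ d, ∃ f g : MvPolynomial (Fin 3) K, f.IsHomogeneous d ∧ g.IsHomogeneous d ∧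
    aeval t g ≠ 0 ∧ h = aeval t f / aeval t g

/-- The coordinate ring of the chart `X_j ≠ 0`. -/
def chart (K : Type*) {L : Type*} [Field K] [Field L] [Algebra K L] (t : Fin 3 → L) (j : Fin 3) :
    Subalgebra K L :=
  Algebra.adjoin K (Set.range fun i => t i / t j)

section Coord

variable {K L : Type u} [Field K] [Field L] [Algebra K L] {t : Fin 3 → L}

lemma aeval_mul_left {d : ℕ} {f : MvPolynomial (Fin 3) K} (hf : f.IsHomogeneous d) (c : L)
    (t : Fin 3 → L) : aeval (fun i => c * t i) f = c ^ d * aeval t f := by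
  rw [aeval_eq_eval₂Hom, aeval_eq_eval₂Hom, coe_eval₂Hom, coe_eval₂Hom, eval₂_eq, eval₂_eq,
    Finset.mul_sum]
  refine Finset.sum_congr rfl fun m hm => ?_
  have hd : ∑ i, m i = d := by
    rw [← hf (mem_support_iff.mp hm), Finsupp.weight_apply, Finsupp.sum_fintype _ _ (by simp)]
    simp
  have h2 : ∀ s : Fin 3 → L, ∏ i ∈ m.support, s i ^ m i = ∏ i, s i ^ m i := fun s =>
    Finset.prod_subset (Finset.subset_univ _) fun i _ hi => by
      rw [Finsupp.notMem_support_iff.mp hi, pow_zero]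
  rw [h2, h2, ← hd, ← Finset.prod_pow_eq_pow_sum]
  simp only [mul_pow, Finset.prod_mul_distrib]
  ring

lemma aeval_div {d : ℕ} {f : MvPolynomial (Fin 3) K} (hf : f.IsHomogeneous d) (c : L)
    (t : Fin 3 → L) : aeval (fun i => t i / c) f = aeval t f / c ^ d := by
  simp_rw [div_eq_inv_mul]
  rw [aeval_mul_left hf, inv_pow]

/-- The algebra `M` is quantified after the form, so that the same homogenization can be evaluated
both in the function field and in a polynomial ring. -/
lemma exists_homogenization (P : MvPolynomial (Fin 3) K) (j : Fin 3) :
    ∃ d, ∃ f : MvPolynomial (Fin 3) K, f.IsHomogeneous d ∧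
      ∀ {M : Type u} [CommRing M] [Algebra K M] (s : Fin 3 → M), s j = 1 →
        aeval s f = aeval s P := by
  refine ⟨P.totalDegree, ∑ i ∈ Finset.range (P.totalDegree + 1),
    X j ^ (P.totalDegree - i) * homogeneousComponent i P, ?_, ?_⟩
  · refine IsHomogeneous.sum _ _ _ fun i hi => ?_
    have h := ((isHomogeneous_X K j).pow (P.totalDegree - i)).mul
      (homogeneousComponent_isHomogeneous i P)
    rwa [one_mul, Nat.sub_add_cancel (Nat.lt_succ_iff.mp (Finset.mem_range.mp hi))] at h
  · intro M _ _ s hs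
    conv_rhs => rw [← sum_homogeneousComponent P]
    simp [map_sum, hs]

lemma mem_chart_iff (j : Fin 3) (ht : t j ≠ 0) (h : L) : h ∈ chart K t j ↔
    ∃ d, ∃ f : MvPolynomial (Fin 3) K, f.IsHomogeneous d ∧ h = aeval t f / t j ^ d := by
  rw [chart, Algebra.adjoin_range_eq_range_aeval]
  constructor
  · rintro ⟨P, rfl⟩
    obtain ⟨d, f, hf, hfP⟩ := exists_homogenization P j
    refine ⟨d, f, hf, ?_⟩
    rw [← aeval_div hf, hfP (fun i => t i / t j) (div_self ht)]
    rfl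
  · rintro ⟨d, f, hf, rfl⟩
    exact ⟨f, aeval_div hf _ _⟩

/-- The component of `a * b` in degree `m + i` is `a` times the component of `b` in degree `i`, and
`a` is not a zero divisor. -/
lemma isHomogeneous_of_mul_left {m n : ℕ} {a b : MvPolynomial (Fin 3) K} (ha : a.IsHomogeneous m)
    (ha0 : a ≠ 0) (hab : (a * b).IsHomogeneous (m + n)) : b.IsHomogeneous n := by
  have key : ∀ i, i ≠ n → homogeneousComponent i b = 0 := by
    intro i hi
    have h1 := DirectSum.coe_decompose_mul_add_of_left_mem (homogeneousSubmodule (Fin 3) K)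
      (a := a) (b := b) (i := m) (j := i) ha
    have h2 : (DirectSum.decompose (homogeneousSubmodule (Fin 3) K) (a * b) (m + i) :
        MvPolynomial (Fin 3) K) = 0 :=
      DirectSum.decompose_of_mem_ne _ (hab : a * b ∈ homogeneousSubmodule (Fin 3) K (m + n))
        (by omega)
    rw [h2] at h1
    have h3 : (DirectSum.decompose (homogeneousSubmodule (Fin 3) K) b i :
        MvPolynomial (Fin 3) K) = homogeneousComponent i b := decomposition.decompose'_apply b i
    rw [h3] at h1
    exact (mul_eq_zero.mp h1.symm).resolve_left ha0
  have hb : b = homogeneousComponent n b := by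
    conv_lhs => rw [← sum_homogeneousComponent b]
    by_cases hn : n ∈ Finset.range (b.totalDegree + 1)
    · exact Finset.sum_eq_single_of_mem n hn fun i _ hi => key i hi
    · rw [Finset.sum_eq_zero, homogeneousComponent_eq_zero]
      · simpa [Nat.lt_succ_iff] using hn
      · intro i hi
        exact key i fun h => hn (h ▸ hi)
  rw [hb]
  exact homogeneousComponent_isHomogeneous n b

lemma X_pow_dvd_of_dvd_mul {i j : Fin 3} (hij : i ≠ j) {d e : ℕ} {f : MvPolynomial (Fin 3) K}
    (h : X i ^ d ∣ X j ^ e * f) : X i ^ d ∣ f :=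
  (X_prime (i := i)).pow_dvd_of_dvd_mul_left d
    (fun hd => hij (X_dvd_X.mp ((X_prime (i := i)).dvd_of_dvd_pow hd))) h

namespace IsProjCoord

lemma ne_zero (ht : IsProjCoord K t) (j : Fin 3) : t j ≠ 0 := fun h =>
  X_ne_zero (R := K) j (ht.inj 1 (X j) (isHomogeneous_X K j) (by simpa using h))

lemma aeval_ne_zero (ht : IsProjCoord K t) {d : ℕ} {f : MvPolynomial (Fin 3) K}
    (hf : f.IsHomogeneous d) (h0 : f ≠ 0) : aeval t f ≠ 0 := fun h => h0 (ht.inj d f hf h)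

lemma aeval_inj (ht : IsProjCoord K t) {d : ℕ} {f g : MvPolynomial (Fin 3) K}
    (hf : f.IsHomogeneous d) (hg : g.IsHomogeneous d) (h : aeval t f = aeval t g) : f = g :=
  sub_eq_zero.mp (ht.inj d _ (hf.sub hg) (by rw [map_sub, h, sub_self]))

/-- The projective plane has the expected derivations. -/
lemma exists_derivation (ht : IsProjCoord K t) (a : Fin 2 → L) :
    ∃ D : Derivation K L L, D (t 1) = a 0 ∧ D (t 2) = a 1 := by
  let φ : (MvPolynomial (Fin 2) K) →ₐ[K] L := aeval ![t 1, t 2]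
  let : Algebra (MvPolynomial (Fin 2) K) L := φ.toRingHom.toAlgebra
  have hmap : ∀ s : (MvPolynomial (Fin 2) K), algebraMap (MvPolynomial (Fin 2) K) L s = φ s := fun _ => rfl
  have : IsScalarTower K (MvPolynomial (Fin 2) K) L := IsScalarTower.of_algebraMap_eq fun c => (φ.commutes c).symm
  let ψ : MvPolynomial (Fin 3) K →ₐ[K] (MvPolynomial (Fin 2) K) := aeval ![1, X 0, X 1]
  have hφψ : ∀ f, φ (ψ f) = aeval t f := by
    intro f
    rw [← AlgHom.comp_apply]
    congr 1
    refine MvPolynomial.algHom_ext fun i => ?_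
    fin_cases i <;> simp [φ, ψ, ht.zero]
  have hinj : Function.Injective φ := by
    rw [injective_iff_map_eq_zero]
    intro P hP
    let ρ : (MvPolynomial (Fin 2) K) →ₐ[K] MvPolynomial (Fin 3) K := aeval ![X 1, X 2]
    have hρ : ∀ P, ψ (ρ P) = P := by
      intro P
      rw [← AlgHom.comp_apply]
      conv_rhs => rw [← AlgHom.id_apply (R := K) P]
      congr 1
      refine MvPolynomial.algHom_ext fun i => ?_
      fin_cases i <;> simp [ψ, ρ, AlgHom.id_apply]
    obtain ⟨d, f, hf, hfP⟩ := exists_homogenization (ρ P) 0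
    have h0 : f = 0 := ht.inj d f hf (by rw [hfP t ht.zero, ← hφψ, hρ, hP])
    have := hfP (M := (MvPolynomial (Fin 2) K)) ![1, X 0, X 1] rfl
    rw [h0, map_zero] at this
    rw [← hρ P]
    exact this.symm
  have : FaithfulSMul (MvPolynomial (Fin 2) K) L := (faithfulSMul_iff_algebraMap_injective (MvPolynomial (Fin 2) K) L).mpr hinj
  have : IsFractionRing (MvPolynomial (Fin 2) K) L := by
    refine IsFractionRing.of_field (MvPolynomial (Fin 2) K) L fun z => ?_
    obtain ⟨d, f, g, hf, hg, hg0, rfl⟩ := ht.frac z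
    exact ⟨ψ f, ψ g, by rw [hmap, hmap, hφψ, hφψ]⟩
  -- `L` is the fraction field of the polynomial ring in `t 1`, `t 2`. Differentials commute with
  -- this localization, so a derivation prescribed on the two variables extends to `L`.
  have : Algebra.FormallyEtale (MvPolynomial (Fin 2) K) L :=
    Algebra.FormallyEtale.of_isLocalization (nonZeroDivisors (MvPolynomial (Fin 2) K))
  let D₀ : Derivation K (MvPolynomial (Fin 2) K) L := mkDerivation K a
  let h := KaehlerDifferential.isBaseChange_of_formallyEtale K (MvPolynomial (Fin 2) K) L
  let ℓ : Ω[L⁄K] →ₗ[L] L := h.lift D₀.liftKaehlerDifferential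
  have hD : ∀ s : (MvPolynomial (Fin 2) K), ℓ (KaehlerDifferential.D K L (algebraMap (MvPolynomial (Fin 2) K) L s)) = D₀ s := by
    intro s
    have := h.lift_eq D₀.liftKaehlerDifferential (KaehlerDifferential.D K (MvPolynomial (Fin 2) K) s)
    simpa using this
  refine ⟨ℓ.compDer (KaehlerDifferential.D K L), ?_, ?_⟩
  · have := hD (X 0)
    simpa [hmap, φ, D₀, mkDerivation_X] using this
  · have := hD (X 1)
    simpa [hmap, φ, D₀, mkDerivation_X] using this

end IsProjCoord

end Coord

end SeveriBrauer

/-! ### Bivector fields as alternating biderivations, and cubic forms. -/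

namespace SeveriBrauer

open MvPolynomial

/-- An alternating `K`-bilinear map on `L` that is a derivation in each variable. -/
structure IsAltBider (K : Type*) {L : Type*} [Field K] [Field L] [Algebra K L] (β : L → L → L) :
    Prop where
  add_left : ∀ u v w, β (u + v) w = β u w + β v w
  smul_left : ∀ (c : K) u w, β (c • u) w = c • β u w
  mul_left : ∀ u v w, β (u * v) w = u * β v w + v * β u w
  swap : ∀ u v, β u v = -β v u
  self : ∀ u, β u u = 0

namespace IsAltBider

variable {K L : Type*} [Field K] [Field L] [Algebra K L] {β γ : L → L → L}

lemma add_right (h : IsAltBider K β) (u v w : L) : β w (u + v) = β w u + β w v := by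
  rw [h.swap, h.add_left, h.swap u, h.swap v]; ring

lemma mul_right (h : IsAltBider K β) (u v w : L) : β w (u * v) = u * β w v + v * β w u := by
  rw [h.swap, h.mul_left, h.swap u, h.swap v]; ring

lemma smul_right (h : IsAltBider K β) (c : K) (u w : L) : β w (c • u) = c • β w u := by
  rw [h.swap, h.smul_left, h.swap u, smul_neg, neg_neg]

lemma zero_left (h : IsAltBider K β) (w : L) : β 0 w = 0 := by
  simpa using h.smul_left 0 0 w

lemma zero_right (h : IsAltBider K β) (w : L) : β w 0 = 0 := by
  rw [h.swap, h.zero_left, neg_zero]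

lemma one_left (h : IsAltBider K β) (w : L) : β 1 w = 0 := by
  have := h.mul_left 1 1 w
  simpa using this

lemma one_right (h : IsAltBider K β) (w : L) : β w 1 = 0 := by
  rw [h.swap, h.one_left, neg_zero]

lemma algebraMap_left (h : IsAltBider K β) (c : K) (w : L) : β (algebraMap K L c) w = 0 := by
  rw [Algebra.algebraMap_eq_smul_one, h.smul_left, h.one_left, smul_zero]

lemma algebraMap_right (h : IsAltBider K β) (c : K) (w : L) : β w (algebraMap K L c) = 0 := by
  rw [h.swap, h.algebraMap_left, neg_zero]

lemma div_left (h : IsAltBider K β) {u v : L} (hv : v ≠ 0) (w : L) :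
    β (u / v) w = (v * β u w - u * β v w) / v ^ 2 := by
  have := h.mul_left (u / v) v w
  rw [div_mul_cancel₀ _ hv] at this
  rw [this]
  field_simp
  ring

lemma div_right (h : IsAltBider K β) {u v : L} (hv : v ≠ 0) (w : L) :
    β w (u / v) = (v * β w u - u * β w v) / v ^ 2 := by
  rw [h.swap, h.div_left hv, h.swap u, h.swap v]; ring

/-- The numerator is alternating in `u`, `v`, `s`. The exponent 3 of the denominator is the reason
why bivector fields on the plane correspond to forms of degree 3. -/
lemma div_div (h : IsAltBider K β) {u v s : L} (hs : s ≠ 0) :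
    β (u / s) (v / s) = (s * β u v - u * β s v + v * β s u) / s ^ 3 := by
  rw [h.div_left hs, h.div_right hs, h.div_right hs, h.self, h.swap u s]
  field_simp
  ring

lemma mem_adjoin (h : IsAltBider K β) {s : Set L}
    (hs : ∀ x ∈ s, ∀ y ∈ s, β x y ∈ Algebra.adjoin K s) {u v : L}
    (hu : u ∈ Algebra.adjoin K s) (hv : v ∈ Algebra.adjoin K s) : β u v ∈ Algebra.adjoin K s := by
  have key : ∀ x ∈ s, β x v ∈ Algebra.adjoin K s := by
    intro x hx
    induction hv using Algebra.adjoin_induction with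
    | mem y hy => exact hs x hx y hy
    | algebraMap r => rw [h.algebraMap_right]; exact zero_mem _
    | add y z _ _ hy hz => rw [h.add_right]; exact add_mem hy hz
    | mul y z hy' hz' hy hz => rw [h.mul_right]; exact add_mem (mul_mem hy' hz) (mul_mem hz' hy)
  induction hu using Algebra.adjoin_induction with
  | mem y hy => exact key y hy
  | algebraMap r => rw [h.algebraMap_left]; exact zero_mem _
  | add y z _ _ hy hz => rw [h.add_left]; exact add_mem hy hz
  | mul y z hy' hz' hy hz => rw [h.mul_left]; exact add_mem (mul_mem hy' hz) (mul_mem hz' hy)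

lemma mul_const (h : IsAltBider K β) (θ : L) : IsAltBider K fun u v => θ * β u v where
  add_left u v w := by rw [h.add_left, mul_add]
  smul_left c u w := by rw [h.smul_left, mul_smul_comm]
  mul_left u v w := by rw [h.mul_left]; ring
  swap u v := by rw [h.swap]; ring
  self u := by rw [h.self, mul_zero]

lemma sub (h : IsAltBider K β) (h' : IsAltBider K γ) : IsAltBider K fun u v => β u v - γ u v where
  add_left u v w := by rw [h.add_left, h'.add_left]; ring
  smul_left c u w := by rw [h.smul_left, h'.smul_left, smul_sub]
  mul_left u v w := by rw [h.mul_left, h'.mul_left]; ring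
  swap u v := by rw [h.swap, h'.swap]; ring
  self u := by rw [h.self, h'.self, sub_zero]

end IsAltBider

section

variable {K L : Type u} [Field K] [Field L] [Algebra K L] {t : Fin 3 → L} {β : L → L → L}

namespace IsProjCoord

/-- Elements of `L` are fractions of polynomials in the `t i`; since `t 0 = 1`, alternation leaves
only the value at `t 1`, `t 2`. Hence biderivations form a space of dimension one over `L`, which is
`bider_eq`. -/
lemma bider_eq_zero (ht : IsProjCoord K t) (h : IsAltBider K β) (h12 : β (t 1) (t 2) = 0)
    (u v : L) : β u v = 0 := by
  have hgen : ∀ i j, β (t i) (t j) = 0 := by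
    intro i j
    have h0 : ∀ w, β (t 0) w = 0 := fun w => by rw [ht.zero, h.one_left]
    have h0' : ∀ w, β w (t 0) = 0 := fun w => by rw [h.swap, h0, neg_zero]
    fin_cases i <;> fin_cases j <;> simp [h0, h0', h.self, h12]
    rw [h.swap, h12, neg_zero]
  have hpol : ∀ i (g : MvPolynomial (Fin 3) K), β (t i) (aeval t g) = 0 := by
    intro i g
    induction g using MvPolynomial.induction_on with
    | C a => rw [aeval_C, h.algebraMap_right]
    | add p q hp hq => rw [map_add, h.add_right, hp, hq, add_zero]
    | mul_X p j hp => rw [map_mul, aeval_X, h.mul_right, hp, hgen]; ring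
  have hpol2 : ∀ f g : MvPolynomial (Fin 3) K, β (aeval t f) (aeval t g) = 0 := by
    intro f g
    induction f using MvPolynomial.induction_on with
    | C a => rw [aeval_C, h.algebraMap_left]
    | add p q hp hq => rw [map_add, h.add_left, hp, hq, add_zero]
    | mul_X p j hp => rw [map_mul, aeval_X, h.mul_left, hp, hpol]; ring
  obtain ⟨d, f, g, -, -, hg0, rfl⟩ := ht.frac u
  obtain ⟨d', f', g', -, -, hg0', rfl⟩ := ht.frac v
  rw [h.div_left hg0, h.div_right hg0', h.div_right hg0', hpol2, hpol2, hpol2, hpol2]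
  simp

lemma exists_bider (ht : IsProjCoord K t) : ∃ β : L → L → L, IsAltBider K β ∧ β (t 1) (t 2) = 1 := by
  obtain ⟨D, hD1, hD2⟩ := ht.exists_derivation ![1, 0]
  obtain ⟨E, hE1, hE2⟩ := ht.exists_derivation ![0, 1]
  refine ⟨fun u v => D u * E v - E u * D v, ⟨?_, ?_, ?_, ?_, ?_⟩, ?_⟩
  · intro u v w; simp only [map_add]; ring
  · intro c u w; rw [D.map_smul, E.map_smul, smul_mul_assoc, smul_mul_assoc, smul_sub]
  · intro u v w; simp only [Derivation.leibniz, smul_eq_mul]; ring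
  · intro u v; ring
  · intro u; ring
  · simp [hD1, hD2, hE1, hE2]

lemma bider_eq (ht : IsProjCoord K t) {γ : L → L → L} (h : IsAltBider K β) (h' : IsAltBider K γ)
    (h12 : γ (t 1) (t 2) = 1) (u v : L) : β u v = β (t 1) (t 2) * γ u v := by
  have := ht.bider_eq_zero (h.sub (h'.mul_const (β (t 1) (t 2)))) (by rw [h12]; ring) u v
  exact sub_eq_zero.mp this

/-- The bivector field defined by a cubic form is regular on all charts. -/
lemma bider_mem_chart (ht : IsProjCoord K t) (h : IsAltBider K β) {g : MvPolynomial (Fin 3) K}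
    (hg : g.IsHomogeneous 3) (h12 : β (t 1) (t 2) = aeval t g) (j : Fin 3) {u v : L}
    (hu : u ∈ chart K t j) (hv : v ∈ chart K t j) : β u v ∈ chart K t j := by
  have hgj : aeval t g / t j ^ 3 ∈ chart K t j :=
    (mem_chart_iff j (ht.ne_zero j) _).mpr ⟨3, g, hg, rfl⟩
  have h21 : β (t 2) (t 1) = -aeval t g := by rw [h.swap, h12]
  refine h.mem_adjoin ?_ hu hv
  rintro _ ⟨a, rfl⟩ _ ⟨b, rfl⟩
  change _ ∈ chart K t j
  have hj := ht.ne_zero j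
  -- The expression is alternating in `j`, `a`, `b`. So `n` is 0 if two indices agree and otherwise
  -- plus or minus 1.
  have hval : ∃ n : ℤ, t j * β (t a) (t b) - t a * β (t j) (t b) + t b * β (t j) (t a) =
      n * aeval t g := by
    have e0 := ht.zero
    fin_cases j <;> fin_cases a <;> fin_cases b <;>
      simp only [Fin.zero_eta, Fin.mk_one, Fin.reduceFinMk, e0, h.one_left, h.one_right, h12, h21,
        h.self] <;>
      first
      | exact ⟨0, by push_cast; ring1⟩
      | exact ⟨1, by push_cast; ring1⟩
      | exact ⟨-1, by push_cast; ring1⟩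
  obtain ⟨n, hn⟩ := hval
  rw [h.div_div hj, hn, mul_div_assoc, ← zsmul_eq_mul]
  exact zsmul_mem hgj n

/-- Conversely a global bivector field is given by a cubic form. -/
lemma exists_cubic (ht : IsProjCoord K t) (h : IsAltBider K β)
    (hC : ∀ j, ∀ u ∈ chart K t j, ∀ v ∈ chart K t j, β u v ∈ chart K t j) :
    ∃ g : MvPolynomial (Fin 3) K, g.IsHomogeneous 3 ∧ β (t 1) (t 2) = aeval t g := by
  have hmem : ∀ i j, t i / t j ∈ chart K t j := fun i j => Algebra.subset_adjoin ⟨i, rfl⟩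
  have h0 : β (t 1) (t 2) ∈ chart K t 0 := by
    have h1 := hmem 1 0
    have h2 := hmem 2 0
    rw [ht.zero, div_one] at h1 h2
    exact hC 0 _ h1 _ h2
  -- On the chart 1, the coordinates `t 0 / t 1` and `t 2 / t 1` have bracket `-β (t 1) (t 2) / t 1
  -- ^ 3`.
  have h1 : β (t 1) (t 2) / t 1 ^ 3 ∈ chart K t 1 := by
    have := hC 1 _ (hmem 0 1) _ (hmem 2 1)
    have hne := ht.ne_zero 1
    rw [h.div_div hne, ht.zero, h.one_left, h.swap (t 1) 1, h.one_left] at this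
    convert neg_mem this using 1
    ring
  rw [mem_chart_iff 0 (ht.ne_zero 0)] at h0
  rw [mem_chart_iff 1 (ht.ne_zero 1)] at h1
  obtain ⟨d, f, hf, hfe⟩ := h0
  obtain ⟨e, f', hf', hfe'⟩ := h1
  rw [ht.zero, one_pow, div_one] at hfe
  have heq : X 1 ^ e * (X 0 ^ 3 * f) = X 1 ^ 3 * X 0 ^ d * f' := by
    refine ht.aeval_inj (d := e + (3 + d)) ?_ ?_ ?_
    · simpa using ((isHomogeneous_X K (1 : Fin 3)).pow e).mul
        (((isHomogeneous_X K (0 : Fin 3)).pow 3).mul hf)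
    · have := (((isHomogeneous_X K (1 : Fin 3)).pow 3).mul
        ((isHomogeneous_X K (0 : Fin 3)).pow d)).mul hf'
      convert this using 1
      ring
    · simp only [map_mul, map_pow, aeval_X, ht.zero, one_pow, one_mul, mul_one, ← hfe]
      have hne := ht.ne_zero 1
      field_simp at hfe'
      rw [← hfe', mul_comm]
  -- Two charts suffice: the first allows only powers of `X 0` in the denominator, the second only
  -- `X 1`, and these are coprime. The quotient is the cubic form.
  have hdvd : (X 0 : MvPolynomial (Fin 3) K) ^ d ∣ X 0 ^ 3 * f :=
    X_pow_dvd_of_dvd_mul (j := 1) (e := e) (by decide)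
      ⟨X 1 ^ 3 * f', by rw [heq]; ring⟩
  obtain ⟨g, hg⟩ := hdvd
  refine ⟨g, isHomogeneous_of_mul_left (m := d) (a := X 0 ^ d) ?_ (pow_ne_zero _ (X_ne_zero _)) ?_,
    ?_⟩
  · simpa using (isHomogeneous_X K (0 : Fin 3)).pow d
  · rw [← hg, add_comm d]
    simpa using ((isHomogeneous_X K (0 : Fin 3)).pow 3).mul hf
  · have := congrArg (aeval t) hg
    simpa [ht.zero, ← hfe] using this

end IsProjCoord

end

end SeveriBrauer

/-! ### Bivector fields and cubic forms are defined over `F`. -/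

namespace SeveriBrauer

open MvPolynomial

section

variable {k K F L : Type*} [Field k] [Field K] [Field F] [Field L] [Algebra k K] [Algebra k F]
  [Algebra K L] [Algebra F L] [Algebra k L] [IsScalarTower k K L] [IsScalarTower k F L]
  [Algebra.IsPushout k F K L]

lemma mem_span_range_algebraMap (k : Type*) {K F L : Type*} [Field k] [Field K] [Field F] [Field L]
    [Algebra k K] [Algebra k F] [Algebra K L] [Algebra F L] [Algebra k L] [IsScalarTower k K L]
    [IsScalarTower k F L] [Algebra.IsPushout k F K L] (w : L) :
    w ∈ Submodule.span K (Set.range (algebraMap F L)) := by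
  rw [pushoutBasis_sum (F := F) (Module.Basis.ofVectorSpace k K) w]
  refine Submodule.sum_mem _ fun i _ => ?_
  dsimp only
  rw [← Algebra.smul_def]
  exact Submodule.smul_mem _ _ (Submodule.subset_span ⟨_, rfl⟩)

variable (K L) in
/-- Extension of scalars of a bilinear map. -/
lemma exists_bilinear_extension (β : F →ₗ[k] F →ₗ[k] F) : ∃ γ : L →ₗ[K] L →ₗ[K] L,
    ∀ r s : F, γ (algebraMap F L r) (algebraMap F L s) = algebraMap F L (β r s) := by
  have h := Algebra.IsPushout.out (R := k) (S := K) (R' := F) (S' := L)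
  let ι : F →ₗ[k] L := (IsScalarTower.toAlgHom k F L).toLinearMap
  let β₁ : F →ₗ[k] (L →ₗ[K] L) :=
    { toFun := fun r => h.lift (ι ∘ₗ β r)
      map_add' := fun r r' => by
        refine h.algHom_ext _ _ fun s => ?_
        rw [LinearMap.add_apply, h.lift_eq, h.lift_eq, h.lift_eq]
        simp
      map_smul' := fun c r => by
        refine h.algHom_ext _ _ fun s => ?_
        rw [RingHom.id_apply, LinearMap.smul_apply, h.lift_eq, h.lift_eq]
        simp }
  refine ⟨h.lift β₁, fun r s => ?_⟩
  have h1 : h.lift β₁ (algebraMap F L r) = β₁ r := h.lift_eq β₁ r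
  rw [h1]
  exact h.lift_eq (ι ∘ₗ β r) s

/-- The components of an alternating biderivation of `K ⊗ F` are such. -/
lemma exists_component_bider {ι : Type*} (κ : Module.Basis ι k K) {β : L → L → L}
    (hβ : IsAltBider K β) (i : ι) : ∃ γ : L → L → L, IsAltBider K γ ∧
      ∀ r s : F, γ (algebraMap F L r) (algebraMap F L s) =
        algebraMap F L ((pushoutBasis F L κ).repr (β (algebraMap F L r) (algebraMap F L s)) i) := by
  have hk : ∀ (c : k) (r : F), algebraMap F L (c • r) = (algebraMap k K c) • algebraMap F L r := by
    intro c r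
    rw [Algebra.smul_def, map_mul, ← IsScalarTower.algebraMap_apply, Algebra.smul_def,
      ← IsScalarTower.algebraMap_apply]
  have hk2 : ∀ (c : k) (w : L), (algebraMap k K c) • w = (algebraMap k F c) • w := by
    intro c w
    rw [Algebra.smul_def, Algebra.smul_def, ← IsScalarTower.algebraMap_apply,
      ← IsScalarTower.algebraMap_apply]
  have hF : ∀ (r : F) (w : L), (pushoutBasis F L κ).repr (algebraMap F L r * w) i =
      r * (pushoutBasis F L κ).repr w i := by
    intro r w
    rw [← Algebra.smul_def, map_smul, Finsupp.smul_apply, smul_eq_mul]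
  -- The `i`-th coordinate of `β` restricted to `F`. Its `K`-bilinear extension inherits the
  -- identities, since these hold on `F` and `F` spans `L`.
  let β' : F →ₗ[k] F →ₗ[k] F := LinearMap.mk₂ k
    (fun r s => (pushoutBasis F L κ).repr (β (algebraMap F L r) (algebraMap F L s)) i)
    (fun r r' s => by rw [map_add, hβ.add_left, map_add, Finsupp.add_apply])
    (fun c r s => by
      rw [hk, hβ.smul_left, hk2, map_smul, Finsupp.smul_apply, smul_eq_mul, Algebra.smul_def])
    (fun r s s' => by rw [map_add, hβ.add_right, map_add, Finsupp.add_apply])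
    (fun c r s => by
      rw [hk, hβ.smul_right, hk2, map_smul, Finsupp.smul_apply, smul_eq_mul, Algebra.smul_def])
  obtain ⟨γ, hγ⟩ := exists_bilinear_extension K L β'
  have hβ' : ∀ r s, β' r s =
      (pushoutBasis F L κ).repr (β (algebraMap F L r) (algebraMap F L s)) i := fun _ _ => rfl
  have hswap : ∀ u v, γ u v = -γ v u := by
    intro u v
    induction mem_span_range_algebraMap k (F := F) (K := K) u using
      Submodule.span_induction with
    | mem x hx =>
      obtain ⟨r, rfl⟩ := hx
      induction mem_span_range_algebraMap k (F := F) (K := K) v using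
        Submodule.span_induction with
      | mem y hy =>
        obtain ⟨s, rfl⟩ := hy
        rw [hγ, hγ, hβ', hβ', hβ.swap, map_neg, Finsupp.neg_apply, map_neg]
      | zero => simp
      | add y z _ _ hy hz => rw [map_add, hy, hz, map_add, LinearMap.add_apply, neg_add]
      | smul c y _ hy => rw [map_smul, hy, map_smul, LinearMap.smul_apply, smul_neg]
    | zero => simp
    | add y z _ _ hy hz => rw [map_add, LinearMap.add_apply, hy, hz, map_add, neg_add]
    | smul c y _ hy => rw [map_smul, LinearMap.smul_apply, hy, map_smul, smul_neg]
  -- This is quadratic in `u`, so the additive step needs `hswap` for the cross terms.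
  have hself : ∀ u, γ u u = 0 := by
    intro u
    induction mem_span_range_algebraMap k (F := F) (K := K) u using
      Submodule.span_induction with
    | mem x hx =>
      obtain ⟨r, rfl⟩ := hx
      rw [hγ, hβ', hβ.self]; simp
    | zero => simp
    | add y z _ _ hy hz =>
      simp only [map_add, LinearMap.add_apply, hy, hz, hswap y z]; ring
    | smul c y _ hy => simp [hy]
  have hmul : ∀ u v w, γ (u * v) w = u * γ v w + v * γ u w := by
    intro u v w
    induction mem_span_range_algebraMap k (F := F) (K := K) w using
      Submodule.span_induction with
    | mem x hx =>
      obtain ⟨r, rfl⟩ := hx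
      induction mem_span_range_algebraMap k (F := F) (K := K) u using
        Submodule.span_induction with
      | mem x hx =>
        obtain ⟨s, rfl⟩ := hx
        induction mem_span_range_algebraMap k (F := F) (K := K) v using
          Submodule.span_induction with
        | mem x hx =>
          obtain ⟨s', rfl⟩ := hx
          rw [← map_mul, hγ, hγ, hγ, hβ', hβ', hβ', map_mul, hβ.mul_left, map_add,
            Finsupp.add_apply, hF, hF, map_add, map_mul, map_mul]
        | zero => simp
        | add y z _ _ hy hz =>
          rw [mul_add, map_add, LinearMap.add_apply, hy, hz, map_add, LinearMap.add_apply]; ring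
        | smul c y _ hy =>
          rw [mul_smul_comm, map_smul, LinearMap.smul_apply, hy, map_smul, LinearMap.smul_apply,
            smul_add, mul_smul_comm, smul_mul_assoc]
      | zero => simp
      | add y z _ _ hy hz =>
        rw [add_mul, map_add, LinearMap.add_apply, hy, hz, map_add, LinearMap.add_apply]; ring
      | smul c y _ hy =>
        rw [smul_mul_assoc, map_smul, LinearMap.smul_apply, hy, map_smul, LinearMap.smul_apply,
          smul_add, mul_smul_comm, smul_mul_assoc]
    | zero => simp
    | add y z _ _ hy hz => rw [map_add, hy, hz, map_add, map_add]; ring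
    | smul c y _ hy =>
      rw [map_smul, hy, map_smul, map_smul, smul_add, mul_smul_comm, mul_smul_comm]
  exact ⟨fun u v => γ u v, ⟨fun u v w => by rw [map_add, LinearMap.add_apply],
    fun c u w => by rw [map_smul, LinearMap.smul_apply], hmul, hswap, hself⟩, hγ⟩

end

section

variable {k K F L : Type u} [Field k] [Field K] [Field F] [Field L] [Algebra k K] [Algebra k F]
  [Algebra K L] [Algebra F L] [Algebra k L] [IsScalarTower k K L] [IsScalarTower k F L]
  [Algebra.IsPushout k F K L]

/-- Cubic forms are defined over `F`, after multiplication by a suitable function `h₀`. -/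
theorem IsProjCoord.exists_span_cubic {t : Fin 3 → L} (ht : IsProjCoord K t) {I : Type*}
    (A : I → Subalgebra k F)
    (hA : ∀ β : L → L → L, IsAltBider K β →
      ((∀ j, ∀ u ∈ chart K t j, ∀ v ∈ chart K t j, β u v ∈ chart K t j) ↔
        ∀ i, ∀ u ∈ Submodule.span K (algebraMap F L '' A i),
          ∀ v ∈ Submodule.span K (algebraMap F L '' A i),
            β u v ∈ Submodule.span K (algebraMap F L '' A i))) :
    ∃ h₀ : L, h₀ ≠ 0 ∧ ∀ g : MvPolynomial (Fin 3) K, g.IsHomogeneous 3 →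
      g ∈ Submodule.span K {s : MvPolynomial (Fin 3) K |
        s.IsHomogeneous 3 ∧ aeval t s * h₀ ∈ Set.range (algebraMap F L)} := by
  classical
  obtain ⟨β₀, hβ₀, h12⟩ := ht.exists_bider
  -- The function `h₀` is a nonzero value of the standard bivector field `β₀` at two elements of
  -- `F`; such a pair exists because `F` spans `L`.
  obtain ⟨r, s, hrs⟩ : ∃ r s : F, β₀ (algebraMap F L r) (algebraMap F L s) ≠ 0 := by
    by_contra! hcon
    have : ∀ x y, β₀ x y = 0 := by
      intro x y
      induction mem_span_range_algebraMap k (F := F) (K := K) x using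
        Submodule.span_induction with
      | mem x hx =>
        obtain ⟨r, rfl⟩ := hx
        induction mem_span_range_algebraMap k (F := F) (K := K) y using
          Submodule.span_induction with
        | mem x hx => obtain ⟨s, rfl⟩ := hx; exact hcon r s
        | zero => exact hβ₀.zero_right _
        | add y z _ _ hy hz => rw [hβ₀.add_right, hy, hz, add_zero]
        | smul c y _ hy => rw [hβ₀.smul_right, hy, smul_zero]
      | zero => exact hβ₀.zero_left _
      | add y z _ _ hy hz => rw [hβ₀.add_left, hy, hz, add_zero]
      | smul c y _ hy => rw [hβ₀.smul_left, hy, smul_zero]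
    exact one_ne_zero (h12.symm.trans (this _ _))
  refine ⟨β₀ (algebraMap F L r) (algebraMap F L s), hrs, fun g hg => ?_⟩
  let κ := Module.Basis.ofVectorSpace k K
  -- The bivector field attached to the cubic form `g`; it is regular on the charts, hence on the
  -- affine opens described by the `A i`.
  let β : L → L → L := fun u v => aeval t g * β₀ u v
  have hβ : IsAltBider K β := hβ₀.mul_const _
  have hβ12 : β (t 1) (t 2) = aeval t g := by simp [β, h12]
  have hβA := (hA β hβ).mp fun j u hu v hv => ht.bider_mem_chart hβ hg hβ12 j hu hv
  -- The components of `β` along the basis of `K` preserve the same subspaces, because these are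
  -- spanned by the `A i`. So each component is again regular on the charts and equals `β₀` times a
  -- cubic form `gi`; evaluated at `r`, `s` it shows that `gi * h₀` lies in `F`.
  have hcomp : ∀ i, ∃ gi : MvPolynomial (Fin 3) K, gi.IsHomogeneous 3 ∧
      ∀ r s : F, aeval t gi * β₀ (algebraMap F L r) (algebraMap F L s) =
        algebraMap F L ((pushoutBasis F L κ).repr (β (algebraMap F L r) (algebraMap F L s)) i) := by
    intro i
    obtain ⟨γ, hγ, hγe⟩ := exists_component_bider (F := F) κ hβ i
    obtain ⟨gi, hgi, hgie⟩ := ht.exists_cubic hγ <| (hA γ hγ).mpr <| by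
      intro j u hu v hv
      induction hu using Submodule.span_induction with
      | mem x hx =>
        obtain ⟨r, hr, rfl⟩ := hx
        induction hv using Submodule.span_induction with
        | mem y hy =>
          obtain ⟨s, hs, rfl⟩ := hy
          rw [hγe]
          refine Submodule.subset_span ⟨_, ?_, rfl⟩
          exact repr_mem_of_mem_span (T := (A j).toSubmodule) κ
            (hβA j _ (Submodule.subset_span ⟨r, hr, rfl⟩) _ (Submodule.subset_span ⟨s, hs, rfl⟩)) i
        | zero => rw [hγ.zero_right]; exact zero_mem _
        | add y z _ _ hy hz => rw [hγ.add_right]; exact add_mem hy hz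
        | smul c y _ hy => rw [hγ.smul_right]; exact Submodule.smul_mem _ _ hy
      | zero => rw [hγ.zero_left]; exact zero_mem _
      | add y z _ _ hy hz => rw [hγ.add_left]; exact add_mem hy hz
      | smul c y _ hy => rw [hγ.smul_left]; exact Submodule.smul_mem _ _ hy
    exact ⟨gi, hgi, fun r s => by rw [← hγe, ht.bider_eq hγ hβ₀ h12, hgie]⟩
  choose gi hgi hgie using hcomp
  have hsum : g = ∑ i ∈ ((pushoutBasis F L κ).repr
      (β (algebraMap F L r) (algebraMap F L s))).support, κ i • gi i := by
    refine ht.aeval_inj hg (IsHomogeneous.sum _ _ _ fun i _ => ?_) ?_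
    · exact (homogeneousSubmodule (Fin 3) K 3).smul_mem _ (hgi i)
    · refine mul_right_cancel₀ hrs ?_
      change β (algebraMap F L r) (algebraMap F L s) = _
      conv_lhs => rw [pushoutBasis_sum (F := F) κ (β (algebraMap F L r) (algebraMap F L s))]
      rw [Finsupp.sum, map_sum, Finset.sum_mul]
      refine Finset.sum_congr rfl fun i _ => ?_
      rw [← hgie, map_smul, Algebra.smul_def, mul_assoc]
  rw [hsum]
  exact Submodule.sum_mem _ fun i _ => Submodule.smul_mem _ _
    (Submodule.subset_span ⟨hgi i, _, (hgie i r s).symm⟩)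

end

end SeveriBrauer

/-! ### From an invariant curve to linear forms with ratios in `F`. -/

namespace SeveriBrauer

open MvPolynomial

section Forms

variable {k K F L : Type u} [Field k] [Field K] [Field F] [Field L] [Algebra k K] [Algebra k F]
  [Algebra K L] [Algebra F L] [Algebra k L] [IsScalarTower k K L] [IsScalarTower k F L]
  {t : Fin 3 → L} {h₀ : L}

/-- The `K`-space of the functions `w · f`, where `f` is a form of degree `d` (in the coordinates
`t`). -/
noncomputable def formSpace (t : Fin 3 → L) (w : L) (d : ℕ) : Submodule K L :=
  (homogeneousSubmodule (Fin 3) K d).map (LinearMap.mulLeft K w ∘ₗ (aeval t).toLinearMap)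

lemma mem_formSpace {w z : L} {d : ℕ} : z ∈ formSpace (K := K) t w d ↔
    ∃ f : MvPolynomial (Fin 3) K, f.IsHomogeneous d ∧ w * aeval t f = z := by
  simp [formSpace, Submodule.mem_map]

lemma linearIndependent_X : LinearIndependent K (X : Fin 3 → MvPolynomial (Fin 3) K) := by
  rw [Fintype.linearIndependent_iff]
  intro g hg i
  have := congrArg (coeff (Finsupp.single i 1)) hg
  simpa [coeff_sum, coeff_smul, coeff_X, Finsupp.single_left_inj] using this

lemma exists_X_eq_sum {Y : Fin 3 → MvPolynomial (Fin 3) K} (hY : ∀ i, (Y i).IsHomogeneous 1)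
    (hli : LinearIndependent K Y) (i : Fin 3) :
    ∃ c : Fin 3 → K, (X i : MvPolynomial (Fin 3) K) = ∑ l, c l • Y l := by
  have hle : Submodule.span K (Set.range Y) ≤ homogeneousSubmodule (Fin 3) K 1 := by
    rw [Submodule.span_le]
    rintro _ ⟨i, rfl⟩
    exact hY i
  have h1 : Submodule.span K (Set.range Y) = homogeneousSubmodule (Fin 3) K 1 := by
    rw [homogeneousSubmodule_one_eq_span_X] at hle ⊢
    have : FiniteDimensional K (Submodule.span K (Set.range (X : Fin 3 → MvPolynomial (Fin 3) K))) :=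
      FiniteDimensional.span_of_finite K (Set.finite_range _)
    refine Submodule.eq_of_le_of_finrank_eq hle ?_
    rw [finrank_span_eq_card hli, finrank_span_eq_card linearIndependent_X]
  have h2 : (X i : MvPolynomial (Fin 3) K) ∈ Submodule.span K (Set.range Y) := by
    rw [h1]
    exact isHomogeneous_X K i
  obtain ⟨c, hc⟩ := (Submodule.mem_span_range_iff_exists_fun K).mp h2
  exact ⟨c, hc.symm⟩

lemma finrank_formSpace (ht : IsProjCoord K t) {w : L} (hw : w ≠ 0) :
    FiniteDimensional K (formSpace (K := K) t w 1) ∧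
      Module.finrank K (formSpace (K := K) t w 1) = 3 := by
  have h1 : formSpace (K := K) t w 1 = Submodule.span K (Set.range fun i => w * t i) := by
    rw [formSpace, homogeneousSubmodule_one_eq_span_X, Submodule.map_span, ← Set.range_comp]
    congr 2
    funext i
    simp
  have h2 : LinearIndependent K fun i => w * t i := by
    rw [Fintype.linearIndependent_iff]
    intro g hg
    have h3 : aeval t (∑ i, g i • (X i : MvPolynomial (Fin 3) K)) = 0 := by
      refine (mul_eq_zero.mp (?_ : w * _ = 0)).resolve_left hw
      rw [← hg, map_sum, Finset.mul_sum]
      refine Finset.sum_congr rfl fun i _ => ?_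
      rw [map_smul, aeval_X, mul_smul_comm]
    have h4 := ht.inj 1 _ (IsHomogeneous.sum _ _ _ fun i _ => by
      rw [smul_eq_C_mul]; exact (isHomogeneous_X K i).C_mul _) h3
    exact Fintype.linearIndependent_iff.mp linearIndependent_X g h4
  rw [h1]
  exact ⟨FiniteDimensional.span_of_finite K (Set.finite_range _), by
    rw [finrank_span_eq_card h2]; rfl⟩

/-- A spanning set of the functions `w · l`, `l` a linear form, contains three independent ones. -/
lemma exists_linear_forms (ht : IsProjCoord K t) {w : L} (hw : w ≠ 0) {S : Set L}
    (hS : formSpace (K := K) t w 1 ≤ Submodule.span K {z | z ∈ formSpace (K := K) t w 1 ∧ z ∈ S}) :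
    ∃ Y : Fin 3 → MvPolynomial (Fin 3) K, (∀ i, (Y i).IsHomogeneous 1) ∧ LinearIndependent K Y ∧
      ∀ i, w * aeval t (Y i) ∈ S := by
  set T := formSpace (K := K) t w 1
  have hT : Submodule.span K {z | z ∈ T ∧ z ∈ S} = T :=
    le_antisymm (Submodule.span_le.mpr fun z hz => hz.1) hS
  have : FiniteDimensional K (Submodule.span K {z | z ∈ T ∧ z ∈ S}) := by
    rw [hT]
    exact (finrank_formSpace ht hw).1
  obtain ⟨v, hv, -, hli⟩ := Submodule.exists_fun_fin_finrank_span_eq K {z | z ∈ T ∧ z ∈ S}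
  have h3 : Module.finrank K (Submodule.span K {z | z ∈ T ∧ z ∈ S}) = 3 := by
    rw [hT]
    exact (finrank_formSpace ht hw).2
  choose Y hY hYv using fun i => mem_formSpace.mp (hv i).1
  refine ⟨Y ∘ Fin.cast h3.symm, fun i => hY _, ?_, fun i => by
    simpa [hYv] using (hv (Fin.cast h3.symm i)).2⟩
  refine LinearIndependent.comp ?_ _ (Fin.cast_injective h3.symm)
  refine LinearIndependent.of_comp (LinearMap.mulLeft K w ∘ₗ (aeval t).toLinearMap) ?_
  have hfun : (LinearMap.mulLeft K w ∘ₗ (aeval t).toLinearMap) ∘ Y = v :=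
    funext fun i => by simpa using hYv i
  rw [hfun]
  exact hli

/-- Forms of degree `3 * n` are sums of products of `n` cubic forms, and products of elements of `F`
lie in `F`. -/
lemma aeval_mem_span {h₀ : L} (hspan : ∀ g : MvPolynomial (Fin 3) K, g.IsHomogeneous 3 →
      g ∈ Submodule.span K {s : MvPolynomial (Fin 3) K |
        s.IsHomogeneous 3 ∧ aeval t s * h₀ ∈ Set.range (algebraMap F L)}) (n : ℕ) :
    ∀ g : MvPolynomial (Fin 3) K, g.IsHomogeneous (3 * n) →
      g ∈ Submodule.span K {s : MvPolynomial (Fin 3) K |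
        s.IsHomogeneous (3 * n) ∧ aeval t s * h₀ ^ n ∈ Set.range (algebraMap F L)} := by
  induction n with
  | zero =>
    intro g hg
    rw [mul_zero, ← mem_homogeneousSubmodule, homogeneousSubmodule_zero] at hg
    obtain ⟨c, rfl⟩ := Submodule.mem_one.mp hg
    rw [Algebra.algebraMap_eq_smul_one]
    exact Submodule.smul_mem _ _ (Submodule.subset_span ⟨by simpa using isHomogeneous_one (Fin 3) K, 1, by simp⟩)
  | succ n ih =>
    intro g hg
    have h1 : g ∈ homogeneousSubmodule (Fin 3) K (3 * n) * homogeneousSubmodule (Fin 3) K 3 := by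
      rw [← homogeneousSubmodule_one_pow (σ := Fin 3) K (3 * n), ← homogeneousSubmodule_one_pow (σ := Fin 3) K 3, ← pow_add,
        homogeneousSubmodule_one_pow]
      exact hg
    have h2 := mul_le_mul' (a := homogeneousSubmodule (Fin 3) K (3 * n))
      (c := homogeneousSubmodule (Fin 3) K 3) (fun g hg => ih g hg) (fun g hg => hspan g hg) h1
    rw [Submodule.span_mul_span] at h2
    refine Submodule.span_mono ?_ h2
    rintro _ ⟨a, ⟨ha, ra, hra⟩, b, ⟨hb, rb, hrb⟩, rfl⟩
    refine ⟨ha.mul hb, ra * rb, ?_⟩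
    rw [map_mul, hra, hrb, map_mul, pow_succ]
    ring

/-- Pigeonhole: a monomial with all three exponents below `Q` has degree at most `3 * Q - 3`, which
is less than `Q + d`, so every monomial of `g` is divisible by some `X i ^ Q`. -/
lemma mem_sum_X_pow_mul {Q d : ℕ} {g : MvPolynomial (Fin 3) K} (hd : 3 * Q < d + 3 + Q)
    (hg : g.IsHomogeneous (Q + d)) : ∃ a : Fin 3 → MvPolynomial (Fin 3) K,
      (∀ i, (a i).IsHomogeneous d) ∧ g = ∑ i, X i ^ Q * a i := by
  classical
  have h1 : ∀ m ∈ g.support, ∃ i : Fin 3, Q ≤ m i := by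
    intro m hm
    by_contra! hcon
    have h := hg (mem_support_iff.mp hm)
    rw [Finsupp.weight_apply, Finsupp.sum_fintype _ _ (by simp)] at h
    simp only [Fin.sum_univ_three, Pi.one_apply, smul_eq_mul, mul_one] at h
    have := hcon 0
    have := hcon 1
    have := hcon 2
    omega
  choose! i hi using h1
  refine ⟨fun j => ∑ m ∈ g.support with i m = j,
    monomial (m - Finsupp.single j Q) (coeff m g), fun j => ?_, ?_⟩
  · refine IsHomogeneous.sum _ _ _ fun m hm => ?_
    rw [Finset.mem_filter] at hm
    refine isHomogeneous_monomial _ ?_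
    have h := hg (mem_support_iff.mp hm.1)
    have h' : m.degree = Q + d := by rw [← h, Finsupp.degree_eq_weight_one]; rfl
    have h2 : Finsupp.single j Q ≤ m := by
      rw [Finsupp.single_le_iff, ← hm.2]
      exact hi m hm.1
    have h3 := congrArg Finsupp.degree (tsub_add_cancel_of_le h2)
    rw [map_add, Finsupp.degree_single] at h3
    omega
  · conv_lhs => rw [g.as_sum, ← Finset.sum_fiberwise_of_maps_to (g := i)
      (fun m _ => Finset.mem_univ (i m))]
    refine Finset.sum_congr rfl fun j _ => ?_
    rw [Finset.mul_sum]
    refine Finset.sum_congr rfl fun m hm => ?_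
    rw [Finset.mem_filter] at hm
    rw [X_pow_eq_monomial, monomial_mul, one_mul, add_tsub_cancel_of_le]
    rw [Finsupp.single_le_iff, ← hm.2]
    exact hi m hm.1

variable [Algebra.IsPushout k F K L]

/-- If the `Q`-th powers of a basis of linear forms are defined over `F`, up to a common factor, then
so is the space of linear forms. -/
lemma isDefinedOver_formSpace_of_pow (ht : IsProjCoord K t) (h0 : h₀ ≠ 0)
    (hspan : ∀ g : MvPolynomial (Fin 3) K, g.IsHomogeneous 3 →
      g ∈ Submodule.span K {s : MvPolynomial (Fin 3) K |
        s.IsHomogeneous 3 ∧ aeval t s * h₀ ∈ Set.range (algebraMap F L)})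
    {p m e : ℕ} [ExpChar k p] (hQ : p ^ m = 3 * e + 1) {w : L} (hw : w ≠ 0)
    {Y : Fin 3 → MvPolynomial (Fin 3) K} (hY : ∀ i, (Y i).IsHomogeneous 1)
    (hli : LinearIndependent K Y)
    (hYF : ∀ i, w * h₀ ^ e * aeval t (Y i) ^ p ^ m ∈ Set.range (algebraMap F L)) :
    IsDefinedOver F (formSpace (K := K) t w 1) := by
  classical
  set Q := p ^ m with hQdef
  have hEK : ExpChar K p := expChar_of_injective_algebraMap (algebraMap k K).injective p
  have hEM : ExpChar (MvPolynomial (Fin 3) K) p :=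
    expChar_of_injective_algebraMap (C_injective (Fin 3) K) p
  -- powers of the variables in terms of powers of the `Y i`
  choose c hc using exists_X_eq_sum hY hli
  have hXQ : ∀ i, (X i : MvPolynomial (Fin 3) K) ^ Q = ∑ l, c i l ^ Q • Y l ^ Q := by
    intro i
    rw [hc i, hQdef, sum_pow_char_pow]
    simp_rw [smul_pow]
  -- the big space is defined over `F`
  have hJ : IsDefinedOver F (formSpace (K := K) t (w * h₀ ^ Q) (3 * Q + 1)) := by
    intro z hz
    obtain ⟨g, hg, rfl⟩ := mem_formSpace.mp hz
    -- Since `Q = 3 * e + 1`, the cofactor degree `2 * Q + 1` equals `3 * (Q - e)`. So the cofactors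
    -- times `h₀ ^ (Q - e)` are spanned by elements of `F`, and the remaining factor `w * h₀ ^ e`
    -- goes with the powers `Y l ^ Q`.
    obtain ⟨a, ha, rfl⟩ := mem_sum_X_pow_mul (Q := Q) (d := 3 * (Q - e)) (by omega)
      (by convert hg using 1; omega)
    rw [map_sum, Finset.mul_sum]
    refine Submodule.sum_mem _ fun i _ => ?_
    rw [hXQ, Finset.sum_mul, map_sum, Finset.mul_sum]
    refine Submodule.sum_mem _ fun l _ => ?_
    rw [smul_mul_assoc, map_smul, mul_smul_comm]
    refine Submodule.smul_mem _ _ ?_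
    have := aeval_mem_span hspan (Q - e) (a i) (ha i)
    generalize a i = b at this
    induction this using Submodule.span_induction with
    | zero => simp
    | add x y _ _ hx hy =>
      rw [mul_add, map_add, mul_add]
      exact Submodule.add_mem _ hx hy
    | smul c x _ hx =>
      rw [mul_smul_comm, map_smul, mul_smul_comm]
      exact Submodule.smul_mem _ _ hx
    | mem s hs =>
      obtain ⟨hs, r, hr⟩ := hs
      refine Submodule.subset_span ⟨mem_formSpace.mpr ⟨_, ?_, rfl⟩, ?_⟩
      · convert ((hY l).pow Q).mul hs using 1
        omega
      · obtain ⟨r', hr'⟩ := hYF l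
        refine ⟨r' * r, ?_⟩
        rw [map_mul, hr, hr', map_mul, map_pow,
          show h₀ ^ Q = h₀ ^ e * h₀ ^ (Q - e) by rw [← pow_add]; congr 1; omega]
        ring
  refine isDefinedOver_of_repr_mem (k := k) (Module.Basis.ofVectorSpace k K) fun z hz i => ?_
  set z' := algebraMap F L ((pushoutBasis F L (Module.Basis.ofVectorSpace k K)).repr z i) with hz'
  -- Multiplication by `F` commutes with taking coordinates. As the larger space is defined over
  -- `F`, multiplication by forms of degree `3 * Q` sends the coordinate `z'` into it, just as it
  -- does `z`.
  have key : ∀ g : MvPolynomial (Fin 3) K, g.IsHomogeneous (3 * Q) →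
      z' * (aeval t g * h₀ ^ Q) ∈ formSpace (K := K) t (w * h₀ ^ Q) (3 * Q + 1) := by
    intro g hg
    have hmem := aeval_mem_span hspan Q g hg
    clear hg
    induction hmem using Submodule.span_induction with
    | zero => simp
    | add x y _ _ hx hy =>
      rw [map_add, add_mul, mul_add]
      exact Submodule.add_mem _ hx hy
    | smul c x _ hx =>
      rw [map_smul, smul_mul_assoc, mul_smul_comm]
      exact Submodule.smul_mem _ _ hx
    | mem s hs =>
      obtain ⟨hs, r, hr⟩ := hs
      have h1 : z * (aeval t s * h₀ ^ Q) ∈ formSpace (K := K) t (w * h₀ ^ Q) (3 * Q + 1) := by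
        obtain ⟨l, hl, rfl⟩ := mem_formSpace.mp hz
        refine mem_formSpace.mpr ⟨s * l, hs.mul hl, ?_⟩
        rw [map_mul]
        ring
      have h2 := repr_mem_of_isDefinedOver (k := k) (Module.Basis.ofVectorSpace k K) hJ h1 i
      rw [← hr, mul_comm z, ← Algebra.smul_def, map_smul, Finsupp.smul_apply, smul_eq_mul, map_mul] at h2
      rwa [← hr, mul_comm z']
  -- The colon argument: `z' / w` is both `g₀ / X 0 ^ (3 * Q)` and `g₁ / X 1 ^ (3 * Q)`. Coprimality
  -- of the denominators makes it a form of degree 1.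
  obtain ⟨g₀, hg₀, hz₀⟩ := mem_formSpace.mp (key (X 0 ^ (3 * Q)) (isHomogeneous_X_pow _ _))
  obtain ⟨g₁, hg₁, hz₁⟩ := mem_formSpace.mp (key (X 1 ^ (3 * Q)) (isHomogeneous_X_pow _ _))
  have h0Q : h₀ ^ Q ≠ 0 := pow_ne_zero _ h0
  rw [map_pow, aeval_X] at hz₀ hz₁
  have hz₀' : w * aeval t g₀ = z' * t 0 ^ (3 * Q) := mul_right_cancel₀ h0Q (by linear_combination hz₀)
  have hz₁' : w * aeval t g₁ = z' * t 1 ^ (3 * Q) := mul_right_cancel₀ h0Q (by linear_combination hz₁)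
  have hdvd : (X 0 : MvPolynomial (Fin 3) K) ^ (3 * Q) ∣ X 1 ^ (3 * Q) * g₀ := by
    refine ⟨g₁, ht.aeval_inj (d := 3 * Q + (3 * Q + 1)) ((isHomogeneous_X_pow _ _).mul hg₀)
      ((isHomogeneous_X_pow _ _).mul hg₁) (mul_left_cancel₀ hw ?_)⟩
    rw [map_mul, map_mul, map_pow, map_pow, aeval_X, aeval_X]
    linear_combination t 1 ^ (3 * Q) * hz₀' - t 0 ^ (3 * Q) * hz₁'
  obtain ⟨l, rfl⟩ := X_pow_dvd_of_dvd_mul (by decide) hdvd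
  refine mem_formSpace.mpr ⟨l, isHomogeneous_of_mul_left (isHomogeneous_X_pow _ _)
    (pow_ne_zero _ (X_ne_zero _)) hg₀, ?_⟩
  have h00 : t 0 ^ (3 * Q) ≠ 0 := pow_ne_zero _ (ht.ne_zero 0)
  refine mul_right_cancel₀ h00 ?_
  rw [← hz₀', map_mul, map_pow, aeval_X]
  ring

/-- The twist of a polynomial by an automorphism of the coefficients and a linear substitution. -/
noncomputable def twist (σ : K ≃ₐ[k] K) (q : Fin 3 → MvPolynomial (Fin 3) K) :
    MvPolynomial (Fin 3) K →+* MvPolynomial (Fin 3) K :=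
  ((aeval q : MvPolynomial (Fin 3) K →ₐ[K] MvPolynomial (Fin 3) K) : _ →+* _).comp
    (map (σ : K →+* K))

variable (F) in
/-- The linear forms `q` describe the action of `σ` on the projective coordinates `t`, and on `h₀`. -/
structure IsTwist (t : Fin 3 → L) (h₀ : L) (σ : K ≃ₐ[k] K) (q : Fin 3 → MvPolynomial (Fin 3) K) :
    Prop where
  hom : ∀ i, (q i).IsHomogeneous 1
  ne_zero : q 0 ≠ 0
  coord : ∀ i, conj F L σ (t i) * aeval t (q 0) = aeval t (q i)
  scale : ∃ γ : K, conj F L σ h₀ = γ • (aeval t (q 0) ^ 3 * h₀)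

variable {σ : K ≃ₐ[k] K} {q : Fin 3 → MvPolynomial (Fin 3) K}

lemma IsTwist.isHomogeneous (hq : IsTwist F t h₀ σ q) {d : ℕ} {f : MvPolynomial (Fin 3) K}
    (hf : f.IsHomogeneous d) : (twist σ q f).IsHomogeneous d := by
  have := (hf.map (σ : K →+* K)).aeval q hq.hom
  rwa [one_mul] at this

/-- The coordinates are mapped to `q i / q 0`, so the factor `q 0 ^ d` clears the denominators of a
form of degree `d`. -/
lemma IsTwist.conj_aeval (hq : IsTwist F t h₀ σ q) {d : ℕ} {f : MvPolynomial (Fin 3) K}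
    (hf : f.IsHomogeneous d) :
    conj F L σ (aeval t f) * aeval t (q 0) ^ d = aeval t (twist σ q f) := by
  have h1 : conj F L σ (aeval t f) =
      aeval (fun i => conj F L σ (t i)) (map (σ : K →+* K) f) := by
    have : ((conj F L σ : L →+* L).comp (aeval t : MvPolynomial (Fin 3) K →ₐ[K] L)) =
        ((aeval (fun i => conj F L σ (t i)) : MvPolynomial (Fin 3) K →ₐ[K] L) :
          MvPolynomial (Fin 3) K →+* L).comp (map (σ : K →+* K)) := by
      refine MvPolynomial.ringHom_ext (fun c => ?_) fun i => ?_
      · simp [← MvPolynomial.algebraMap_eq]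
      · simp
    exact RingHom.congr_fun this f
  have h2 : aeval t (twist σ q f) = aeval (fun i => aeval t (q i)) (map (σ : K →+* K) f) := by
    have : (aeval t : MvPolynomial (Fin 3) K →ₐ[K] L).comp (aeval q) =
        aeval (fun i => aeval t (q i)) := MvPolynomial.algHom_ext fun i => by simp
    rw [← this]
    rfl
  rw [h1, h2, mul_comm, ← aeval_mul_left (hf.map (σ : K →+* K))]
  congr 2
  funext i
  exact (mul_comm _ _).trans (hq.coord i)

/-- A Galois-invariant curve of degree prime to `3` gives projective coordinates over `F`. -/
theorem exists_coord_of_invariant [IsAlgClosure k K] (h3 : (3 : k) ≠ 0) (ht : IsProjCoord K t)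
    (h0 : h₀ ≠ 0)
    (hspan : ∀ g : MvPolynomial (Fin 3) K, g.IsHomogeneous 3 →
      g ∈ Submodule.span K {s : MvPolynomial (Fin 3) K |
        s.IsHomogeneous 3 ∧ aeval t s * h₀ ∈ Set.range (algebraMap F L)})
    {d : ℕ} (hd : ¬ 3 ∣ d) {f : MvPolynomial (Fin 3) K} (hf : f.IsHomogeneous d) (hf0 : f ≠ 0)
    (hinv : ∀ σ : K ≃ₐ[k] K, ∃ q, IsTwist F t h₀ σ q ∧ ∃ c : K, twist σ q f = c • f) :
    ∃ Z : Fin 3 → MvPolynomial (Fin 3) K, (∀ i, (Z i).IsHomogeneous 1) ∧ LinearIndependent K Z ∧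
      ∀ i, aeval t (Z i) / aeval t (Z 0) ∈ Set.range (algebraMap F L) := by
  obtain ⟨p, hp⟩ := ExpChar.exists k
  -- Solves `d * j = -1` modulo 3; this is where the degree being prime to 3 is needed.
  obtain ⟨j, N, hj, hj0⟩ : ∃ j N, d * j + 1 = 3 * N ∧ j ≠ 0 := by
    obtain h | h : d % 3 = 1 ∨ d % 3 = 2 := by omega
    · exact ⟨2, (d * 2 + 1) / 3, by omega, by decide⟩
    · exact ⟨1, (d * 1 + 1) / 3, by omega, by decide⟩
  set w := aeval t f ^ j * h₀ ^ N with hw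
  have hft := ht.aeval_ne_zero hf hf0
  have hw0 : w ≠ 0 := mul_ne_zero (pow_ne_zero _ hft) (pow_ne_zero _ h0)
  obtain ⟨_, hfin⟩ := finrank_formSpace ht hw0
  -- The factors contribute the power `3 * N - d * j - 1` of `q 0`, which is zero by the choice of
  -- `j` and `N`; only constants remain.
  have hstable : ∀ σ : K ≃ₐ[k] K, ∀ z ∈ formSpace (K := K) t w 1,
      conj F L σ z ∈ formSpace (K := K) t w 1 := by
    intro σ z hz
    obtain ⟨l, hl, rfl⟩ := mem_formSpace.mp hz
    obtain ⟨q, hq, c, hc⟩ := hinv σ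
    obtain ⟨γ, hγ⟩ := hq.scale
    have hq0 := ht.aeval_ne_zero (hq.hom 0) hq.ne_zero
    refine mem_formSpace.mpr ⟨(c ^ j * γ ^ N) • twist σ q l, ?_, ?_⟩
    · rw [smul_eq_C_mul]
      exact (hq.isHomogeneous hl).C_mul _
    · have e1 := hq.conj_aeval hf
      have e2 := hq.conj_aeval hl
      rw [hc, map_smul, Algebra.smul_def] at e1
      rw [Algebra.smul_def] at hγ
      rw [map_smul, ← e2, hw, map_mul, map_mul, map_pow, map_pow, hγ, Algebra.smul_def, map_mul,
        map_pow, map_pow]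
      have e3 : (conj F L σ (aeval t f)) ^ j * aeval t (q 0) ^ (d * j) =
          algebraMap K L c ^ j * aeval t f ^ j := by
        rw [pow_mul, ← mul_pow, e1, mul_pow]
      have e4 : (aeval t (q 0) ^ 3) ^ N = aeval t (q 0) ^ (d * j) * aeval t (q 0) := by
        rw [← pow_mul, ← hj, pow_succ]
      rw [mul_pow, mul_pow, e4]
      linear_combination (-(algebraMap K L γ ^ N) * aeval t (q 0) * h₀ ^ N *
        conj F L σ (aeval t l)) * e3
  obtain ⟨Y, hY, hYli, hYfix⟩ := exists_linear_forms ht hw0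
    (S := {z | ∀ σ : K ≃ₐ[k] K, conj F L σ z = z})
    (le_span_fixed_of_conj_mem 3 _ hfin hstable)
  choose n hn using fun i => exists_pow_mem_range_of_conj_eq (k := k) (K := K) (F := F) (L := L) p (hYfix i)
  -- Large enough for all three fixed elements, and even: `p` is not divisible by 3, so `p ^ 2` is 1
  -- modulo 3. In characteristic 0 the exponential characteristic is `p = 1`, with `Q = 1` and `e =
  -- 0`.
  set m := 2 * (n 0 + n 1 + n 2) with hm
  have hnm : ∀ i, n i ≤ m := by
    intro i
    fin_cases i <;> simp only [hm, Fin.zero_eta, Fin.mk_one, Fin.reduceFinMk] <;> omega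
  obtain ⟨e, he⟩ : ∃ e, p ^ m = 3 * e + 1 := by
    have hp3 : p % 3 = 1 ∨ p % 3 = 2 := by
      have : ¬ 3 ∣ p := by
        intro hdvd
        rcases hp with _ | ⟨hprime⟩
        · omega
        · have : p = 3 := ((Nat.prime_dvd_prime_iff_eq Nat.prime_three hprime).mp hdvd).symm
          subst this
          exact h3 (by exact_mod_cast CharP.cast_eq_zero k 3)
      omega
    have h1 : p ^ 2 % 3 = 1 := by
      rcases hp3 with h | h <;> simp [Nat.pow_mod, h]
    have h2 : p ^ m % 3 = 1 := by
      rw [hm, pow_mul, Nat.pow_mod, h1]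
      simp
    exact ⟨p ^ m / 3, by omega⟩
  set Q := p ^ m with hQ
  have hNe : e ≤ N * Q := by
    have : 1 ≤ N := by omega
    nlinarith
  -- Chosen so that `w' * h₀ ^ e = w ^ Q`. The degrees fit again: `d * j * Q + 1 = 3 * (N * Q - e)`.
  set w' := (aeval t f ^ j) ^ Q * h₀ ^ (N * Q - e)
  have hw'0 : w' ≠ 0 := mul_ne_zero (pow_ne_zero _ (pow_ne_zero _ hft)) (pow_ne_zero _ h0)
  obtain ⟨Z, hZ, hZli, hZF⟩ := exists_linear_forms ht hw'0 (S := Set.range (algebraMap F L))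
    (isDefinedOver_formSpace_of_pow (k := k) ht h0 hspan he hw'0 hY hYli fun i => by
      have := hn i m (hnm i)
      rwa [← hQ, mul_pow, hw, mul_pow, ← pow_mul h₀, ← Nat.sub_add_cancel hNe, pow_add,
        ← mul_assoc ((aeval t f ^ j) ^ Q)] at this)
  refine ⟨Z, hZ, hZli, fun i => ?_⟩
  obtain ⟨a, ha⟩ := hZF i
  obtain ⟨b, hb⟩ := hZF 0
  exact ⟨a / b, by rw [map_div₀, ha, hb, mul_div_mul_left _ _ hw'0]⟩

end Forms

end SeveriBrauer

/-! ### The semilinear Galois action on homogeneous coordinates. -/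

namespace SeveriBrauer

open MvPolynomial

section Twist

variable {k K F L : Type u} [Field k] [Field K] [Field F] [Field L] [Algebra k K] [Algebra k F]
  [Algebra K L] [Algebra F L] [Algebra k L] [IsScalarTower k K L] [IsScalarTower k F L]
  [Algebra.IsPushout k F K L] {t : Fin 3 → L} {h₀ : L}

lemma isHomogeneous_one_of_pow {a : MvPolynomial (Fin 3) K} {n : ℕ} (hn : n ≠ 0) {c : K}
    (hc : c ≠ 0) (ha : a.totalDegree = 1) (h : (a ^ n * C c).IsHomogeneous n) :
    a.IsHomogeneous 1 := by
  have h0 : coeff 0 a = 0 := by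
    have h1 : constantCoeff (a ^ n * C c) = 0 :=
      h.coeff_eq_zero (d := 0) (by simpa using hn.symm)
    rw [map_mul, map_pow, constantCoeff_C] at h1
    exact pow_eq_zero_iff hn |>.mp ((mul_eq_zero.mp h1).resolve_right hc)
  rw [← sum_homogeneousComponent a, ha, Finset.sum_range_succ, Finset.sum_range_one,
    homogeneousComponent_zero, h0, C_0, zero_add]
  exact homogeneousComponent_isHomogeneous 1 a

/-- Forms of degree `3` in geometric progression. -/
lemma exists_linear_of_geometric {A B C' D : MvPolynomial (Fin 3) K} (hA : A.IsHomogeneous 3)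
    (hB : B.IsHomogeneous 3) (hD : D.IsHomogeneous 3) (hA0 : A ≠ 0) (hD0 : D ≠ 0)
    (h1 : A * C' = B * B) (h2 : A * D = B * C')
    (hconst : ∀ c d : K, d ≠ 0 → C c * A ≠ C d * B) :
    ∃ a b : MvPolynomial (Fin 3) K, ∃ c : K, a.IsHomogeneous 1 ∧ b.IsHomogeneous 1 ∧ a ≠ 0 ∧
      c ≠ 0 ∧ A = a ^ 3 * C c ∧ A * b = B * a := by
  -- Remove the common factor of `A` and `B`. The first relation then shows that `a` divides it, and
  -- the second that `a ^ 2` does, so that `A` is `a ^ 3` times a cofactor.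
  obtain ⟨a, b, w, hab, rfl, rfl⟩ := UniqueFactorizationMonoid.exists_reduced_factors A hA0 B
  have hw0 : w ≠ 0 := left_ne_zero_of_mul hA0
  have ha0 : a ≠ 0 := right_ne_zero_of_mul hA0
  have e1 : a * C' = w * (b * b) := mul_left_cancel₀ hw0 (by linear_combination h1)
  obtain ⟨w, rfl⟩ : a ∣ w := by
    have h : a ∣ b * b * w := ⟨C', by rw [e1]; ring⟩
    exact (hab.mul_right hab).dvd_of_dvd_mul_left h
  have hw0 := right_ne_zero_of_mul hw0
  have e1 : C' = w * (b * b) := mul_left_cancel₀ ha0 (by linear_combination e1)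
  subst e1
  have e2 : a * D = b * b * b * w := by
    refine mul_left_cancel₀ (mul_ne_zero ha0 hw0) ?_
    linear_combination h2
  obtain ⟨w, rfl⟩ : a ∣ w := ((hab.mul_right hab).mul_right hab).dvd_of_dvd_mul_left ⟨D, e2.symm⟩
  have hw0 := right_ne_zero_of_mul hw0
  have e2 : D = b * b * b * w := mul_left_cancel₀ ha0 (by linear_combination e2)
  subst e2
  have hb0 : b ≠ 0 := by
    rintro rfl
    simp at hD0
  have degA := hA.totalDegree hA0
  have degD := hD.totalDegree hD0
  rw [totalDegree_mul_of_isDomain (mul_ne_zero ha0 (mul_ne_zero ha0 hw0)) ha0,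
    totalDegree_mul_of_isDomain ha0 (mul_ne_zero ha0 hw0), totalDegree_mul_of_isDomain ha0 hw0]
    at degA
  rw [totalDegree_mul_of_isDomain (mul_ne_zero (mul_ne_zero hb0 hb0) hb0) hw0,
    totalDegree_mul_of_isDomain (mul_ne_zero hb0 hb0) hb0, totalDegree_mul_of_isDomain hb0 hb0]
    at degD
  -- Degree 0 for `a` forces the cofactor to have degree 3, hence `b` to be constant as well, and
  -- then `A` and `B` are proportional, against `hconst`.
  have hda : a.totalDegree = 1 := by
    by_contra hne
    have ha : a.totalDegree = 0 := by omega
    have hb : b.totalDegree = 0 := by omega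
    rw [totalDegree_eq_zero_iff_eq_C] at ha hb
    have : coeff 0 a ≠ 0 := fun h => ha0 (by rw [ha, h, C_0])
    refine hconst (coeff 0 b) (coeff 0 a) this ?_
    rw [← ha, ← hb]
    ring
  have hdw : w.totalDegree = 0 := by omega
  rw [totalDegree_eq_zero_iff_eq_C] at hdw
  have hc : coeff 0 w ≠ 0 := fun h => hw0 (by rw [hdw, h, C_0])
  generalize coeff 0 w = c at hdw hc
  subst hdw
  have haH : a.IsHomogeneous 1 := by
    refine isHomogeneous_one_of_pow three_ne_zero hc hda ?_
    convert hA using 1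
    ring
  refine ⟨a, b, c, haH, ?_, ha0, hc, by ring, by ring⟩
  refine isHomogeneous_of_mul_left (m := 2) (a := C c * (a * a)) ?_ ?_ ?_
  · exact (haH.mul haH).C_mul c
  · exact mul_ne_zero (by simpa using hc) (mul_ne_zero ha0 ha0)
  · convert hB using 1
    ring

/-- The Galois group acts on the projective coordinates by linear substitutions. -/
theorem exists_isTwist (ht : IsProjCoord K t) (h0 : h₀ ≠ 0)
    (hspan : ∀ g : MvPolynomial (Fin 3) K, g.IsHomogeneous 3 →
      g ∈ Submodule.span K {s : MvPolynomial (Fin 3) K |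
        s.IsHomogeneous 3 ∧ aeval t s * h₀ ∈ Set.range (algebraMap F L)}) (σ : K ≃ₐ[k] K) :
    ∃ q, IsTwist F t h₀ σ q := by
  -- The space of cubic forms times `h₀` is spanned by elements fixed by `conj`, so it is stable.
  -- This is all that is used about `h₀`.
  have key : ∀ g : MvPolynomial (Fin 3) K, g.IsHomogeneous 3 →
      ∃ g' : MvPolynomial (Fin 3) K, g'.IsHomogeneous 3 ∧
        conj F L σ (aeval t g) * conj F L σ h₀ = aeval t g' * h₀ := by
    intro g hg
    have hmem := hspan g hg
    clear hg
    induction hmem using Submodule.span_induction with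
    | zero => exact ⟨0, isHomogeneous_zero _ _ _, by simp⟩
    | add x y _ _ hx hy =>
      obtain ⟨x', hx', ex⟩ := hx
      obtain ⟨y', hy', ey⟩ := hy
      exact ⟨x' + y', hx'.add hy', by rw [map_add, map_add, map_add, add_mul, ex, ey, add_mul]⟩
    | smul c x _ hx =>
      obtain ⟨x', hx', ex⟩ := hx
      refine ⟨σ c • x', by rw [smul_eq_C_mul]; exact hx'.C_mul _, ?_⟩
      rw [map_smul, conj_smul, smul_mul_assoc, ex, map_smul, smul_mul_assoc]
    | mem s hs =>
      obtain ⟨hs, r, hr⟩ := hs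
      exact ⟨s, hs, by rw [← map_mul, ← hr, conj_left]⟩
  have hφinj : Function.Injective (conj F L σ) := (conj F L σ : L →+* L).injective
  have hh0 : conj F L σ h₀ ≠ 0 := (map_ne_zero_iff _ hφinj).mpr h0
  have hne : ∀ g g' : MvPolynomial (Fin 3) K, g.IsHomogeneous 3 → g ≠ 0 →
      conj F L σ (aeval t g) * conj F L σ h₀ = aeval t g' * h₀ → g' ≠ 0 := by
    rintro g _ hg hg0 h rfl
    rw [map_zero, zero_mul] at h
    exact mul_ne_zero ((map_ne_zero_iff _ hφinj).mpr (ht.aeval_ne_zero hg hg0)) hh0 h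
  obtain ⟨A, hA, eA⟩ := key (X 0 ^ 3) (isHomogeneous_X_pow _ _)
  have hA0 := hne _ _ (isHomogeneous_X_pow _ _) (pow_ne_zero _ (X_ne_zero _)) eA
  rw [map_pow, aeval_X, ht.zero, one_pow, map_one, one_mul] at eA
  -- The images of the four cubics `X 0 ^ 3`, `X 0 ^ 2 * X i`, `X 0 * X i ^ 2`, `X i ^ 3` are in
  -- geometric progression with ratio the image of `t i`. So this ratio is a quotient of two linear
  -- forms.
  have step : ∀ i : Fin 3, i ≠ 0 → ∃ a b : MvPolynomial (Fin 3) K, ∃ c : K, a.IsHomogeneous 1 ∧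
      b.IsHomogeneous 1 ∧ a ≠ 0 ∧ c ≠ 0 ∧ A = a ^ 3 * C c ∧
        conj F L σ (t i) * aeval t a = aeval t b := by
    intro i hi
    obtain ⟨B, hB, eB⟩ := key (X 0 ^ 2 * X i) ((isHomogeneous_X_pow _ _).mul (isHomogeneous_X _ _))
    obtain ⟨C', hC, eC⟩ := key (X 0 * X i ^ 2)
      ((isHomogeneous_X _ _).mul (isHomogeneous_X_pow (R := K) i 2))
    obtain ⟨D, hD, eD⟩ := key (X i ^ 3) (isHomogeneous_X_pow _ _)
    have hD0 := hne _ _ (isHomogeneous_X_pow _ _) (pow_ne_zero _ (X_ne_zero _)) eD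
    simp only [map_pow, map_mul, aeval_X, ht.zero, one_pow, one_mul] at eB eC eD
    have hh : h₀ * h₀ ≠ 0 := mul_ne_zero h0 h0
    obtain ⟨a, b, c, ha, hb, ha0, hc, hAa, hab⟩ := exists_linear_of_geometric (C' := C') hA hB hD
      hA0 hD0
      (ht.aeval_inj (hA.mul hC) (hB.mul hB) (mul_left_cancel₀ hh (by
        rw [map_mul, map_mul]
        linear_combination (-h₀ * aeval t C') * eA - conj F L σ h₀ * eC +
          (conj F L σ (t i) * conj F L σ h₀ + h₀ * aeval t B) * eB)))
      (ht.aeval_inj (hA.mul hD) (hB.mul hC) (mul_left_cancel₀ hh (by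
        rw [map_mul, map_mul]
        linear_combination (-h₀ * aeval t D) * eA - conj F L σ h₀ * eD +
          conj F L σ (t i) * conj F L σ h₀ * eC + h₀ * aeval t C' * eB)))
      (by
        -- Proportionality of `A` and `B` would, after undoing `σ`, make `t i` a constant.
        intro c d hd h
        have h1 := congrArg (fun P => aeval t P * h₀) h
        simp only [map_mul, mul_assoc, ← eA, ← eB, ← algebraMap_eq, AlgHom.commutes] at h1
        rw [← σ.apply_symm_apply c, ← σ.apply_symm_apply d, ← conj_right (F := F) σ (σ.symm c),
          ← conj_right (F := F) σ (σ.symm d), ← map_mul, ← map_mul, ← map_mul] at h1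
        have h2 := hφinj h1
        rw [← mul_assoc] at h2
        have h3 := mul_right_cancel₀ h0 h2
        have h4 := ht.inj 1 (C (σ.symm c) * X 0 - C (σ.symm d) * X i)
          (((isHomogeneous_X _ _).C_mul _).sub ((isHomogeneous_X _ _).C_mul _)) (by
            rw [map_sub, map_mul, map_mul, aeval_X, aeval_X, ht.zero, ← algebraMap_eq,
              AlgHom.commutes, AlgHom.commutes, h3, mul_one, sub_self])
        have h5 := congrArg (coeff (Finsupp.single i 1)) h4
        rw [coeff_sub, coeff_C_mul, coeff_C_mul, coeff_X, coeff_X, if_pos rfl, if_neg, coeff_zero,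
          mul_zero, mul_one, zero_sub, neg_eq_zero] at h5
        · exact hd (by simpa using h5)
        · rw [Finsupp.single_left_inj one_ne_zero]
          exact hi.symm)
    refine ⟨a, b, c, ha, hb, ha0, hc, hAa, ?_⟩
    refine mul_right_cancel₀ hh0 ?_
    have h1 := congrArg (aeval t) hab
    rw [map_mul, map_mul] at h1
    rw [mul_right_comm, eB, eA]
    linear_combination -h₀ * h1
  obtain ⟨a, b₁, c, ha, hb₁, ha0, hc, hAa, e₁⟩ := step 1 (by decide)
  obtain ⟨a', b₂, c', ha', hb₂, ha'0, hc', hAa', e₂⟩ := step 2 (by decide)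
  -- The two ratios must have the same denominator. Both denominators have a cube proportional to
  -- `A`, so they differ by a constant `s`, which is absorbed into the third form.
  obtain ⟨s, rfl⟩ : a ∣ a' := by
    rw [← UniqueFactorizationMonoid.pow_dvd_pow_iff_dvd three_ne_zero]
    refine ⟨C (c * c'⁻¹), ?_⟩
    have : (C c' : MvPolynomial (Fin 3) K) * C (c'⁻¹) = 1 := by
      rw [← C_mul, mul_inv_cancel₀ hc', C_1]
    rw [C_mul, ← mul_assoc, ← hAa, hAa', mul_assoc, this, mul_one]
  have hs : s.IsHomogeneous 0 := isHomogeneous_of_mul_left ha ha0 ha'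
  obtain ⟨s, rfl⟩ : ∃ s', s = C s' := ⟨coeff 0 s, by
    rw [← totalDegree_eq_zero_iff_eq_C]
    exact Nat.le_zero.mp hs.totalDegree_le⟩
  refine ⟨![a, b₁, C s⁻¹ * b₂], ?_, ha0, ?_, c, ?_⟩
  · intro i
    fin_cases i
    · exact ha
    · exact hb₁
    · exact hb₂.C_mul _
  · intro i
    fin_cases i
    · simp [ht.zero]
    · exact e₁
    · have hs0 : s ≠ 0 := by
        rintro rfl
        simp at ha'0
      have hs1 : algebraMap K L s ≠ 0 := by simpa using hs0
      change conj F L σ (t 2) * aeval t a = aeval t (C s⁻¹ * b₂)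
      rw [map_mul, ← e₂, map_mul, ← algebraMap_eq, AlgHom.commutes, AlgHom.commutes, map_inv₀]
      field_simp
  · change _ = c • (aeval t a ^ 3 * h₀)
    rw [eA, hAa, map_mul, map_pow, ← algebraMap_eq, AlgHom.commutes, Algebra.smul_def]
    ring

end Twist

end SeveriBrauer

/-! ### Lines and conics through points of the plane, and six conjugate points. -/

namespace SeveriBrauer

open MvPolynomial

section Plane

variable {K : Type u} [Field K]

lemma eval_linear {l : MvPolynomial (Fin 3) K} (hl : l.IsHomogeneous 1) :
    ∃ n : Fin 3 → K, l = ∑ i, n i • X i ∧ ∀ v, eval v l = n 0 * v 0 + n 1 * v 1 + n 2 * v 2 := by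
  rw [← mem_homogeneousSubmodule, homogeneousSubmodule_one_eq_span_X,
    Submodule.mem_span_range_iff_exists_fun] at hl
  obtain ⟨n, rfl⟩ := hl
  exact ⟨n, rfl, fun v => by simp [Fin.sum_univ_three, smul_eval]⟩

lemma eval_quadratic {h : MvPolynomial (Fin 3) K} (hh : h.IsHomogeneous 2) :
    ∃ M : Fin 3 → Fin 3 → K, ∀ v, eval v h = ∑ i, ∑ j, M i j * v i * v j := by
  rw [← mem_homogeneousSubmodule, ← homogeneousSubmodule_one_pow, pow_two,
    homogeneousSubmodule_one_eq_span_X, Submodule.span_mul_span] at hh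
  induction hh using Submodule.span_induction with
  | zero => exact ⟨0, by simp⟩
  | add x y _ _ hx hy =>
    obtain ⟨M, hM⟩ := hx
    obtain ⟨N, hN⟩ := hy
    exact ⟨M + N, fun v => by simp [hM, hN, add_mul, Finset.sum_add_distrib]⟩
  | smul c x _ hx =>
    obtain ⟨M, hM⟩ := hx
    exact ⟨c • M, fun v => by simp [smul_eval, hM, Finset.mul_sum, mul_assoc]⟩
  | mem x hx =>
    obtain ⟨_, ⟨i, rfl⟩, _, ⟨j, rfl⟩, rfl⟩ := hx
    classical
    refine ⟨Pi.single i (Pi.single j 1), fun v => ?_⟩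
    rw [Finset.sum_eq_single i, Finset.sum_eq_single j]
    · simp
    · intro j' _ hj'
      simp [Pi.single_eq_of_ne hj']
    · simp
    · intro i' _ hi'
      simp [Pi.single_eq_of_ne hi']
    · simp

/-- A line is determined by two of its points. -/
lemma linear_unique {a b : Fin 3 → K} (hab : ∃ i j, a i * b j ≠ a j * b i)
    {l l' : MvPolynomial (Fin 3) K} (hl : l.IsHomogeneous 1) (hl' : l'.IsHomogeneous 1)
    (hl0 : l ≠ 0) (ha : eval a l = 0) (hb : eval b l = 0) (ha' : eval a l' = 0)
    (hb' : eval b l' = 0) : ∃ c : K, l' = c • l := by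
  obtain ⟨n, rfl, hn⟩ := eval_linear hl
  obtain ⟨n', rfl, hn'⟩ := eval_linear hl'
  rw [hn] at ha hb
  rw [hn'] at ha' hb'
  -- The witness is the cross product of `a` and `b`, nonzero for distinct points. Every vector
  -- orthogonal to both is proportional to it.
  have hw : ∃ w : Fin 3 → K, w ≠ 0 ∧ ∀ m : Fin 3 → K,
      m 0 * a 0 + m 1 * a 1 + m 2 * a 2 = 0 → m 0 * b 0 + m 1 * b 1 + m 2 * b 2 = 0 →
        ∀ i j, m i * w j = m j * w i := by
    refine ⟨![a 1 * b 2 - a 2 * b 1, a 2 * b 0 - a 0 * b 2, a 0 * b 1 - a 1 * b 0], ?_, ?_⟩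
    · intro h
      have h0 : a 1 * b 2 - a 2 * b 1 = 0 := congrFun h 0
      have h1 : a 2 * b 0 - a 0 * b 2 = 0 := congrFun h 1
      have h2 : a 0 * b 1 - a 1 * b 0 = 0 := congrFun h 2
      obtain ⟨i, j, hij⟩ := hab
      apply hij
      fin_cases i <;> fin_cases j <;> simp only [Fin.zero_eta, Fin.mk_one, Fin.reduceFinMk]
      · linear_combination h2
      · linear_combination -h1
      · linear_combination -h2
      · linear_combination h0
      · linear_combination h1
      · linear_combination -h0
    · intro m ha hb i j
      have e0 : m 1 * (a 0 * b 1 - a 1 * b 0) = m 2 * (a 2 * b 0 - a 0 * b 2) := by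
        linear_combination a 0 * hb - b 0 * ha
      have e1 : m 2 * (a 1 * b 2 - a 2 * b 1) = m 0 * (a 0 * b 1 - a 1 * b 0) := by
        linear_combination a 1 * hb - b 1 * ha
      have e2 : m 0 * (a 2 * b 0 - a 0 * b 2) = m 1 * (a 1 * b 2 - a 2 * b 1) := by
        linear_combination a 2 * hb - b 2 * ha
      fin_cases i <;> fin_cases j
      · rfl
      · exact e2
      · exact e1.symm
      · exact e2.symm
      · rfl
      · exact e0
      · exact e1
      · exact e0.symm
      · rfl
  obtain ⟨w, hw0, hw⟩ := hw
  obtain ⟨i, hi⟩ : ∃ i, w i ≠ 0 := by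
    by_contra! h
    exact hw0 (funext h)
  have h1 := hw n ha hb
  have h2 := hw n' ha' hb'
  have hni : n i ≠ 0 := by
    intro h
    refine hl0 (Finset.sum_eq_zero fun j _ => ?_)
    have := h1 i j
    rw [h, zero_mul] at this
    rw [(mul_eq_zero.mp this.symm).resolve_right hi, zero_smul]
  refine ⟨n' i / n i, ?_⟩
  rw [Finset.smul_sum]
  refine Finset.sum_congr rfl fun j _ => ?_
  rw [smul_smul]
  congr 1
  refine mul_right_cancel₀ hi ?_
  rw [h2 j i, mul_assoc, h1 j i, ← mul_assoc, div_mul_cancel₀ _ hni]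

/-- Points of the plane that do not lie on a line. -/
def Noncollinear (a b c : Fin 3 → K) : Prop :=
  ∀ l : MvPolynomial (Fin 3) K, l.IsHomogeneous 1 → eval a l = 0 → eval b l = 0 → eval c l = 0 →
    l = 0

lemma Noncollinear.det_ne_zero {a b c : Fin 3 → K} (h : Noncollinear a b c) :
    (Matrix.of ![a, b, c]).det ≠ 0 := by
  intro hdet
  obtain ⟨n, hn0, hn⟩ := Matrix.exists_mulVec_eq_zero_iff.mpr hdet
  have hv : ∀ v, eval v (∑ i, n i • (X i : MvPolynomial (Fin 3) K)) = v ⬝ᵥ n := fun v => by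
    simp [Fin.sum_univ_three, smul_eval, dotProduct, mul_comm]
  have := h (∑ i, n i • X i) (IsHomogeneous.sum _ _ _ fun i _ => by
    rw [smul_eq_C_mul]; exact (isHomogeneous_X K i).C_mul _)
    ((hv _).trans (congrFun hn 0)) ((hv _).trans (congrFun hn 1)) ((hv _).trans (congrFun hn 2))
  exact hn0 (funext fun i => Fintype.linearIndependent_iff.mp linearIndependent_X n this i)

lemma Noncollinear.exists_coord {a b c : Fin 3 → K} (h : Noncollinear a b c) (v : Fin 3 → K) :
    ∃ y : Fin 3 → K, ∀ i, v i = y 0 * a i + y 1 * b i + y 2 * c i := by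
  have hy : Matrix.vecMul (Matrix.vecMul v (Matrix.of ![a, b, c])⁻¹) (Matrix.of ![a, b, c]) = v := by
    rw [Matrix.vecMul_vecMul, Matrix.nonsing_inv_mul _ (isUnit_iff_ne_zero.mpr h.det_ne_zero),
      Matrix.vecMul_one]
  generalize Matrix.vecMul v (Matrix.of ![a, b, c])⁻¹ = y at hy
  refine ⟨y, fun i => ?_⟩
  rw [← hy]
  simp [Matrix.vecMul, dotProduct, Fin.sum_univ_three]

/-- Two conics through five points, no three of them collinear, have no sixth point in common on the
line through two of these. -/
lemma quadratic_eq_zero [Infinite K] {a b c d e : Fin 3 → K} (habc : Noncollinear a b c)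
    (habd : Noncollinear a b d) (habe : Noncollinear a b e) (hcde : Noncollinear c d e)
    {h : MvPolynomial (Fin 3) K} (hh : h.IsHomogeneous 2) (ha : eval a h = 0) (hb : eval b h = 0)
    (hc : eval c h = 0) (hd : eval d h = 0) (he : eval e h = 0)
    (hab : eval (fun i => a i + b i) h = 0) : h = 0 := by
  obtain ⟨M, hM⟩ := eval_quadratic hh
  obtain ⟨y, hy⟩ := habc.exists_coord d
  obtain ⟨z, hz⟩ := habc.exists_coord e
  -- In the coordinates given by `a`, `b`, `c`, the coefficients of the squares are the values at
  -- these points, so only the mixed terms survive. The form of the expansion makes sense in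
  -- characteristic 2 as well.
  have hexp : ∃ B : Fin 3 → K, ∀ x : Fin 3 → K, eval (fun i => x 0 * a i + x 1 * b i + x 2 * c i) h =
      x 0 ^ 2 * eval a h + x 1 ^ 2 * eval b h + x 2 ^ 2 * eval c h + x 0 * x 1 * B 2 +
        x 0 * x 2 * B 1 + x 1 * x 2 * B 0 := by
    refine ⟨![∑ i, ∑ j, M i j * (b i * c j + b j * c i), ∑ i, ∑ j, M i j * (a i * c j + a j * c i),
      ∑ i, ∑ j, M i j * (a i * b j + a j * b i)], fun x => ?_⟩
    simp only [hM, Fin.sum_univ_three, Matrix.cons_val_zero, Matrix.cons_val_one, Matrix.cons_val]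
    ring
  obtain ⟨B, hB⟩ := hexp
  simp only [ha, hb, hc, mul_zero, zero_add] at hB
  have hB2 : B 2 = 0 := by
    have := hB ![1, 1, 0]
    simpa [hab] using this.symm
  have hdd := hB y
  rw [show (fun i => y 0 * a i + y 1 * b i + y 2 * c i) = d from funext fun i => (hy i).symm, hd,
    hB2] at hdd
  have hee := hB z
  rw [show (fun i => z 0 * a i + z 1 * b i + z 2 * c i) = e from funext fun i => (hz i).symm, he,
    hB2] at hee
  have hdet := habd.det_ne_zero
  have hdet' := habe.det_ne_zero
  have hdet'' := hcde.det_ne_zero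
  simp only [Matrix.det_fin_three, Matrix.of_apply, Matrix.cons_val_zero, Matrix.cons_val_one,
    Matrix.cons_val] at hdet hdet' hdet''
  have hy2 : y 2 ≠ 0 := by
    intro h0
    apply hdet
    rw [hy 0, hy 1, hy 2, h0]
    ring
  have hz2 : z 2 ≠ 0 := by
    intro h0
    apply hdet'
    rw [hz 0, hz 1, hz 2, h0]
    ring
  have hyz : y 0 * z 1 - y 1 * z 0 ≠ 0 := by
    intro h0
    apply hdet''
    rw [hy 0, hy 1, hy 2, hz 0, hz 1, hz 2]
    linear_combination (a 0 * b 1 * c 2 - a 0 * b 2 * c 1 - a 1 * b 0 * c 2 + a 1 * b 2 * c 0 +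
      a 2 * b 0 * c 1 - a 2 * b 1 * c 0) * h0
  -- With `B 2 = 0` the conic consists of the line `a b` and a line through `c`. The points `d`, `e`
  -- are off the former, hence on the latter, but `c`, `d`, `e` are not collinear.
  have e1 : y 0 * B 1 + y 1 * B 0 = 0 := mul_left_cancel₀ hy2 (by linear_combination -hdd)
  have e2 : z 0 * B 1 + z 1 * B 0 = 0 := mul_left_cancel₀ hz2 (by linear_combination -hee)
  have hB1 : B 1 = 0 := mul_left_cancel₀ hyz (by linear_combination z 1 * e1 - y 1 * e2)
  have hB0 : B 0 = 0 := mul_left_cancel₀ hyz (by linear_combination y 0 * e2 - z 0 * e1)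
  refine MvPolynomial.funext fun v => ?_
  obtain ⟨x, hx⟩ := habc.exists_coord v
  have := hB x
  rw [show (fun i => x 0 * a i + x 1 * b i + x 2 * c i) = v from funext fun i => (hx i).symm] at this
  rw [this, hB2, hB1, hB0]
  simp

end Plane

section Six

variable {k K : Type u} [Field k] [Field K] [Algebra k K]

lemma eval_twist {σ : K ≃ₐ[k] K} {q : Fin 3 → MvPolynomial (Fin 3) K} {a a' : Fin 3 → K} {c : K}
    (hq : ∀ i, eval a' (q i) = c * σ (a i)) {d : ℕ} {f : MvPolynomial (Fin 3) K}
    (hf : f.IsHomogeneous d) : eval a' (twist σ q f) = c ^ d * σ (eval a f) := by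
  have h1 : eval a' (twist σ q f) = eval (fun i => eval a' (q i)) (map (σ : K →+* K) f) := by
    have : ((aeval a' : MvPolynomial (Fin 3) K →ₐ[K] K)).comp (aeval q) =
        aeval (fun i => eval a' (q i)) := MvPolynomial.algHom_ext fun i => by
      simp [aeval_eq_eval]
    exact AlgHom.congr_fun this (map (σ : K →+* K) f)
  have h2 : eval (fun i => c * σ (a i)) (map (σ : K →+* K) f) =
      c ^ d * eval (fun i => σ (a i)) (map (σ : K →+* K) f) := by
    have := aeval_mul_left (hf.map (σ : K →+* K)) c (fun i => σ (a i))
    simpa [aeval_eq_eval] using this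
  rw [h1, funext hq, h2]
  congr 1
  have h3 : (eval fun i => σ (a i)).comp (map (σ : K →+* K)) = (σ : K →+* K).comp (eval a) :=
    MvPolynomial.ringHom_ext (fun c => by simp) fun i => by simp
  exact RingHom.congr_fun h3 f

open Pointwise in
/-- Six points of the plane in one orbit of a group that acts by semilinear collineations: if they
are in special position, then there is an invariant curve of degree prime to `3`. -/
theorem exists_invariant [Infinite K] {E : Type*} [Fintype E] [MulAction (K ≃ₐ[k] K) E]
    [MulAction.IsPretransitive (K ≃ₐ[k] K) E] (hE : Fintype.card E = 6) {a : E → Fin 3 → K}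
    (hdist : ∀ ε ε', ε ≠ ε' → ∃ i j, a ε i * a ε' j ≠ a ε j * a ε' i)
    {q : (K ≃ₐ[k] K) → Fin 3 → MvPolynomial (Fin 3) K} (hqh : ∀ σ i, (q σ i).IsHomogeneous 1)
    (hq : ∀ σ ε, ∃ c : K, c ≠ 0 ∧ ∀ i, eval (a (σ • ε)) (q σ i) = c * σ (a ε i))
    (hne : ∀ σ d f, f.IsHomogeneous d → f ≠ 0 → twist σ (q σ) f ≠ 0)
    (hspecial : (∃ ε₁ ε₂ ε₃, ε₁ ≠ ε₂ ∧ ε₁ ≠ ε₃ ∧ ε₂ ≠ ε₃ ∧ ¬ Noncollinear (a ε₁) (a ε₂) (a ε₃)) ∨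
      ∃ h : MvPolynomial (Fin 3) K, h.IsHomogeneous 2 ∧ h ≠ 0 ∧ ∀ ε, eval (a ε) h = 0) :
    ∃ d, ¬ 3 ∣ d ∧ ∃ f : MvPolynomial (Fin 3) K, f.IsHomogeneous d ∧ f ≠ 0 ∧
      ∀ σ, ∃ c : K, twist σ (q σ) f = c • f := by
  classical
  have htw : ∀ σ {d} {f : MvPolynomial (Fin 3) K}, f.IsHomogeneous d →
      (twist σ (q σ) f).IsHomogeneous d := by
    intro σ d f hf
    have := (hf.map (σ : K →+* K)).aeval (q σ) (hqh σ)
    rwa [one_mul] at this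
  have hev : ∀ σ ε {d} {f : MvPolynomial (Fin 3) K}, f.IsHomogeneous d →
      (eval (a (σ • ε)) (twist σ (q σ) f) = 0 ↔ eval (a ε) f = 0) := by
    intro σ ε d f hf
    obtain ⟨c, hc, hqc⟩ := hq σ ε
    rw [eval_twist hqc hf, mul_eq_zero, or_iff_right (pow_ne_zero _ hc),
      EmbeddingLike.map_eq_zero_iff]
  by_cases hcol : ∃ ε₁ ε₂ ε₃, ε₁ ≠ ε₂ ∧ ε₁ ≠ ε₃ ∧ ε₂ ≠ ε₃ ∧ ¬ Noncollinear (a ε₁) (a ε₂) (a ε₃)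
  · clear hspecial
    obtain ⟨ε₁, ε₂, ε₃, h12, h13, h23, hcol⟩ := hcol
    rw [Noncollinear] at hcol
    push Not at hcol
    obtain ⟨l₀, hl₀, hl1, hl2, hl3, hl₀0⟩ := hcol
    -- All points on the line, not only the given three, so that two lines of the orbit sharing two
    -- points have the same block. Lines are thus indexed by the orbit of `b₀`.
    let b₀ : Finset E := Finset.univ.filter fun ε => eval (a ε) l₀ = 0
    let O : Finset (Finset E) := Finset.univ.filter fun b => b ∈ MulAction.orbit (K ≃ₐ[k] K) b₀
    have hO : ∀ b, b ∈ O ↔ ∃ σ : K ≃ₐ[k] K, σ • b₀ = b := by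
      intro b
      simp only [O, Finset.mem_filter, Finset.mem_univ, true_and]
      rfl
    have hb3 : 3 ≤ b₀.card := by
      rw [← Finset.card_eq_three.mpr ⟨ε₁, ε₂, ε₃, h12, h13, h23, rfl⟩]
      refine Finset.card_le_card fun ε hε => ?_
      simp only [Finset.mem_insert, Finset.mem_singleton] at hε
      rcases hε with rfl | rfl | rfl <;> simp [b₀, *]
    have hOcard : ∀ b ∈ O, b.card = b₀.card := by
      intro b hb
      obtain ⟨σ, rfl⟩ := (hO b).mp hb
      exact Finset.card_smul_finset σ b₀
    have hform : ∀ b ∈ O, ∃ l : MvPolynomial (Fin 3) K, l.IsHomogeneous 1 ∧ l ≠ 0 ∧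
        ∀ ε, ε ∈ b ↔ eval (a ε) l = 0 := by
      intro b hb
      obtain ⟨σ, rfl⟩ := (hO b).mp hb
      refine ⟨twist σ (q σ) l₀, htw σ hl₀, hne σ 1 l₀ hl₀ hl₀0, fun ε => ?_⟩
      have h1 := hev σ (σ⁻¹ • ε) hl₀
      rw [smul_inv_smul] at h1
      rw [← Finset.inv_smul_mem_iff, h1]
      simp [b₀]
    choose! l hl hl0 hlb using hform
    have huniq : ∀ b ∈ O, ∀ l' : MvPolynomial (Fin 3) K, l'.IsHomogeneous 1 →
        (∀ ε ∈ b, eval (a ε) l' = 0) → ∃ c : K, l' = c • l b := by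
      intro b hb l' hl' h
      obtain ⟨ε, hε, ε', hε', hne⟩ := Finset.one_lt_card.mp
        (show 1 < b.card by rw [hOcard b hb]; omega)
      exact linear_unique (hdist ε ε' hne) (hl b hb) hl' (hl0 b hb) ((hlb b hb ε).mp hε)
        ((hlb b hb ε').mp hε') (h ε hε) (h ε' hε')
    have hinter : ∀ b ∈ O, ∀ b' ∈ O, ∀ ε ε', ε ≠ ε' → ε ∈ b → ε' ∈ b → ε ∈ b' → ε' ∈ b' →
        b = b' := by
      have hle : ∀ b ∈ O, ∀ b' ∈ O, ∀ ε ε', ε ≠ ε' → ε ∈ b → ε' ∈ b → ε ∈ b' → ε' ∈ b' →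
          b ⊆ b' := by
        intro b hb b' hb' ε ε' hne h1 h2 h3 h4 η hη
        obtain ⟨c, hc⟩ := linear_unique (hdist ε ε' hne) (hl b hb) (hl b' hb') (hl0 b hb)
          ((hlb b hb ε).mp h1) ((hlb b hb ε').mp h2) ((hlb b' hb' ε).mp h3) ((hlb b' hb' ε').mp h4)
        rw [hlb b' hb', hc, smul_eval, (hlb b hb η).mp hη, mul_zero]
      intro b hb b' hb' ε ε' hne h1 h2 h3 h4
      exact (hle b hb b' hb' ε ε' hne h1 h2 h3 h4).antisymm (hle b' hb' b hb ε ε' hne h3 h4 h1 h2)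
    have hOsmul : ∀ σ : K ≃ₐ[k] K, ∀ b, σ • b ∈ O ↔ b ∈ O := by
      intro σ b
      rw [hO, hO]
      constructor
      · rintro ⟨τ, hτ⟩
        exact ⟨σ⁻¹ * τ, by rw [mul_smul, hτ, inv_smul_smul]⟩
      · rintro ⟨τ, rfl⟩
        exact ⟨σ * τ, mul_smul _ _ _⟩
    refine ⟨O.card, ?_, ∏ b ∈ O, l b, ?_, ?_, fun σ => ?_⟩
    · -- counting incidences
      have hcount : ∃ r, O.card * b₀.card = 6 * r := by
        have hconst : ∀ ε, (O.filter fun b => ε ∈ b).card = (O.filter fun b => ε₁ ∈ b).card := by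
          intro ε
          obtain ⟨σ, rfl⟩ := MulAction.exists_smul_eq (K ≃ₐ[k] K) ε₁ ε
          symm
          refine Finset.card_bij (fun b _ => σ • b) ?_ ?_ ?_
          · intro b hb
            rw [Finset.mem_filter] at hb ⊢
            exact ⟨(hOsmul σ b).mpr hb.1, Finset.smul_mem_smul_finset hb.2⟩
          · intro b _ b' _ h
            exact smul_left_cancel σ h
          · intro b hb
            rw [Finset.mem_filter] at hb
            refine ⟨σ⁻¹ • b, Finset.mem_filter.mpr ⟨?_, ?_⟩, smul_inv_smul _ _⟩
            · rw [← hOsmul σ, smul_inv_smul]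
              exact hb.1
            · rw [← Finset.smul_mem_smul_finset_iff σ, smul_inv_smul]
              exact hb.2
        refine ⟨(O.filter fun b => ε₁ ∈ b).card, ?_⟩
        calc O.card * b₀.card = ∑ b ∈ O, b.card := by
              rw [Finset.sum_congr rfl hOcard, Finset.sum_const, smul_eq_mul]
          _ = ∑ b ∈ O, ∑ ε : E, if ε ∈ b then 1 else 0 := by simp
          _ = ∑ ε : E, (O.filter fun b => ε ∈ b).card := by
              rw [Finset.sum_comm]
              simp
          _ = 6 * _ := by
              rw [Finset.sum_congr rfl fun ε _ => hconst ε, Finset.sum_const, Finset.card_univ, hE,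
                smul_eq_mul]
      obtain ⟨r, hr⟩ := hcount
      -- Different blocks share at most one point, so their ordered pairs are disjoint subsets of
      -- the 30 ordered pairs of points.
      have hpairs : O.card * (b₀.card * b₀.card - b₀.card) ≤ 30 := by
        calc O.card * (b₀.card * b₀.card - b₀.card) = ∑ b ∈ O, b.offDiag.card := by
              rw [Finset.sum_congr rfl fun b hb => by
                rw [Finset.offDiag_card, hOcard b hb], Finset.sum_const, smul_eq_mul]
          _ = (O.biUnion fun b => b.offDiag).card := by
              rw [Finset.card_biUnion]
              intro b hb b' hb' hbb
              rw [Function.onFun, Finset.disjoint_left]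
              rintro ⟨ε, ε'⟩ h h'
              rw [Finset.mem_offDiag] at h h'
              exact hbb (hinter b hb b' hb' ε ε' h.2.2 h.1 h.2.1 h'.1 h'.2.1)
          _ ≤ (Finset.univ : Finset E).offDiag.card := by
              refine Finset.card_le_card fun p hp => ?_
              obtain ⟨b, -, hb⟩ := Finset.mem_biUnion.mp hp
              exact Finset.mem_offDiag.mpr ⟨Finset.mem_univ _, Finset.mem_univ _,
                (Finset.mem_offDiag.mp hb).2.2⟩
          _ = 30 := by rw [Finset.offDiag_card, Finset.card_univ, hE]
      have hOpos : 0 < O.card := Finset.card_pos.mpr ⟨b₀, (hO b₀).mpr ⟨1, one_smul _ _⟩⟩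
      have hb6 : b₀.card ≤ 6 := hE ▸ Finset.card_le_univ b₀
      generalize O.card = N at *
      generalize b₀.card = s at *
      -- For `s` = 3 the number of lines is even and at most 5, so it is 2 or 4; for `s` = 6 it is
      -- 1. The values 4 and 5 are impossible, since they require a number of lines divisible by 3
      -- but at most 2.
      interval_cases s <;> omega
    · have := IsHomogeneous.prod O l (fun _ => 1) fun b hb => hl b hb
      simpa using this
    · exact Finset.prod_ne_zero_iff.mpr fun b hb => hl0 b hb
    · have h1 : ∀ b ∈ O, ∃ c : K, twist σ (q σ) (l b) = c • l (σ • b) := by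
        intro b hb
        refine huniq _ ((hOsmul σ b).mpr hb) _ (htw σ (hl b hb)) fun ε hε => ?_
        obtain ⟨η, hη, rfl⟩ := Finset.mem_smul_finset.mp hε
        rw [hev σ η (hl b hb)]
        exact (hlb b hb η).mp hη
      choose! c hc using h1
      refine ⟨∏ b ∈ O, c b, ?_⟩
      rw [map_prod, Finset.prod_congr rfl hc, Finset.prod_smul]
      congr 1
      refine Finset.prod_bij (fun b _ => σ • b) (fun b hb => (hOsmul σ b).mpr hb)
        (fun b _ b' _ h => smul_left_cancel σ h) (fun b hb => ⟨σ⁻¹ • b, ?_, smul_inv_smul _ _⟩)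
        fun _ _ => rfl
      rw [← hOsmul σ, smul_inv_smul]
      exact hb
  · obtain ⟨h, hh, hh0, hhE⟩ := hspecial.resolve_left hcol
    push Not at hcol
    let ε : Fin 6 ≃ E := (Fintype.equivFinOfCardEq hE).symm
    have hnc : ∀ i j l : Fin 6, i ≠ j → i ≠ l → j ≠ l →
        Noncollinear (a (ε i)) (a (ε j)) (a (ε l)) := fun i j l h1 h2 h3 =>
      hcol _ _ _ (ε.injective.ne h1) (ε.injective.ne h2) (ε.injective.ne h3)
    -- Vanishing at the six points and at one more point of the line through two of them kills a
    -- conic. So conics through the six points are determined by a single value, and the transform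
    -- of `h` is a multiple of `h`.
    have hz : ∀ g : MvPolynomial (Fin 3) K, g.IsHomogeneous 2 → (∀ η, eval (a η) g = 0) →
        eval (fun i => a (ε 0) i + a (ε 1) i) g = 0 → g = 0 := fun g hg hgE h01 =>
      quadratic_eq_zero (c := a (ε 2)) (d := a (ε 3)) (e := a (ε 4))
        (hnc _ _ _ (by decide) (by decide) (by decide))
        (hnc _ _ _ (by decide) (by decide) (by decide))
        (hnc _ _ _ (by decide) (by decide) (by decide))
        (hnc _ _ _ (by decide) (by decide) (by decide)) hg (hgE _) (hgE _) (hgE _) (hgE _) (hgE _)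
        h01
    have hβ : eval (fun i => a (ε 0) i + a (ε 1) i) h ≠ 0 := fun h1 => hh0 (hz h hh hhE h1)
    refine ⟨2, by decide, h, hh, hh0, fun σ => ?_⟩
    have hEσ : ∀ η, eval (a η) (twist σ (q σ) h) = 0 := by
      intro η
      have := (hev σ (σ⁻¹ • η) hh).mpr (hhE _)
      rwa [smul_inv_smul] at this
    have hsm : ∀ (c : K) {g : MvPolynomial (Fin 3) K}, g.IsHomogeneous 2 →
        (c • g).IsHomogeneous 2 := fun c g hg => by
      rw [smul_eq_C_mul]
      exact hg.C_mul c
    generalize hg : twist σ (q σ) h = g at hEσ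
    have hgh : g.IsHomogeneous 2 := hg ▸ htw σ hh
    set v := fun i => a (ε 0) i + a (ε 1) i
    refine ⟨eval v g / eval v h, sub_eq_zero.mp (hz _ (hgh.sub (hsm _ hh)) (fun η => ?_) ?_)⟩
    · rw [map_sub, smul_eval, hEσ, hhE, mul_zero, sub_zero]
    · rw [map_sub, smul_eval, div_mul_cancel₀ _ hβ, sub_self]

end Six

end SeveriBrauer

/-! ### Values of rational functions at geometric points. -/

namespace SeveriBrauer

open MvPolynomial

section Values

variable {k K F L A B : Type u} [Field k] [Field K] [Field F] [Field L] [Algebra k K] [Algebra k F]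
  [Algebra K L] [Algebra F L] [Algebra k L] [IsScalarTower k K L] [IsScalarTower k F L]
  [CommRing A] [CommRing B] [Algebra k A] [Algebra A B] [Algebra K B] [Algebra k B]
  [IsScalarTower k A B] [IsScalarTower k K B] [Algebra A F] [Algebra B L]
  [Algebra A L] [IsScalarTower A F L] [IsScalarTower A B L] [IsScalarTower K B L]

/-- The function `h`, a fraction of elements of `B`, takes the value `c` at the `K`-point `e`. -/
def HasValue (e : B →ₐ[K] K) (h : L) (c : K) : Prop :=
  ∃ b s : B, e s ≠ 0 ∧ h * algebraMap B L s = algebraMap B L b ∧ e b = c * e s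

namespace HasValue

variable {e : B →ₐ[K] K} {h h' : L} {c c' : K}

lemma of_algebraMap (e : B →ₐ[K] K) (b : B) : HasValue e (algebraMap B L b) (e b) :=
  ⟨b, 1, by simp, by simp, by simp⟩

lemma const (L : Type u) [Field L] [Algebra K L] [Algebra B L] [IsScalarTower K B L]
    (e : B →ₐ[K] K) (c : K) : HasValue e (algebraMap K L c) c := by
  have := of_algebraMap (L := L) e (algebraMap K B c)
  rwa [← IsScalarTower.algebraMap_apply, e.commutes] at this

lemma add (H : HasValue e h c) (H' : HasValue e h' c') : HasValue e (h + h') (c + c') := by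
  obtain ⟨b, s, hs, h1, h2⟩ := H
  obtain ⟨b', s', hs', h1', h2'⟩ := H'
  refine ⟨b * s' + b' * s, s * s', by simp [hs, hs'], ?_, ?_⟩
  · simp only [map_mul, map_add]
    rw [← h1, ← h1']
    ring
  · simp only [map_mul, map_add, h2, h2']
    ring

lemma mul (H : HasValue e h c) (H' : HasValue e h' c') : HasValue e (h * h') (c * c') := by
  obtain ⟨b, s, hs, h1, h2⟩ := H
  obtain ⟨b', s', hs', h1', h2'⟩ := H'
  refine ⟨b * b', s * s', by simp [hs, hs'], ?_, ?_⟩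
  · simp only [map_mul]
    rw [← h1, ← h1']
    ring
  · simp only [map_mul, h2, h2']
    ring

lemma unique (hB : Function.Injective (algebraMap B L)) (H : HasValue e h c)
    (H' : HasValue e h c') : c = c' := by
  obtain ⟨b, s, hs, h1, h2⟩ := H
  obtain ⟨b', s', hs', h1', h2'⟩ := H'
  have h3 : b * s' = b' * s := hB (by rw [map_mul, map_mul, ← h1, ← h1']; ring)
  have h4 := congrArg e h3
  rw [map_mul, map_mul, h2, h2'] at h4
  exact mul_right_cancel₀ (mul_ne_zero hs hs') (by linear_combination h4)

lemma aeval {v : Fin 3 → L} {a : Fin 3 → K} (H : ∀ i, HasValue e (v i) (a i))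
    (f : MvPolynomial (Fin 3) K) : HasValue e (MvPolynomial.aeval v f) (eval a f) := by
  induction f using MvPolynomial.induction_on with
  | C c =>
    rw [← algebraMap_eq, AlgHom.commutes, algebraMap_eq, eval_C]
    exact const L e c
  | add p q hp hq =>
    rw [map_add, map_add]
    exact hp.add hq
  | mul_X p i hp =>
    rw [map_mul, map_mul, aeval_X, eval_X]
    exact hp.mul (H i)

end HasValue

/-- The extension of a `K`-valued point to `K ⊗ A`. -/
noncomputable def extendPoint [Algebra.IsPushout k A K B] (ε : A →ₐ[k] K) : B →ₐ[K] K :=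
  let f : B →ₐ[k] K := Algebra.pushoutDesc B ε (AlgHom.id k K) fun _ _ => mul_comm _ _
  { f with commutes' := fun c => Algebra.pushoutDesc_right B ε (AlgHom.id k K) _ c }

@[simp]
lemma extendPoint_algebraMap [Algebra.IsPushout k A K B] (ε : A →ₐ[k] K) (a : A) :
    extendPoint (B := B) ε (algebraMap A B a) = ε a :=
  Algebra.pushoutDesc_left B ε (AlgHom.id k K) _ a

/-- The action fixes `A` and moves the scalars in `K`, so it preserves `K ⊗ A`; evaluation at `σ ∘
ε` is the conjugate of evaluation at `ε`. This transports values of functions, in `HasValue.conj`.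
-/
lemma exists_conj_eq [Algebra.IsPushout k A K B] [Algebra.IsPushout k F K L] (ε : A →ₐ[k] K)
    (σ : K ≃ₐ[k] K) (b : B) : ∃ b' : B, algebraMap B L b' = conj F L σ (algebraMap B L b) ∧
      extendPoint (B := B) ((σ : K →ₐ[k] K).comp ε) b' = σ (extendPoint ε b) := by
  have H : Algebra.IsPushout k A K B := inferInstance
  refine H.out.inductionOn b _ ?_ ?_ ?_ ?_
  · exact ⟨0, by simp⟩
  · intro c
    refine ⟨algebraMap K B (σ c), ?_, ?_⟩
    · change _ = conj F L σ (algebraMap B L (algebraMap K B c))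
      rw [← IsScalarTower.algebraMap_apply, ← IsScalarTower.algebraMap_apply, conj_right]
    · change _ = σ (extendPoint ε (algebraMap K B c))
      rw [AlgHom.commutes, AlgHom.commutes]
      rfl
  · rintro a b ⟨b', h1, h2⟩
    refine ⟨a • b', ?_, ?_⟩
    · rw [Algebra.smul_def, Algebra.smul_def, map_mul, h1, map_mul, map_mul,
        ← IsScalarTower.algebraMap_apply, IsScalarTower.algebraMap_apply A F L, conj_left]
    · rw [Algebra.smul_def, Algebra.smul_def, map_mul, map_mul, map_mul, h2,
        extendPoint_algebraMap, extendPoint_algebraMap]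
      rfl
  · rintro a b ⟨a', h1, h2⟩ ⟨b', h3, h4⟩
    exact ⟨a' + b', by rw [map_add, map_add, map_add, h1, h3],
      by rw [map_add, map_add, map_add, h2, h4]⟩

lemma HasValue.conj [Algebra.IsPushout k A K B] [Algebra.IsPushout k F K L] {ε : A →ₐ[k] K}
    {h : L} {c : K} (H : HasValue (extendPoint (B := B) ε) h c) (σ : K ≃ₐ[k] K) :
    HasValue (extendPoint (B := B) ((σ : K →ₐ[k] K).comp ε)) (conj F L σ h) (σ c) := by
  obtain ⟨b, s, hs, h1, h2⟩ := H
  obtain ⟨b', hb1, hb2⟩ := exists_conj_eq (F := F) (L := L) ε σ b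
  obtain ⟨s', hs1, hs2⟩ := exists_conj_eq (F := F) (L := L) ε σ s
  refine ⟨b', s', ?_, ?_, ?_⟩
  · rw [hs2]
    simpa using hs
  · rw [hs1, hb1, ← map_mul, h1]
  · rw [hb2, hs2, h2, map_mul]

variable [Algebra.IsPushout k A K B] [Algebra.IsPushout k F K L] {t : Fin 3 → L} {h₀ : L}

/-- The substitution `q` takes the coordinates of the conjugate point to the conjugated coordinates
of the point, up to a factor: both sides are values of one rational function at the conjugate point.
The indices `i`, `i'` are charts containing the two points. -/
lemma IsTwist.eval_eq (hB : Function.Injective (algebraMap B L)) (ht : IsProjCoord K t)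
    {σ : K ≃ₐ[k] K} {q : Fin 3 → MvPolynomial (Fin 3) K} (hq : IsTwist F t h₀ σ q)
    {ε : A →ₐ[k] K} {a a' : Fin 3 → K} {i i' : Fin 3}
    (ha : ∀ j, HasValue (extendPoint (B := B) ε) (t j / t i) (a j))
    (ha' : ∀ j, HasValue (extendPoint (B := B) ((σ : K →ₐ[k] K).comp ε)) (t j / t i') (a' j)) :
    ∃ c : K, c ≠ 0 ∧ ∀ l, eval a' (q l) = c * σ (a l) := by
  have hti := ht.ne_zero i
  have hti' := ht.ne_zero i'
  have hq0 := ht.aeval_ne_zero (hq.hom 0) hq.ne_zero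
  have hφ : ∀ z, conj F L σ z = 0 → z = 0 := fun z hz =>
    (map_eq_zero_iff _ (conj F L σ : L →+* L).injective).mp hz
  have hqne : ∀ l, aeval t (q l) ≠ 0 := fun l hl => by
    rw [← hq.coord] at hl
    exact ht.ne_zero l (hφ _ ((mul_eq_zero.mp hl).resolve_right hq0))
  have key : ∀ l, eval a' (q l) = eval a' (q i) * σ (a l) := by
    intro l
    have h1 : ∀ l, HasValue (extendPoint (B := B) ((σ : K →ₐ[k] K).comp ε))
        (aeval t (q l) / t i') (eval a' (q l)) := fun l => by
      have := HasValue.aeval ha' (q l)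
      rwa [aeval_div (hq.hom l), pow_one] at this
    have h2 := (ha l).conj (F := F) σ
    have h3 : aeval t (q i) / t i' * conj F L σ (t l / t i) = aeval t (q l) / t i' := by
      rw [map_div₀, ← hq.coord i, ← hq.coord l]
      have : conj F L σ (t i) ≠ 0 := fun h => hti (hφ _ h)
      field_simp
    have h4 := (h1 i).mul h2
    rw [h3] at h4
    exact (h1 l).unique hB h4
  refine ⟨eval a' (q i), fun hc => ?_, key⟩
  simp only [hc, zero_mul] at key
  choose n hn hnv using fun l => eval_linear (hq.hom l)
  -- If the factor vanished, the matrix of `q` would kill the nonzero vector `a'`. The forms `q l`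
  -- would then be dependent and, after undoing `σ`, so would the coordinates `t l`.
  have hker : Matrix.mulVec (Matrix.of n) a' = 0 := by
    funext l
    rw [Pi.zero_apply, ← key l, hnv]
    simp [Matrix.mulVec, dotProduct, Fin.sum_univ_three]
  have ha0 : a' ≠ 0 := by
    intro h
    have h1 := ha' i'
    rw [div_self hti'] at h1
    have h2 := h1.unique hB (by simpa using HasValue.const L _ (1 : K))
    rw [h] at h2
    exact zero_ne_one h2
  obtain ⟨c, hc0, hc⟩ := Matrix.exists_vecMul_eq_zero_iff.mpr
    (Matrix.exists_mulVec_eq_zero_iff.mp ⟨a', ha0, hker⟩)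
  have hsum : ∑ l, c l • q l = 0 := by
    have h1 : ∀ j, ∑ l, c l * n l j = 0 := fun j => congrFun hc j
    calc ∑ l, c l • q l = ∑ l, ∑ j, (c l * n l j) • (X j : MvPolynomial (Fin 3) K) := by
          refine Finset.sum_congr rfl fun l _ => ?_
          conv_lhs => rw [hn l, Finset.smul_sum]
          simp_rw [smul_smul]
      _ = 0 := by
          rw [Finset.sum_comm]
          refine Finset.sum_eq_zero fun j _ => ?_
          rw [← Finset.sum_smul, h1, zero_smul]
  have h1 : conj F L σ (aeval t (∑ l, σ.symm (c l) • (X l : MvPolynomial (Fin 3) K))) = 0 := by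
    refine (mul_eq_zero.mp ?_).resolve_right hq0
    have h2 := congrArg (aeval t) hsum
    simp only [map_sum, map_smul, map_zero] at h2
    rw [map_sum, map_sum, Finset.sum_mul, ← h2]
    refine Finset.sum_congr rfl fun l _ => ?_
    rw [map_smul, conj_smul, σ.apply_symm_apply, aeval_X, smul_mul_assoc, hq.coord]
  have h2 := ht.inj 1 _ (IsHomogeneous.sum _ _ _ fun l _ => by
    rw [smul_eq_C_mul]; exact (isHomogeneous_X K l).C_mul _) (hφ _ h1)
  refine hc0 (funext fun l => ?_)
  have := Fintype.linearIndependent_iff.mp linearIndependent_X _ h2 l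
  simpa using this

/-- Six conjugate points in special position give projective coordinates over `F`. -/
theorem exists_coord_of_special [IsAlgClosure k K] (h3 : (3 : k) ≠ 0) (ht : IsProjCoord K t)
    {I : Type*} (S : I → Subalgebra k F)
    (hS : ∀ β : L → L → L, IsAltBider K β →
      ((∀ j, ∀ u ∈ chart K t j, ∀ v ∈ chart K t j, β u v ∈ chart K t j) ↔
        ∀ i, ∀ u ∈ Submodule.span K (algebraMap F L '' S i),
          ∀ v ∈ Submodule.span K (algebraMap F L '' S i),
            β u v ∈ Submodule.span K (algebraMap F L '' S i)))
    (hB : Function.Injective (algebraMap B L)) {E : Type*} [Fintype E]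
    [MulAction (K ≃ₐ[k] K) E] [MulAction.IsPretransitive (K ≃ₐ[k] K) E] (hE : Fintype.card E = 6)
    (ev : E → A →ₐ[k] K) (hev : ∀ (σ : K ≃ₐ[k] K) ε, ev (σ • ε) = (σ : K →ₐ[k] K).comp (ev ε))
    {a : E → Fin 3 → K} {i : E → Fin 3}
    (ha : ∀ ε j, HasValue (extendPoint (B := B) (ev ε)) (t j / t (i ε)) (a ε j))
    (hdist : ∀ ε ε', ε ≠ ε' → ∃ i j, a ε i * a ε' j ≠ a ε j * a ε' i)
    (hspecial : (∃ ε₁ ε₂ ε₃, ε₁ ≠ ε₂ ∧ ε₁ ≠ ε₃ ∧ ε₂ ≠ ε₃ ∧ ¬ Noncollinear (a ε₁) (a ε₂) (a ε₃)) ∨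
      ∃ h : MvPolynomial (Fin 3) K, h.IsHomogeneous 2 ∧ h ≠ 0 ∧ ∀ ε, eval (a ε) h = 0) :
    ∃ Z : Fin 3 → MvPolynomial (Fin 3) K, (∀ i, (Z i).IsHomogeneous 1) ∧ LinearIndependent K Z ∧
      ∀ i, aeval t (Z i) / aeval t (Z 0) ∈ Set.range (algebraMap F L) := by
  have : IsAlgClosed K := IsAlgClosure.isAlgClosed k
  obtain ⟨h₀, h0, hspan⟩ := ht.exists_span_cubic S hS
  choose q hq using exists_isTwist (k := k) (F := F) ht h0 hspan
  obtain ⟨d, hd, f, hf, hf0, hinv⟩ := exists_invariant hE hdist (q := q) (fun σ => (hq σ).hom)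
    (fun σ ε => (hq σ).eval_eq hB ht (ha ε) fun j => by
      rw [← hev]
      exact ha (σ • ε) j)
    (fun σ d f hf hf0 h => by
      have h1 := (hq σ).conj_aeval hf
      rw [h, map_zero] at h1
      have h2 := (mul_eq_zero.mp h1).resolve_right
        (pow_ne_zero _ (ht.aeval_ne_zero ((hq σ).hom 0) (hq σ).ne_zero))
      exact ht.aeval_ne_zero hf hf0
        ((map_eq_zero_iff _ (conj F L σ : L →+* L).injective).mp h2)) hspecial
  exact exists_coord_of_invariant h3 ht h0 hspan hd hf hf0 fun σ => ⟨q σ, hq σ, hinv σ⟩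

end Values

end SeveriBrauer

/-! ### Function fields and sections under extension of the base field. -/

namespace SeveriBrauer

section FractionField

variable {k K A B F L : Type u} [Field k] [Field K] [CommRing A] [CommRing B] [Field F] [Field L]
  [Algebra k K] [Algebra k A] [Algebra k B] [Algebra A B] [Algebra K B] [Algebra A F] [Algebra B L]
  [Algebra k F] [Algebra K L] [Algebra F L] [Algebra k L] [Algebra A L]
  [IsScalarTower k A B] [IsScalarTower k K B] [IsScalarTower k A F] [IsScalarTower k K L]
  [IsScalarTower k F L] [IsScalarTower A F L] [IsScalarTower A B L] [IsScalarTower K B L]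
  [IsScalarTower k B L] [IsScalarTower k A L]

/-- The function field of `K ⊗ A` is `K ⊗ Frac A`. -/
lemma isPushout_fractionField [IsDomain A] [IsDomain B] [Algebra.IsAlgebraic k K]
    [IsFractionRing A F] [IsFractionRing B L] [Algebra.IsPushout k A K B] :
    Algebra.IsPushout k F K L := by
  have hAB : Function.Injective (algebraMap A B) := by
    have h : Function.Injective (algebraMap A L) := by
      rw [IsScalarTower.algebraMap_eq A F L]
      exact (algebraMap F L).injective.comp (IsFractionRing.injective A F)
    rw [IsScalarTower.algebraMap_eq A B L] at h
    exact Function.Injective.of_comp h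
  have : FaithfulSMul A B := (faithfulSMul_iff_algebraMap_injective A B).mpr hAB
  have hint : Algebra.IsIntegral A B := by
    refine ⟨fun b => ?_⟩
    refine (inferInstance : Algebra.IsPushout k A K B).out.inductionOn b _ isIntegral_zero ?_ ?_ ?_
    · intro c
      have h1 : IsIntegral k c := Algebra.IsIntegral.isIntegral c
      exact (h1.map (IsScalarTower.toAlgHom k K B)).tower_top
    · intro a b hb
      rw [Algebra.smul_def]
      exact isIntegral_algebraMap.mul hb
    · intro a b ha hb
      exact ha.add hb
  -- As `B` is integral over `A`, every nonzero element of `B` divides a nonzero element of `A`. So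
  -- inverting the latter already gives the fraction field of `B`.
  have hloc : IsLocalization (Algebra.algebraMapSubmonoid B (nonZeroDivisors A)) L := by
    refine (isLocalization_iff _ _).mpr ⟨?_, ?_, ?_⟩
    · rintro ⟨_, a, ha, rfl⟩
      refine isUnit_iff_ne_zero.mpr fun h => nonZeroDivisors.ne_zero ha ?_
      exact hAB (IsFractionRing.injective B L (by simpa using h))
    · intro z
      obtain ⟨b, c, hc, rfl⟩ := IsFractionRing.div_surjective (A := B) z
      have hc0 := nonZeroDivisors.ne_zero hc
      obtain ⟨d, a, ha, h⟩ := Algebra.IsAlgebraic.exists_smul_eq_mul A (1 : B) (b := c)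
        hc0
      refine ⟨⟨b * d, ⟨algebraMap A B a, a, mem_nonZeroDivisors_of_ne_zero ha, rfl⟩⟩, ?_⟩
      have hcL : algebraMap B L c ≠ 0 := fun h0 => hc0 (IsFractionRing.injective B L (by simpa using h0))
      rw [Algebra.smul_def, mul_one] at h
      dsimp only
      rw [h, map_mul, map_mul]
      field_simp
    · intro x y h
      exact ⟨1, by rw [IsFractionRing.injective B L h]⟩
  have h1 : Algebra.IsPushout A F B L :=
    (Algebra.isPushout_of_isLocalization (nonZeroDivisors A) F B L).symm
  exact (Algebra.IsPushout.comp_iff (R := k) (S := A) (R' := K) (S' := B) (T := F) (T' := L)).mpr h1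

end FractionField

section Span

variable {k K A B F L : Type u} [Field k] [Field K] [CommRing A] [CommRing B] [Field F] [Field L]
  [Algebra k K] [Algebra k A] [Algebra k B] [Algebra A B] [Algebra K B] [Algebra A F] [Algebra B L]
  [Algebra K L] [Algebra F L] [Algebra A L] [IsScalarTower k A B] [IsScalarTower k K B]
  [IsScalarTower A F L] [IsScalarTower A B L] [IsScalarTower K B L]

/-- `K ⊗ A` is the `K`-span of `A`. -/
lemma range_algebraMap_eq_span [Algebra.IsPushout k A K B] : Set.range (algebraMap B L) =
    Submodule.span K (algebraMap F L '' (Set.range (algebraMap A F))) := by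
  rw [← Set.range_comp, ← RingHom.coe_comp, ← IsScalarTower.algebraMap_eq]
  ext z
  constructor
  · rintro ⟨b, rfl⟩
    have H : Algebra.IsPushout k K A B := Algebra.IsPushout.symm inferInstance
    refine H.out.inductionOn b (fun b => algebraMap B L b ∈ Submodule.span K _) ?_ ?_ ?_ ?_
    · rw [map_zero]
      exact Submodule.zero_mem _
    · intro a
      refine Submodule.subset_span ⟨a, ?_⟩
      exact IsScalarTower.algebraMap_apply A B L a
    · intro c b hb
      rw [Algebra.smul_def, map_mul, ← IsScalarTower.algebraMap_apply, ← Algebra.smul_def]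
      exact Submodule.smul_mem _ _ hb
    · intro a b ha hb
      rw [map_add]
      exact Submodule.add_mem _ ha hb
  · intro hz
    induction hz using Submodule.span_induction with
    | mem z hz =>
      obtain ⟨a, rfl⟩ := hz
      exact ⟨algebraMap A B a, (IsScalarTower.algebraMap_apply A B L a).symm⟩
    | zero => exact ⟨0, map_zero _⟩
    | add x y _ _ hx hy =>
      obtain ⟨x, rfl⟩ := hx
      obtain ⟨y, rfl⟩ := hy
      exact ⟨x + y, map_add _ _ _⟩
    | smul c x _ hx =>
      obtain ⟨x, rfl⟩ := hx
      exact ⟨algebraMap K B c * x, by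
        rw [map_mul, ← IsScalarTower.algebraMap_apply, Algebra.smul_def]⟩

end Span

section Sections

variable {R : Type u} [CommRing R] {X : Scheme.{u}} (g : X ⟶ Spec (CommRingCat.of R))

/-- The structure of an `R`-algebra on the sections of an `R`-scheme. -/
noncomputable def sectionHom (U : X.Opens) : CommRingCat.of R ⟶ Γ(X, U) :=
  (Scheme.ΓSpecIso (CommRingCat.of R)).inv ≫ g.appTop ≫ X.presheaf.map (homOfLE le_top).op

lemma sectionHom_map {U U' : X.Opens} (i : U' ≤ U) :
    sectionHom g U ≫ X.presheaf.map (homOfLE i).op = sectionHom g U' := by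
  simp only [sectionHom, Category.assoc, ← Functor.map_comp]
  rfl

lemma ι_comp_eq_toSpecΓ_comp (U : X.Opens) :
    U.ι ≫ g = U.toSpecΓ ≫ Spec.map (sectionHom g U) := by
  rw [sectionHom, Spec.map_comp, Spec.map_comp, Category.assoc,
    Scheme.Opens.toSpecΓ_SpecMap_presheaf_map_top_assoc, ← Scheme.toSpecΓ_naturality_assoc,
    toSpecΓ_SpecMap_ΓSpecIso_inv, Category.comp_id]

lemma sectionHom_eq {U : X.Opens} {φ : CommRingCat.of R ⟶ Γ(X, U)}
    (h : U.ι ≫ g = U.toSpecΓ ≫ Spec.map φ) : sectionHom g U = φ := by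
  rw [ι_comp_eq_toSpecΓ_comp] at h
  have h1 := congrArg Scheme.Hom.appTop h
  simp only [Scheme.Hom.comp_appTop, Scheme.Opens.toSpecΓ_appTop, ← Category.assoc, cancel_mono,
    Scheme.ΓSpecIso_naturality, cancel_epi] at h1
  exact h1

variable {S : Type u} [CommRing S] {Y : Scheme.{u}} {v : Y ⟶ Spec (CommRingCat.of S)} {m : X ⟶ Y}
  {ρ : CommRingCat.of S ⟶ CommRingCat.of R}

lemma sectionHom_comp_app (h : m ≫ v = g ≫ Spec.map ρ) (W : Y.Opens) :
    sectionHom v W ≫ m.app W = ρ ≫ sectionHom g (m ⁻¹ᵁ W) := by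
  have h1 := congrArg Scheme.Hom.appTop h
  rw [Scheme.Hom.comp_appTop, Scheme.Hom.comp_appTop] at h1
  simp only [sectionHom, Category.assoc]
  rw [Scheme.ΓSpecIso_inv_naturality_assoc, ← reassoc_of% h1, Scheme.Hom.naturality]
  rfl

/-- Restrict the pullback square to `W` and its preimage, which are affine; global sections turn a
pullback of affine schemes into a pushout of rings. -/
lemma isPushout_sections [IsAffineHom m] (h : IsPullback m g v (Spec.map ρ)) {W : Y.Opens}
    (hW : IsAffineOpen W) :
    IsPushout (sectionHom v W) ρ (m.app W) (sectionHom g (m ⁻¹ᵁ W)) := by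
  have : IsAffine W.toScheme := hW
  have h1 := ((isPullback_morphismRestrict m W).flip.paste_horiz h.flip).flip
  have h2 := isPushout_appTop_of_isPullback h1
  refine h2.of_iso (Scheme.ΓSpecIso _) W.topIso (Scheme.ΓSpecIso _) (m ⁻¹ᵁ W).topIso ?_ ?_ ?_ ?_
  · rw [ι_comp_eq_toSpecΓ_comp, Scheme.Hom.comp_appTop, Scheme.Opens.toSpecΓ_appTop,
      Scheme.ΓSpecIso_naturality_assoc, Category.assoc, Category.assoc, Iso.inv_hom_id,
      Category.comp_id]
  · simp
  · have h3 := congrArg Scheme.Hom.appTop (Scheme.Opens.toSpecΓ_naturality m W)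
    rw [Scheme.Hom.comp_appTop, Scheme.Hom.comp_appTop, Scheme.Opens.toSpecΓ_appTop,
      Scheme.Opens.toSpecΓ_appTop, Scheme.ΓSpecIso_naturality_assoc, Category.assoc,
      cancel_epi] at h3
    rw [← Iso.inv_comp_eq, ← reassoc_of% h3, Iso.inv_hom_id, Category.comp_id]
  · rw [ι_comp_eq_toSpecΓ_comp, Scheme.Hom.comp_appTop, Scheme.Opens.toSpecΓ_appTop,
      Scheme.ΓSpecIso_naturality_assoc, Category.assoc, Category.assoc, Iso.inv_hom_id,
      Category.comp_id]

end Sections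

end SeveriBrauer

/-! ### Regular functions and regular biderivations on integral schemes. -/

namespace SeveriBrauer

section Regular

variable {X : Scheme.{u}} [IsIntegral X]

/-- The rational function `h` is regular at `y`. -/
def IsRegularAt (y : X) (h : X.functionField) : Prop :=
  ∃ s : X.presheaf.stalk y, algebraMap (X.presheaf.stalk y) X.functionField s = h

lemma stalk_algebraMap_injective (y : X) :
    Function.Injective (algebraMap (X.presheaf.stalk y) X.functionField) :=
  IsFractionRing.injective _ _

lemma IsRegularAt.of_section {U : X.Opens} [Nonempty U] {y : X} (hy : y ∈ U) {b s : Γ(X, U)}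
    (hs : y ∈ X.basicOpen s) {h : X.functionField}
    (hb : h * X.germToFunctionField U s = X.germToFunctionField U b) : IsRegularAt y h := by
  rw [Scheme.mem_basicOpen X s y hy] at hs
  obtain ⟨u, hu⟩ := hs
  refine ⟨X.presheaf.germ U y hy b * ((u⁻¹ : (X.presheaf.stalk y)ˣ) : X.presheaf.stalk y), ?_⟩
  have h1 := Scheme.algebraMap_germ_eq_germToFunctionField X hy s
  have h2 := Scheme.algebraMap_germ_eq_germToFunctionField X hy b
  rw [map_mul, h2, ← hb, ← h1, mul_assoc, ← map_mul, ← hu, Units.mul_inv, map_one, mul_one]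

lemma IsRegularAt.exists_section {U : X.Opens} (hU : IsAffineOpen U) [Nonempty U] {y : X}
    (hy : y ∈ U) {h : X.functionField} (H : IsRegularAt y h) : ∃ b s : Γ(X, U),
      y ∈ X.basicOpen s ∧ h * X.germToFunctionField U s = X.germToFunctionField U b := by
  obtain ⟨z, rfl⟩ := H
  let : Algebra Γ(X, U) (X.presheaf.stalk y) := (X.presheaf.germ U y hy).hom.toAlgebra
  have hloc : IsLocalization.AtPrime (X.presheaf.stalk y) (hU.primeIdealOf ⟨y, hy⟩).asIdeal :=
    hU.isLocalization_stalk ⟨y, hy⟩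
  obtain ⟨⟨b, s⟩, hbs⟩ := IsLocalization.surj (hU.primeIdealOf ⟨y, hy⟩).asIdeal.primeCompl z
  refine ⟨b, s, ?_, ?_⟩
  · rw [Scheme.mem_basicOpen X _ y hy]
    exact IsLocalization.map_units (X.presheaf.stalk y) s
  · rw [← Scheme.algebraMap_germ_eq_germToFunctionField X hy,
      ← Scheme.algebraMap_germ_eq_germToFunctionField X hy, ← map_mul]
    exact congrArg _ hbs

/-- Whether a rational function vanishes at a point can be tested on any chart. -/
lemma mem_basicOpen_congr {U U' : X.Opens} [Nonempty U] [Nonempty U'] {y : X} (hy : y ∈ U)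
    (hy' : y ∈ U') {b s : Γ(X, U)} {b' s' : Γ(X, U')} {h : X.functionField}
    (hs : y ∈ X.basicOpen s) (hs' : y ∈ X.basicOpen s')
    (hb : h * X.germToFunctionField U s = X.germToFunctionField U b)
    (hb' : h * X.germToFunctionField U' s' = X.germToFunctionField U' b') :
    y ∈ X.basicOpen b ↔ y ∈ X.basicOpen b' := by
  rw [Scheme.mem_basicOpen X _ y hy] at hs ⊢
  rw [Scheme.mem_basicOpen X _ y hy'] at hs' ⊢
  have h1 : X.presheaf.germ U y hy b * X.presheaf.germ U' y hy' s' =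
      X.presheaf.germ U' y hy' b' * X.presheaf.germ U y hy s := by
    apply stalk_algebraMap_injective y
    rw [map_mul, map_mul]
    simp only [Scheme.algebraMap_germ_eq_germToFunctionField]
    rw [← hb, ← hb']
    ring
  constructor <;> intro hu
  · exact isUnit_of_mul_isUnit_left (h1 ▸ hu.mul hs')
  · exact isUnit_of_mul_isUnit_left (h1.symm ▸ hu.mul hs)

/-- A rational function that is regular at all points of an affine open is a section on it. -/
lemma mem_range_of_isRegularAt {U : X.Opens} (hU : IsAffineOpen U) [Nonempty U]
    {h : X.functionField} (H : ∀ y ∈ U, IsRegularAt y h) :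
    h ∈ Set.range (X.germToFunctionField U) := by
  -- The ideal of denominators of `h`. Regularity at every point means that its basic opens cover
  -- `U`, so it contains 1.
  let I : Ideal Γ(X, U) :=
    { carrier := {s | ∃ b, h * X.germToFunctionField U s = X.germToFunctionField U b}
      add_mem' := by
        rintro s s' ⟨b, hb⟩ ⟨b', hb'⟩
        exact ⟨b + b', by rw [map_add, map_add, mul_add, hb, hb']⟩
      zero_mem' := ⟨0, by rw [map_zero, mul_zero]⟩
      smul_mem' := by
        rintro a s ⟨b, hb⟩
        exact ⟨a * b, by rw [smul_eq_mul, map_mul, map_mul, ← hb]; ring⟩ }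
  have hI : Ideal.span (I : Set Γ(X, U)) = ⊤ := by
    rw [← hU.iSup_basicOpen_eq_self_iff]
    refine le_antisymm (iSup_le fun f => X.basicOpen_le _) fun y hy => ?_
    obtain ⟨b, s, hs, hb⟩ := (H y hy).exists_section hU hy
    exact TopologicalSpace.Opens.mem_iSup.mpr ⟨⟨s, b, hb⟩, hs⟩
  rw [Ideal.span_eq, Ideal.eq_top_iff_one] at hI
  obtain ⟨b, hb⟩ := hI
  exact ⟨b, by rw [← hb, map_one, mul_one]⟩

lemma isRegularAt_section {U : X.Opens} [Nonempty U] {y : X} (hy : y ∈ U) (b : Γ(X, U)) :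
    IsRegularAt y (X.germToFunctionField U b) :=
  ⟨X.presheaf.germ U y hy b, Scheme.algebraMap_germ_eq_germToFunctionField X hy b⟩

variable {K : Type u} [Field K] [Algebra K X.functionField]

/-- Bring `u` and `v` to the common denominator `s * s'`; by `IsAltBider.div_div` the value then has
denominator `(s * s') ^ 3`, a unit at `y`. -/
lemma IsAltBider.isRegularAt {β : X.functionField → X.functionField → X.functionField}
    (hβ : IsAltBider K β) {U : X.Opens} (hU : IsAffineOpen U) [Nonempty U]
    (H : ∀ u ∈ Set.range (X.germToFunctionField U), ∀ v ∈ Set.range (X.germToFunctionField U),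
      β u v ∈ Set.range (X.germToFunctionField U)) {y : X} (hy : y ∈ U) {u v : X.functionField}
    (hu : IsRegularAt y u) (hv : IsRegularAt y v) : IsRegularAt y (β u v) := by
  obtain ⟨b, s, hs, hb⟩ := hu.exists_section hU hy
  obtain ⟨b', s', hs', hb'⟩ := hv.exists_section hU hy
  have hne : ∀ {s : Γ(X, U)}, y ∈ X.basicOpen s → X.germToFunctionField U s ≠ 0 := by
    intro s hs h0
    rw [Scheme.mem_basicOpen X _ y hy] at hs
    rw [← Scheme.algebraMap_germ_eq_germToFunctionField X hy] at h0
    have := stalk_algebraMap_injective y (h0.trans (map_zero _).symm)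
    rw [this] at hs
    exact not_isUnit_zero hs
  obtain ⟨c₁, h1⟩ := H _ ⟨b * s', rfl⟩ _ ⟨b' * s, rfl⟩
  obtain ⟨c₂, h2⟩ := H _ ⟨s * s', rfl⟩ _ ⟨b' * s, rfl⟩
  obtain ⟨c₃, h3⟩ := H _ ⟨s * s', rfl⟩ _ ⟨b * s', rfl⟩
  have hss : X.germToFunctionField U (s * s') ≠ 0 := by
    rw [map_mul]
    exact mul_ne_zero (hne hs) (hne hs')
  have eu : u = X.germToFunctionField U (b * s') / X.germToFunctionField U (s * s') := by
    rw [eq_div_iff hss, map_mul, map_mul, ← hb]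
    ring
  have ev : v = X.germToFunctionField U (b' * s) / X.germToFunctionField U (s * s') := by
    rw [eq_div_iff hss, map_mul, map_mul, ← hb']
    ring
  refine IsRegularAt.of_section hy (s := (s * s') ^ 3)
    (b := s * s' * c₁ - b * s' * c₂ + b' * s * c₃) ?_ ?_
  · rw [Scheme.mem_basicOpen X _ y hy] at hs hs' ⊢
    rw [map_pow, map_mul]
    exact (hs.mul hs').pow 3
  · rw [eu, ev, hβ.div_div hss, map_pow, div_mul_cancel₀ _ (pow_ne_zero 3 hss), map_add, map_sub,
      map_mul _ (s * s'), map_mul _ (b * s'), map_mul _ (b' * s), h1, h2, h3]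

/-- Whether a biderivation is regular can be tested on any affine cover. -/
lemma IsAltBider.forall_section {β : X.functionField → X.functionField → X.functionField}
    (hβ : IsAltBider K β) {I J : Type*} {U : I → X.Opens} {W : J → X.Opens}
    (hU : ∀ i, IsAffineOpen (U i)) (hW : ∀ j, IsAffineOpen (W j)) [∀ i, Nonempty (U i)]
    [∀ j, Nonempty (W j)] (hcov : ∀ y : X, ∃ i, y ∈ U i)
    (H : ∀ i, ∀ u ∈ Set.range (X.germToFunctionField (U i)),
      ∀ v ∈ Set.range (X.germToFunctionField (U i)),
        β u v ∈ Set.range (X.germToFunctionField (U i))) (j : J) :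
    ∀ u ∈ Set.range (X.germToFunctionField (W j)),
      ∀ v ∈ Set.range (X.germToFunctionField (W j)),
        β u v ∈ Set.range (X.germToFunctionField (W j)) := by
  rintro _ ⟨u, rfl⟩ _ ⟨v, rfl⟩
  refine mem_range_of_isRegularAt (hW j) fun y hy => ?_
  obtain ⟨i, hi⟩ := hcov y
  exact hβ.isRegularAt (hU i) (H i) hi (isRegularAt_section hy u) (isRegularAt_section hy v)

end Regular

end SeveriBrauer

/-! ### The projective plane as `Proj`: charts, sections, function field. -/

namespace SeveriBrauer

open MvPolynomial

section Proj

variable (K : Type u) [Field K]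

/-- The grading of `K[X₀, X₁, X₂]` by degree. -/
noncomputable abbrev grading : ℕ → Submodule K (MvPolynomial (Fin 3) K) := homogeneousSubmodule (Fin 3) K

/-- The projective plane as a scheme. -/
noncomputable abbrev plane : Scheme.{u} := Proj (grading K)

/-- The structure morphism of the projective plane. -/
noncomputable abbrev planeHom : plane K ⟶ Spec (CommRingCat.of K) :=
  Proj.toSpecZero (grading K) ≫ Spec.map (CommRingCat.ofHom (algebraMap K (grading K 0)))

lemma X_mem_grading (j : Fin 3) : (X j : MvPolynomial (Fin 3) K) ∈ grading K 1 :=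
  isHomogeneous_X K j

/-- The standard chart `X_j ≠ 0`. -/
noncomputable abbrev planeChart (j : Fin 3) : (plane K).Opens := Proj.basicOpen (grading K) (X j)

lemma isAffineOpen_planeChart (j : Fin 3) : IsAffineOpen (planeChart K j) :=
  Proj.isAffineOpen_basicOpen _ _ (X_mem_grading K j) one_pos

lemma irrelevant_le_span_X : (HomogeneousIdeal.irrelevant (grading K)).toIdeal ≤
    Ideal.span (Set.range (X : Fin 3 → MvPolynomial (Fin 3) K)) := by
  intro f hf
  have h0 : coeff 0 f = 0 := by
    have h := (HomogeneousIdeal.mem_irrelevant_iff _ _).mp hf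
    rw [GradedRing.proj_apply] at h
    have h' : homogeneousComponent 0 f = 0 := by
      rw [← h]
      exact (decomposition.decompose'_apply f 0).symm
    rw [homogeneousComponent_zero] at h'
    exact (C_eq_zero).mp h'
  rw [← Set.image_univ, mem_ideal_span_X_image]
  intro m hm
  by_contra! H
  refine (mem_support_iff.mp hm) ?_
  rw [show m = 0 from Finsupp.ext fun i => H i (Set.mem_univ i), h0]

lemma exists_mem_planeChart (y : plane K) : ∃ j, y ∈ planeChart K j := by
  have h := Proj.iSup_basicOpen_eq_top (grading K) (X : Fin 3 → _) (irrelevant_le_span_X K)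
  exact TopologicalSpace.Opens.mem_iSup.mp (h ▸ TopologicalSpace.Opens.mem_top y)

/-- The zero ideal, as a point of the projective plane. -/
noncomputable def bottomPoint : plane K :=
  (⟨⊥, by
      change (⊥ : Ideal (MvPolynomial (Fin 3) K)).IsPrime
      exact Ideal.isPrime_bot,
    fun h => by
      have h1 : (X 0 : MvPolynomial (Fin 3) K) ∈ (⊥ : HomogeneousIdeal (grading K)) :=
        h (HomogeneousIdeal.mem_irrelevant_of_mem _ one_pos (X_mem_grading K 0))
      exact X_ne_zero (R := K) (0 : Fin 3) h1⟩ : ProjectiveSpectrum (grading K))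

lemma bottomPoint_specializes (y : plane K) : bottomPoint K ⤳ y := by
  rw [specializes_iff_mem_closure]
  exact (ProjectiveSpectrum.le_iff_mem_closure (𝒜 := grading K) (bottomPoint K) y).mp
    (show (⊥ : HomogeneousIdeal (grading K)) ≤ _ from bot_le)

lemma isGenericPoint_bottomPoint : IsGenericPoint (bottomPoint K) Set.univ := by
  rw [isGenericPoint_iff_specializes]
  exact fun y => ⟨fun _ => Set.mem_univ y, fun _ => bottomPoint_specializes K y⟩

/-- The zero ideal is a generic point, and the stalks embed into localizations of the polynomial
ring, which are domains. -/
instance : IsIntegral (plane K) := by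
  have h1 : IrreducibleSpace (plane K) := by
    have : PreirreducibleSpace (plane K) :=
      ⟨(isGenericPoint_bottomPoint K).isIrreducible.isPreirreducible⟩
    exact { toNonempty := ⟨bottomPoint K⟩ }
  have h2 : ∀ y : plane K, _root_.IsReduced ((plane K).presheaf.stalk y) := fun y => by
    have : y.asHomogeneousIdeal.toIdeal.IsPrime := ProjectiveSpectrum.isPrime (𝒜 := grading K) y
    have : _root_.IsReduced (HomogeneousLocalization.AtPrime (grading K)
        y.asHomogeneousIdeal.toIdeal) := by
      have : IsDomain (Localization y.asHomogeneousIdeal.toIdeal.primeCompl) :=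
        IsLocalization.isDomain_localization (Ideal.primeCompl_le_nonZeroDivisors _)
      exact isReduced_of_injective (algebraMap _ (Localization
        y.asHomogeneousIdeal.toIdeal.primeCompl)) (HomogeneousLocalization.val_injective _)
    exact isReduced_of_injective (Proj.stalkIso (grading K) y).hom.hom
      (Proj.stalkIso (grading K) y).commRingCatIsoToRingEquiv.injective
  have h3 := isReduced_of_isReduced_stalk (plane K)
  exact isIntegral_of_irreducibleSpace_of_isReduced _

instance (j : Fin 3) : Nonempty (planeChart K j) :=
  ⟨⟨bottomPoint K, fun h => X_ne_zero (R := K) j h⟩⟩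

variable {K} in
/-- The section `f / l ^ d` over the open set `l ≠ 0`, for a linear form `l`. -/
noncomputable def linearSection {l : MvPolynomial (Fin 3) K} (hl : l.IsHomogeneous 1) {d : ℕ}
    {f : MvPolynomial (Fin 3) K} (hf : f.IsHomogeneous d) :
    Γ(plane K, Proj.basicOpen (grading K) l) :=
  Proj.awayToSection (grading K) l
    (HomogeneousLocalization.Away.mk (grading K) hl d f (by simpa using hf))

/-- The section `f / X_j ^ d` over the chart `X_j ≠ 0`. -/
noncomputable abbrev formSection (j : Fin 3) {d : ℕ} {f : MvPolynomial (Fin 3) K}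
    (hf : f.IsHomogeneous d) : Γ(plane K, planeChart K j) :=
  linearSection (isHomogeneous_X K j) hf

lemma exists_linearSection {l : MvPolynomial (Fin 3) K} (hl : l.IsHomogeneous 1)
    (s : Γ(plane K, Proj.basicOpen (grading K) l)) :
    ∃ d, ∃ f : MvPolynomial (Fin 3) K, ∃ hf : f.IsHomogeneous d, s = linearSection hl hf := by
  obtain ⟨z, rfl⟩ := (Proj.basicOpenIsoAway (grading K) _ hl
    one_pos).commRingCatIsoToRingEquiv.surjective s
  obtain ⟨n, a, ha, rfl⟩ := HomogeneousLocalization.Away.mk_surjective _ hl z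
  exact ⟨n, a, by simpa using ha, rfl⟩

instance (y : plane K) : y.asHomogeneousIdeal.toIdeal.IsPrime :=
  ProjectiveSpectrum.isPrime (𝒜 := grading K) y

lemma val_stalkIso_linearSection {l : MvPolynomial (Fin 3) K} (hl : l.IsHomogeneous 1) {d : ℕ}
    {f : MvPolynomial (Fin 3) K} (hf : f.IsHomogeneous d) {y : plane K}
    (hy : y ∈ Proj.basicOpen (grading K) l) :
    ((Proj.stalkIso (grading K) y).hom
      ((plane K).presheaf.germ (Proj.basicOpen (grading K) l) y hy (linearSection hl hf))).val =
      Localization.mk f ⟨l ^ d, y.asHomogeneousIdeal.toIdeal.primeCompl.pow_mem hy d⟩ := by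
  have h := ConcreteCategory.congr_hom
    (ProjectiveSpectrum.Proj.awayToSection_germ (grading K) l y hy)
    (HomogeneousLocalization.Away.mk (grading K) hl d f (by simpa using hf))
  have h2 : (Proj.stalkIso (grading K) y).hom
      ((plane K).presheaf.germ (Proj.basicOpen (grading K) l) y hy (linearSection hl hf)) = _ :=
    (congrArg (Proj.stalkIso (grading K) y).hom h).trans
      ((Proj.stalkIso (grading K) y).commRingCatIsoToRingEquiv.apply_symm_apply _)
  rw [h2]
  rfl

lemma mem_basicOpen_formSection {j : Fin 3} {d : ℕ} {f : MvPolynomial (Fin 3) K}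
    (hf : f.IsHomogeneous d) {y : plane K} (hy : y ∈ planeChart K j) :
    y ∈ (plane K).basicOpen (formSection K j hf) ↔ f ∉ y.asHomogeneousIdeal := by
  rw [Scheme.mem_basicOpen _ _ y hy]
  have h1 := MulEquiv.isUnit_map (Proj.stalkIso (grading K) y).commRingCatIsoToRingEquiv
    (x := (plane K).presheaf.germ (planeChart K j) y hy (formSection K j hf))
  rw [← h1]
  change IsUnit ((Proj.stalkIso (grading K) y).hom _) ↔ _
  rw [← HomogeneousLocalization.isUnit_iff_isUnit_val, val_stalkIso_linearSection,
    Localization.mk_eq_mk', IsLocalization.AtPrime.isUnit_mk'_iff]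
  rfl

lemma nonempty_basicOpen {l : MvPolynomial (Fin 3) K} (hl : l ≠ 0) :
    Nonempty (Proj.basicOpen (grading K) l) :=
  ⟨⟨bottomPoint K, fun h => hl h⟩⟩

/-- The function `Θ` expresses rational functions on the projective plane as fractions of forms. -/
def IsFractionHom (Θ : (plane K).functionField →+* FractionRing (MvPolynomial (Fin 3) K)) : Prop :=
  ∀ {l : MvPolynomial (Fin 3) K} (hl : l.IsHomogeneous 1) {d : ℕ} {f : MvPolynomial (Fin 3) K}
    (hf : f.IsHomogeneous d) [Nonempty (Proj.basicOpen (grading K) l)],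
    Θ ((plane K).germToFunctionField _ (linearSection hl hf)) =
      algebraMap (MvPolynomial (Fin 3) K) (FractionRing (MvPolynomial (Fin 3) K)) f /
        algebraMap (MvPolynomial (Fin 3) K) (FractionRing (MvPolynomial (Fin 3) K)) l ^ d

/-- The stalk at the generic point is a homogeneous localization of the polynomial ring, hence maps
to its fraction field. Identities between rational functions can then be checked among fractions of
polynomials. -/
lemma exists_isFractionHom :
    ∃ Θ : (plane K).functionField →+* FractionRing (MvPolynomial (Fin 3) K),
      IsFractionHom K Θ := by
  have hη : ∀ f ∈ (genericPoint (plane K)).asHomogeneousIdeal.toIdeal.primeCompl, f ≠ 0 := by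
    rintro f hf rfl
    exact hf (Ideal.zero_mem _)
  have hu : ∀ f : (genericPoint (plane K)).asHomogeneousIdeal.toIdeal.primeCompl, IsUnit
      (algebraMap (MvPolynomial (Fin 3) K) (FractionRing (MvPolynomial (Fin 3) K)) f) := fun f =>
    isUnit_iff_ne_zero.mpr fun h => hη f f.2
      (IsFractionRing.injective (MvPolynomial (Fin 3) K) (FractionRing (MvPolynomial (Fin 3) K))
        (h.trans (map_zero _).symm))
  refine ⟨(IsLocalization.lift (S := Localization
    (genericPoint (plane K)).asHomogeneousIdeal.toIdeal.primeCompl) hu).comp ((algebraMap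
    (HomogeneousLocalization.AtPrime (grading K)
      (genericPoint (plane K)).asHomogeneousIdeal.toIdeal) (Localization _)).comp
    (Proj.stalkIso (grading K) (genericPoint (plane K))).hom.hom), fun {l} hl d f hf hne => ?_⟩
  have hmem : genericPoint (plane K) ∈ Proj.basicOpen (grading K) l :=
    ((genericPoint_spec (plane K)).mem_open_set_iff (Proj.basicOpen (grading K) l).isOpen).mpr
      (by simpa using hne)
  refine (congrArg (IsLocalization.lift hu) (val_stalkIso_linearSection K hl hf hmem)).trans ?_
  rw [Localization.mk_eq_mk', IsLocalization.lift_mk'_spec, ← map_pow]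
  exact (mul_div_cancel₀ _ (hu ⟨_, Submonoid.pow_mem _ hmem d⟩).ne_zero).symm

lemma sectionHom_planeChart (j : Fin 3) (c : K) :
    sectionHom (planeHom K) (planeChart K j) c = formSection K j (isHomogeneous_C _ c) := by
  have h : sectionHom (planeHom K) (planeChart K j) =
      CommRingCat.ofHom (algebraMap K (grading K 0)) ≫
        CommRingCat.ofHom (HomogeneousLocalization.fromZeroRingHom (grading K) _) ≫
        Proj.awayToSection (grading K) (X j) := by
    apply sectionHom_eq
    have h1 : (planeChart K j).ι = (planeChart K j).toSpecΓ ≫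
        Spec.map (Proj.awayToSection (grading K) (X j)) ≫
          Proj.awayι (grading K) _ (X_mem_grading K j) one_pos := by
      rw [Proj.awayι]
      exact (Iso.hom_inv_id_assoc (Proj.basicOpenIsoSpec (grading K) _ (X_mem_grading K j)
        one_pos) _).symm
    rw [h1]
    simp only [Category.assoc, Spec.map_comp, Proj.awayι_toSpecZero_assoc]
  rw [h]
  change Proj.awayToSection (grading K) (X j) _ = Proj.awayToSection (grading K) (X j) _
  congr 1

end Proj

section Coordinates

variable {R : Type u} [CommRing R] {X : Scheme.{u}} [IsIntegral X]

/-- The structure of an `R`-algebra on the function field of an integral `R`-scheme. -/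
noncomputable def functionFieldHom (g : X ⟶ Spec (CommRingCat.of R)) :
    CommRingCat.of R ⟶ X.functionField :=
  have : Nonempty (⊤ : X.Opens) := ⟨⟨genericPoint X, trivial⟩⟩
  sectionHom g ⊤ ≫ X.germToFunctionField ⊤

lemma sectionHom_germToFunctionField (g : X ⟶ Spec (CommRingCat.of R)) (U : X.Opens) [Nonempty U] :
    sectionHom g U ≫ X.germToFunctionField U = functionFieldHom g := by
  rw [functionFieldHom, ← sectionHom_map g (le_top (a := U)), Category.assoc]
  simp

end Coordinates

section PlaneCoordinates

variable (K : Type u) [Field K]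

/-- The function field of the projective plane over `K` is an extension of `K`. -/
@[reducible] noncomputable def planeFunctionFieldAlgebra : Algebra K (plane K).functionField :=
  (functionFieldHom (planeHom K)).hom.toAlgebra

attribute [local instance] planeFunctionFieldAlgebra

/-- The affine coordinates `X_i / X_0` on the projective plane. -/
noncomputable def planeCoord (i : Fin 3) : (plane K).functionField :=
  (plane K).germToFunctionField (planeChart K 0) (formSection K 0 (isHomogeneous_X K i))

lemma exists_algHom_isFractionHom :
    ∃ Θ : (plane K).functionField →ₐ[K] FractionRing (MvPolynomial (Fin 3) K),
      IsFractionHom K (Θ : (plane K).functionField →+* _) := by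
  obtain ⟨Θ, hΘ⟩ := exists_isFractionHom K
  refine ⟨{ Θ with commutes' := fun c => ?_ }, hΘ⟩
  change Θ ((functionFieldHom (planeHom K)).hom c) = _
  rw [← sectionHom_germToFunctionField _ (planeChart K 0)]
  refine (congrArg (fun s => Θ ((plane K).germToFunctionField (planeChart K 0) s))
    (sectionHom_planeChart K 0 c)).trans ?_
  rw [hΘ, pow_zero, div_one, IsScalarTower.algebraMap_apply K (MvPolynomial (Fin 3) K)]
  rfl

variable {K}

lemma IsFractionHom.planeCoord
    {Θ : (plane K).functionField →ₐ[K] FractionRing (MvPolynomial (Fin 3) K)}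
    (hΘ : IsFractionHom K (Θ : (plane K).functionField →+* _)) (i : Fin 3) :
    Θ (planeCoord K i) =
      algebraMap (MvPolynomial (Fin 3) K) (FractionRing (MvPolynomial (Fin 3) K)) (X i) /
        algebraMap (MvPolynomial (Fin 3) K) (FractionRing (MvPolynomial (Fin 3) K)) (X 0) := by
  have h := hΘ (isHomogeneous_X K 0) (isHomogeneous_X K i)
  rwa [pow_one] at h

lemma IsFractionHom.aeval {Θ : (plane K).functionField →ₐ[K] FractionRing (MvPolynomial (Fin 3) K)}
    (hΘ : IsFractionHom K (Θ : (plane K).functionField →+* _)) {d : ℕ}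
    {f : MvPolynomial (Fin 3) K} (hf : f.IsHomogeneous d) :
    Θ (aeval (SeveriBrauer.planeCoord K) f) =
      algebraMap (MvPolynomial (Fin 3) K) (FractionRing (MvPolynomial (Fin 3) K)) f /
        algebraMap (MvPolynomial (Fin 3) K) (FractionRing (MvPolynomial (Fin 3) K)) (X 0) ^ d := by
  rw [comp_aeval_apply]
  simp_rw [hΘ.planeCoord]
  rw [aeval_div hf]
  congr 1
  exact (aeval_algebraMap_apply _ X f).trans (by rw [aeval_X_left_apply])

lemma germ_linearSection {l : MvPolynomial (Fin 3) K} (hl : l.IsHomogeneous 1) {d : ℕ}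
    {f : MvPolynomial (Fin 3) K} (hf : f.IsHomogeneous d)
    [hne : Nonempty (Proj.basicOpen (grading K) l)] :
    (plane K).germToFunctionField _ (linearSection hl hf) =
      aeval (planeCoord K) f / aeval (planeCoord K) l ^ d := by
  obtain ⟨Θ, hΘ⟩ := exists_algHom_isFractionHom K
  have hl0 : l ≠ 0 := by
    rintro rfl
    obtain ⟨⟨y, hy⟩⟩ := hne
    rw [Proj.basicOpen_zero] at hy
    exact hy
  apply Θ.toRingHom.injective
  have hX : ∀ {g : MvPolynomial (Fin 3) K}, g ≠ 0 →
      algebraMap (MvPolynomial (Fin 3) K) (FractionRing (MvPolynomial (Fin 3) K)) g ≠ 0 :=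
    fun hg h => hg (IsFractionRing.injective (MvPolynomial (Fin 3) K)
      (FractionRing (MvPolynomial (Fin 3) K)) (h.trans (map_zero _).symm))
  refine (hΘ hl hf).trans ?_
  change _ = Θ _
  rw [map_div₀, map_pow, hΘ.aeval hf, hΘ.aeval hl, pow_one, div_pow]
  have := hX (X_ne_zero (R := K) (0 : Fin 3))
  have := hX hl0
  field_simp

variable (K)

lemma germ_formSection (j : Fin 3) {d : ℕ} {f : MvPolynomial (Fin 3) K} (hf : f.IsHomogeneous d) :
    (plane K).germToFunctionField (planeChart K j) (formSection K j hf) =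
      aeval (planeCoord K) f / planeCoord K j ^ d := by
  rw [germ_linearSection, aeval_X]

lemma isProjCoord_planeCoord : IsProjCoord K (planeCoord K) := by
  obtain ⟨Θ, hΘ⟩ := exists_algHom_isFractionHom K
  have hX : ∀ i, algebraMap (MvPolynomial (Fin 3) K) (FractionRing (MvPolynomial (Fin 3) K)) (X i)
      ≠ 0 := fun i => by simp
  have h0 : planeCoord K 0 = 1 := by
    apply Θ.toRingHom.injective
    change Θ _ = Θ _
    rw [hΘ.planeCoord, div_self (hX 0), map_one]
  refine ⟨h0, fun d f hf h => ?_, fun h => ?_⟩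
  · have h1 := hΘ.aeval hf
    rw [h, map_zero, eq_comm, div_eq_zero_iff, or_iff_left (pow_ne_zero _ (hX 0))] at h1
    exact IsFractionRing.injective _ (FractionRing (MvPolynomial (Fin 3) K))
      (h1.trans (map_zero _).symm)
  · have := functionField_isFractionRing_of_isAffineOpen (plane K) (planeChart K 0)
      (isAffineOpen_planeChart K 0)
    obtain ⟨b, s, hs, rfl⟩ := IsFractionRing.div_surjective (A := Γ(plane K, planeChart K 0)) h
    obtain ⟨d, f, hf, rfl⟩ := exists_linearSection K (isHomogeneous_X K 0) b
    obtain ⟨e, g, hg, rfl⟩ := exists_linearSection K (isHomogeneous_X K 0) s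
    have e1 : ∀ {d : ℕ} {f : MvPolynomial (Fin 3) K} (hf : f.IsHomogeneous d),
        algebraMap Γ(plane K, planeChart K 0) (plane K).functionField (formSection K 0 hf) =
          aeval (planeCoord K) f := fun hf => by
      refine (germ_formSection K 0 hf).trans ?_
      rw [h0, one_pow, div_one]
    have hg0 : algebraMap Γ(plane K, planeChart K 0) (plane K).functionField (formSection K 0 hg)
        ≠ 0 := by
      simpa using nonZeroDivisors.ne_zero hs
    rw [e1] at hg0
    have hX0 : ∀ n, (X 0 ^ n : MvPolynomial (Fin 3) K).IsHomogeneous n := fun n => by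
      simpa using (isHomogeneous_X K (0 : Fin 3)).pow n
    refine ⟨d + e, f * X 0 ^ e, g * X 0 ^ d, hf.mul (hX0 e), ?_, ?_, ?_⟩
    · rw [add_comm]
      exact hg.mul (hX0 d)
    · simpa [h0] using hg0
    · simp [h0, e1]

lemma range_germ_planeChart (j : Fin 3) :
    Set.range ((plane K).germToFunctionField (planeChart K j)) =
      (chart K (planeCoord K) j : Set (plane K).functionField) := by
  ext h
  rw [SetLike.mem_coe, mem_chart_iff j ((isProjCoord_planeCoord K).ne_zero j)]
  constructor
  · rintro ⟨s, rfl⟩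
    obtain ⟨d, f, hf, rfl⟩ := exists_linearSection K (isHomogeneous_X K j) s
    exact ⟨d, f, hf, germ_formSection K j hf⟩
  · rintro ⟨d, f, hf, rfl⟩
    exact ⟨_, germ_formSection K j hf⟩

end PlaneCoordinates

end SeveriBrauer

/-! ### Base change of integral schemes along an extension of fields. -/

namespace SeveriBrauer

lemma nonempty_preimage {X Y : Scheme.{u}} (m : X ⟶ Y) [Surjective m] (W : Y.Opens)
    [h : Nonempty W] : Nonempty (m ⁻¹ᵁ W) := by
  obtain ⟨⟨y, hy⟩⟩ := h
  obtain ⟨x, rfl⟩ := m.surjective y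
  exact ⟨⟨x, hy⟩⟩

section FunctionFieldMap

variable {X Y : Scheme.{u}} [IsIntegral X] [IsIntegral Y] {m : X ⟶ Y}

/-- The extension of function fields given by a dominant morphism. -/
noncomputable def functionFieldMap (m : X ⟶ Y) (h : m (genericPoint X) = genericPoint Y) :
    Y.functionField ⟶ X.functionField :=
  Y.presheaf.stalkSpecializes (specializes_of_eq h) ≫ m.stalkMap (genericPoint X)

lemma map_genericPoint (m : X ⟶ Y) [Surjective m] : m (genericPoint X) = genericPoint Y := by
  refine (genericPoint_spec Y).eq ?_ |>.symm
  have h := (genericPoint_spec X).image m.continuous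
  rwa [Set.image_univ, m.surjective.range_eq, closure_univ] at h

lemma germToFunctionField_functionFieldMap (h : m (genericPoint X) = genericPoint Y) (W : Y.Opens)
    [Nonempty W] [Nonempty (m ⁻¹ᵁ W)] :
    Y.germToFunctionField W ≫ functionFieldMap m h = m.app W ≫ X.germToFunctionField (m ⁻¹ᵁ W) := by
  rw [functionFieldMap, Scheme.germToFunctionField, ← Category.assoc,
    TopCat.Presheaf.germ_stalkSpecializes, Scheme.Hom.germ_stalkMap]

variable {R S : Type u} [CommRing R] [CommRing S] {g : X ⟶ Spec (CommRingCat.of R)}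
  {v : Y ⟶ Spec (CommRingCat.of S)} {ρ : CommRingCat.of S ⟶ CommRingCat.of R}

lemma functionFieldHom_functionFieldMap (hmg : m ≫ v = g ≫ Spec.map ρ)
    (h : m (genericPoint X) = genericPoint Y) :
    functionFieldHom v ≫ functionFieldMap m h = ρ ≫ functionFieldHom g := by
  have h1 : Nonempty (⊤ : Y.Opens) := ⟨⟨genericPoint Y, trivial⟩⟩
  have h2 : Nonempty (m ⁻¹ᵁ (⊤ : Y.Opens)) := ⟨⟨genericPoint X, trivial⟩⟩
  rw [← sectionHom_germToFunctionField v ⊤, Category.assoc, germToFunctionField_functionFieldMap,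
    ← Category.assoc, sectionHom_comp_app g hmg, Category.assoc, sectionHom_germToFunctionField]

end FunctionFieldMap

/-- A scheme with an integral, flat and surjective cover is integral. -/
lemma isIntegral_of_flat_surjective {X Y : Scheme.{u}} (m : X ⟶ Y) [IsIntegral X] [Flat m]
    [Surjective m] : IsIntegral Y := by
  have h1 : IrreducibleSpace Y :=
    Function.Surjective.irreducibleSpace m.continuous m.surjective
  have h2 : ∀ y : Y, _root_.IsReduced (Y.presheaf.stalk y) := fun y => by
    obtain ⟨x, rfl⟩ := m.surjective y
    have hf := Flat.stalkMap m x
    algebraize [(m.stalkMap x).hom]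
    have : IsLocalHom (algebraMap (Y.presheaf.stalk (m x)) (X.presheaf.stalk x)) :=
      inferInstanceAs (IsLocalHom (m.stalkMap x).hom)
    -- A flat local homomorphism is faithfully flat, hence injective, so reducedness passes from the
    -- stalks of `X` to those of `Y`.
    have : Module.FaithfullyFlat (Y.presheaf.stalk (m x)) (X.presheaf.stalk x) :=
      Module.FaithfullyFlat.of_flat_of_isLocalHom
    exact isReduced_of_injective (algebraMap (Y.presheaf.stalk (m x)) (X.presheaf.stalk x))
      (FaithfulSMul.algebraMap_injective _ _)
  have h3 := isReduced_of_isReduced_stalk Y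
  exact isIntegral_of_irreducibleSpace_of_isReduced _

section BaseChange

variable {k K : Type u} [Field k] [Field K] [Algebra k K] {X Y : Scheme.{u}}
  {g : X ⟶ Spec (CommRingCat.of K)} {v : Y ⟶ Spec (CommRingCat.of k)} {m : X ⟶ Y}

lemma flat_specMap_algebraMap (k K : Type u) [Field k] [Field K] [Algebra k K] :
    Flat (Spec.map (CommRingCat.ofHom (algebraMap k K))) := by
  rw [Flat.SpecMap_iff]
  change (algebraMap k K).Flat
  rw [RingHom.flat_algebraMap_iff]
  infer_instance

lemma surjective_specMap_algebraMap (k K : Type u) [Field k] [Field K] [Algebra k K] :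
    Surjective (Spec.map (CommRingCat.ofHom (algebraMap k K))) := by
  refine ⟨fun p => ?_⟩
  have h1 : Subsingleton (PrimeSpectrum k) := inferInstance
  have h2 : Nonempty (PrimeSpectrum K) := inferInstance
  exact ⟨h2.some, h1.elim _ _⟩

variable (hm : IsPullback m g v (Spec.map (CommRingCat.ofHom (algebraMap k K))))
include hm

lemma isAffineHom_of_isPullback : IsAffineHom m :=
  MorphismProperty.of_isPullback hm.flip inferInstance

lemma flat_of_isPullback : Flat m :=
  MorphismProperty.of_isPullback hm.flip (flat_specMap_algebraMap k K)

lemma surjective_of_isPullback : Surjective m :=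
  MorphismProperty.of_isPullback hm.flip (surjective_specMap_algebraMap k K)

lemma isPushout_algebra_sections {W : Y.Opens} (hW : IsAffineOpen W) [Algebra k Γ(Y, W)]
    [Algebra K Γ(X, m ⁻¹ᵁ W)] [Algebra Γ(Y, W) Γ(X, m ⁻¹ᵁ W)] [Algebra k Γ(X, m ⁻¹ᵁ W)]
    [IsScalarTower k Γ(Y, W) Γ(X, m ⁻¹ᵁ W)] [IsScalarTower k K Γ(X, m ⁻¹ᵁ W)]
    (h1 : algebraMap k Γ(Y, W) = (sectionHom v W).hom)
    (h2 : algebraMap K Γ(X, m ⁻¹ᵁ W) = (sectionHom g (m ⁻¹ᵁ W)).hom)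
    (h3 : algebraMap Γ(Y, W) Γ(X, m ⁻¹ᵁ W) = (m.app W).hom) :
    Algebra.IsPushout k Γ(Y, W) K Γ(X, m ⁻¹ᵁ W) := by
  have := isAffineHom_of_isPullback hm
  refine CommRingCat.isPushout_iff_isPushout.mp ?_
  rw [h1, h2, h3]
  exact isPushout_sections g hm hW

variable [IsIntegral X] [IsIntegral Y] (hη : m (genericPoint X) = genericPoint Y)

/-- The sections over the preimage of `W` are `K ⊗ Γ(Y, W)`. This is how regularity on such
preimages becomes a condition on `K`-spans of subrings of the function field of `Y`. -/
lemma span_range_germToFunctionField {W : Y.Opens} (hW : IsAffineOpen W) [Nonempty W]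
    [Nonempty (m ⁻¹ᵁ W)] :
    letI : Algebra K X.functionField := (functionFieldHom g).hom.toAlgebra
    (Submodule.span K (functionFieldMap m hη '' Set.range (Y.germToFunctionField W)) :
      Set X.functionField) = Set.range (X.germToFunctionField (m ⁻¹ᵁ W)) := by
  let : Algebra k Γ(Y, W) := (sectionHom v W).hom.toAlgebra
  let : Algebra K Γ(X, m ⁻¹ᵁ W) := (sectionHom g (m ⁻¹ᵁ W)).hom.toAlgebra
  let : Algebra Γ(Y, W) Γ(X, m ⁻¹ᵁ W) := (m.app W).hom.toAlgebra
  let : Algebra k Γ(X, m ⁻¹ᵁ W) := ((sectionHom v W) ≫ m.app W).hom.toAlgebra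
  have : IsScalarTower k Γ(Y, W) Γ(X, m ⁻¹ᵁ W) := .of_algebraMap_eq' rfl
  have : IsScalarTower k K Γ(X, m ⁻¹ᵁ W) :=
    .of_algebraMap_eq' (congrArg CommRingCat.Hom.hom (sectionHom_comp_app g hm.w W))
  let : Algebra K X.functionField := (functionFieldHom g).hom.toAlgebra
  let : Algebra Y.functionField X.functionField := (functionFieldMap m hη).hom.toAlgebra
  let : Algebra Γ(Y, W) X.functionField :=
    ((functionFieldMap m hη).hom.comp (Y.germToFunctionField W).hom).toAlgebra
  have : IsScalarTower Γ(Y, W) Y.functionField X.functionField := .of_algebraMap_eq' rfl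
  have : IsScalarTower Γ(Y, W) Γ(X, m ⁻¹ᵁ W) X.functionField :=
    .of_algebraMap_eq' (congrArg CommRingCat.Hom.hom (germToFunctionField_functionFieldMap hη W))
  have : IsScalarTower K Γ(X, m ⁻¹ᵁ W) X.functionField :=
    .of_algebraMap_eq' (congrArg CommRingCat.Hom.hom (sectionHom_germToFunctionField g _)).symm
  have := isPushout_algebra_sections hm hW rfl rfl rfl
  exact (range_algebraMap_eq_span (k := k) (K := K) (A := Γ(Y, W)) (B := Γ(X, m ⁻¹ᵁ W))
    (F := Y.functionField) (L := X.functionField)).symm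

end BaseChange

section Plane

attribute [local instance] planeFunctionFieldAlgebra

variable {k K : Type u} [Field k] [Field K] [Algebra k K] {Y : Scheme.{u}} [IsIntegral Y]
  {v : Y ⟶ Spec (CommRingCat.of k)} {m : plane K ⟶ Y}

/-- A biderivation is regular on the projective plane if and only if it is regular on the preimages
of the affine opens of `Y`. -/
lemma IsAltBider.forall_chart_iff
    (hm : IsPullback m (planeHom K) v (Spec.map (CommRingCat.ofHom (algebraMap k K))))
    (hη : m (genericPoint (plane K)) = genericPoint Y)
    {β : (plane K).functionField → (plane K).functionField → (plane K).functionField}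
    (hβ : IsAltBider K β) (T : {W : Y.Opens // IsAffineOpen W ∧ Nonempty W} → Set Y.functionField)
    (hT : ∀ W, T W = have := W.2.2; Set.range (Y.germToFunctionField W.1)) :
    (∀ j, ∀ u ∈ chart K (planeCoord K) j, ∀ v ∈ chart K (planeCoord K) j,
        β u v ∈ chart K (planeCoord K) j) ↔
      ∀ W, ∀ u ∈ Submodule.span K (functionFieldMap m hη '' T W),
        ∀ v ∈ Submodule.span K (functionFieldMap m hη '' T W),
          β u v ∈ Submodule.span K (functionFieldMap m hη '' T W) := by
  have := isAffineHom_of_isPullback hm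
  have := surjective_of_isPullback hm
  have h1 : ∀ W : {W : Y.Opens // IsAffineOpen W ∧ Nonempty W}, Nonempty W.1 := fun W => W.2.2
  have h2 : ∀ W : {W : Y.Opens // IsAffineOpen W ∧ Nonempty W}, Nonempty (m ⁻¹ᵁ W.1) :=
    fun W => nonempty_preimage m W.1
  have h3 : ∀ W : {W : Y.Opens // IsAffineOpen W ∧ Nonempty W}, IsAffineOpen (m ⁻¹ᵁ W.1) :=
    fun W => W.2.1.preimage m
  have h4 : ∀ y : plane K, ∃ W : {W : Y.Opens // IsAffineOpen W ∧ Nonempty W}, y ∈ m ⁻¹ᵁ W.1 := by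
    intro y
    obtain ⟨W, hW, hy, -⟩ := exists_isAffineOpen_mem_and_subset (x := m y) (U := ⊤) trivial
    exact ⟨⟨W, hW, ⟨⟨m y, hy⟩⟩⟩, hy⟩
  have hW : ∀ W : {W : Y.Opens // IsAffineOpen W ∧ Nonempty W}, ∀ u,
      u ∈ Submodule.span K (functionFieldMap m hη '' T W) ↔
        u ∈ Set.range ((plane K).germToFunctionField (m ⁻¹ᵁ W.1)) := fun W u => by
    rw [hT, ← span_range_germToFunctionField hm hη W.2.1]
    rfl
  have hU : ∀ j u, u ∈ chart K (planeCoord K) j ↔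
      u ∈ Set.range ((plane K).germToFunctionField (planeChart K j)) := fun j u => by
    rw [range_germ_planeChart]
    rfl
  simp only [hW, hU]
  exact ⟨fun H => hβ.forall_section (isAffineOpen_planeChart K) h3 (exists_mem_planeChart K) H,
    fun H => hβ.forall_section h3 (isAffineOpen_planeChart K) h4 H⟩

end Plane

end SeveriBrauer

/-! ### The residue field and the geometric points over a closed point. -/

namespace SeveriBrauer

section ResidueField

variable {k K κ : Type u} [Field k] [Field K] [Field κ] [Algebra k K] [Algebra k κ]

/-- An extension of degree `6` is separable in characteristic different from `2` and `3`. -/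
lemma isSeparable_of_finrank_eq_six (h2 : (2 : k) ≠ 0) (h3 : (3 : k) ≠ 0)
    (h6 : Module.finrank k κ = 6) : Algebra.IsSeparable k κ := by
  have : FiniteDimensional k κ := FiniteDimensional.of_finrank_pos (by omega)
  rw [← Field.finSepDegree_eq_finrank_iff]
  have h := Field.finSepDegree_mul_finInsepDegree k κ
  obtain ⟨q, hq⟩ := ExpChar.exists k
  obtain ⟨n, hn⟩ := finInsepDegree_eq_pow k κ q
  suffices q ^ n = 1 by rw [← h, hn, this, mul_one]
  rcases hq with _ | hp
  · exact one_pow n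
  · rcases Nat.eq_zero_or_pos n with rfl | hn0
    · exact pow_zero q
    · exfalso
      -- The inseparable degree is a power of the characteristic and divides 6.
      have hd : q ∣ 2 * 3 := by
        refine (dvd_pow_self q hn0.ne').trans ?_
        rw [← hn]
        exact Dvd.intro_left _ (h.trans h6)
      have hc := CharP.cast_eq_zero k q
      rcases (Nat.Prime.dvd_mul hp).mp hd with hd | hd
      · rw [(Nat.prime_dvd_prime_iff_eq hp Nat.prime_two).mp hd] at hc
        exact h2 (by exact_mod_cast hc)
      · rw [(Nat.prime_dvd_prime_iff_eq hp Nat.prime_three).mp hd] at hc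
        exact h3 (by exact_mod_cast hc)

/-- The Galois action on the embeddings of an extension. -/
@[reducible] def embeddingAction : MulAction (K ≃ₐ[k] K) (κ →ₐ[k] K) where
  smul σ ε := (σ : K →ₐ[k] K).comp ε
  one_smul _ := rfl
  mul_smul _ _ _ := rfl

lemma isPretransitive_embeddingAction [IsAlgClosure k K] [Algebra.IsAlgebraic k κ] :
    letI := embeddingAction (k := k) (K := K) (κ := κ)
    MulAction.IsPretransitive (K ≃ₐ[k] K) (κ →ₐ[k] K) := by
  let := embeddingAction (k := k) (K := K) (κ := κ)
  refine ⟨fun ε ε' => ?_⟩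
  have hc : IsAlgClosed K := IsAlgClosure.isAlgClosed k
  have ha : Algebra.IsAlgebraic k K := IsAlgClosure.isAlgebraic
  -- View `K` as an algebraic extension of the residue field through `ε` and extend `ε'` along it.
  -- An endomorphism of an algebraic extension is bijective.
  have key : ∃ f : K →ₐ[k] K, f.comp ε = ε' := by
    let i₁ : Algebra κ K := ε.toRingHom.toAlgebra
    have h1 : IsScalarTower k κ K := .of_algebraMap_eq' ε.comp_algebraMap.symm
    have h2 : Algebra.IsAlgebraic κ K := Algebra.IsAlgebraic.tower_top (K := k) κ
    obtain ⟨f, hf⟩ := IsAlgClosed.surjective_domRestrict_of_isAlgebraic (E := K) ε'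
    exact ⟨f, hf⟩
  obtain ⟨f, hf⟩ := key
  refine ⟨AlgEquiv.ofBijective f (Algebra.IsAlgebraic.algHom_bijective f), ?_⟩
  exact hf

end ResidueField

section Points

variable {k K A B κ : Type u} [Field k] [Field K] [CommRing A] [CommRing B] [Field κ]
  [Algebra k K] [Algebra k A] [Algebra k B] [Algebra A B] [Algebra K B] [Algebra k κ]
  [IsScalarTower k A B] [IsScalarTower k K B]

lemma algHom_ext_of_isPushout (H : Algebra.IsPushout k A K B) {e e' : B →ₐ[K] K}
    (h : ∀ a : A, e (algebraMap A B a) = e' (algebraMap A B a)) : e = e' := by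
  ext b
  refine H.symm.out.inductionOn b (fun b => e b = e' b) ?_ h ?_ ?_
  · rw [map_zero, map_zero]
  · intro c b hb
    rw [map_smul, map_smul, hb]
  · intro b c hb hc
    rw [map_add, map_add, hb, hc]

lemma algHom_eq_of_ker_le {e e' : B →ₐ[K] K} (h : RingHom.ker e ≤ RingHom.ker e') : e = e' := by
  ext b
  have h1 : b - algebraMap K B (e b) ∈ RingHom.ker e := by
    rw [RingHom.mem_ker, map_sub, AlgHom.commutes]
    exact sub_self _
  have h2 := h h1
  rw [RingHom.mem_ker, map_sub, AlgHom.commutes, sub_eq_zero] at h2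
  exact h2.symm

variable [Algebra.IsPushout k A K B]

lemma extendPoint_comp_injective {π : A →ₐ[k] κ} (hπ : Function.Surjective π) {ε ε' : κ →ₐ[k] K}
    (h : RingHom.ker (extendPoint (B := B) (ε.comp π)) ≤
      RingHom.ker (extendPoint (B := B) (ε'.comp π))) : ε = ε' := by
  have h1 := algHom_eq_of_ker_le h
  ext z
  obtain ⟨a, rfl⟩ := hπ z
  have h2 := congrArg (fun e : B →ₐ[K] K => e (algebraMap A B a)) h1
  simpa using h2

/-- The primes of `K ⊗ A` over a maximal ideal of `A` come from embeddings of its residue field. -/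
lemma exists_ker_extendPoint_eq [IsAlgClosed K] [Algebra.IsAlgebraic k κ] {π : A →ₐ[k] κ}
    (hπ : Function.Surjective π) (q : Ideal B) [q.IsPrime]
    (hq : q.comap (algebraMap A B) = RingHom.ker π) :
    ∃ ε : κ →ₐ[k] K, RingHom.ker (extendPoint (B := B) (ε.comp π)) = q := by
  have H : Algebra.IsPushout k K A B := Algebra.IsPushout.symm inferInstance
  -- The quotient is generated over `K` by images of elements of `A`, which factor through the
  -- algebraic extension `κ`. As `K` is algebraically closed, the quotient is `K`, which yields a
  -- `K`-point.
  have hint : Algebra.IsIntegral K (B ⧸ q) := by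
    refine ⟨fun z => ?_⟩
    obtain ⟨b, rfl⟩ := Ideal.Quotient.mk_surjective z
    refine H.out.inductionOn b (fun b => IsIntegral K (Ideal.Quotient.mk q b)) ?_ ?_ ?_ ?_
    · rw [map_zero]
      exact isIntegral_zero
    · intro a
      obtain ⟨p, hp, hpa⟩ := Algebra.IsIntegral.isIntegral (R := k) (π a)
      have h1 : Polynomial.aeval a p ∈ RingHom.ker π := by
        rw [RingHom.mem_ker, ← Polynomial.aeval_algHom_apply]
        exact hpa
      rw [← hq, Ideal.mem_comap] at h1
      refine ⟨p.map (algebraMap k K), hp.map _, ?_⟩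
      have h2 : Polynomial.aeval (algebraMap A B a) p ∈ q := by
        rwa [Polynomial.aeval_algebraMap_apply]
      have h3 : Polynomial.aeval (Ideal.Quotient.mkₐ k q (algebraMap A B a)) p = 0 := by
        rw [Polynomial.aeval_algHom_apply]
        exact Ideal.Quotient.eq_zero_iff_mem.mpr h2
      rwa [Polynomial.eval₂_map, ← IsScalarTower.algebraMap_eq]
    · intro c b hb
      rw [Algebra.smul_def, map_mul]
      exact (isIntegral_algebraMap (R := K) (A := B ⧸ q) (x := c)).mul hb
    · intro b c hb hc
      rw [map_add]
      exact hb.add hc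
  let j := AlgEquiv.ofBijective (Algebra.ofId K (B ⧸ q))
    IsAlgClosed.algebraMap_bijective_of_isIntegral
  let e : B →ₐ[K] K := (j.symm : (B ⧸ q) →ₐ[K] K).comp (Ideal.Quotient.mkₐ K q)
  have he : RingHom.ker e = q := by
    ext b
    rw [RingHom.mem_ker]
    change j.symm (Ideal.Quotient.mk q b) = 0 ↔ _
    rw [EmbeddingLike.map_eq_zero_iff, Ideal.Quotient.eq_zero_iff_mem]
  let δ : A →ₐ[k] K := (e.restrictScalars k).comp (IsScalarTower.toAlgHom k A B)
  have hδ : ∀ a ∈ RingHom.ker π, δ a = 0 := fun a ha => by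
    rw [← hq, Ideal.mem_comap, ← he] at ha
    exact ha
  let ε : κ →ₐ[k] K := (Ideal.Quotient.liftₐ (RingHom.ker π) δ hδ).comp
    (Ideal.quotientKerAlgEquivOfSurjective hπ).symm
  have hε : ∀ a, ε (π a) = δ a := fun a => by
    change Ideal.Quotient.liftₐ (RingHom.ker π) δ hδ
      ((Ideal.quotientKerAlgEquivOfSurjective hπ).symm (π a)) = δ a
    rw [← Ideal.quotientKerAlgEquivOfSurjective_mk hπ, AlgEquiv.symm_apply_apply]
    rfl
  refine ⟨ε, ?_⟩
  rw [← he]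
  congr 1
  refine algHom_ext_of_isPushout (k := k) (A := A) inferInstance fun a => ?_
  rw [extendPoint_algebraMap]
  exact hε a

end Points

section Evaluation

variable {X : Scheme.{u}}

lemma fromSpec_mem_basicOpen {U : X.Opens} (hU : IsAffineOpen U) (p : PrimeSpectrum Γ(X, U))
    (s : Γ(X, U)) : hU.fromSpec p ∈ X.basicOpen s ↔ s ∉ p.asIdeal := by
  rw [← PrimeSpectrum.mem_basicOpen, ← SetLike.mem_coe, ← hU.fromSpec_preimage_basicOpen]
  rfl

lemma eq_of_forall_mem_basicOpen_iff {U : X.Opens} (hU : IsAffineOpen U) {x y : X} (hx : x ∈ U)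
    (hy : y ∈ U) (h : ∀ s : Γ(X, U), x ∈ X.basicOpen s ↔ y ∈ X.basicOpen s) : x = y := by
  rw [← SetLike.mem_coe, ← hU.range_fromSpec] at hx hy
  obtain ⟨p, rfl⟩ := hx
  obtain ⟨q, rfl⟩ := hy
  congr 1
  exact PrimeSpectrum.ext (Ideal.ext fun s => not_iff_not.mp
    (((fromSpec_mem_basicOpen hU p s).symm.trans (h s)).trans (fromSpec_mem_basicOpen hU q s)))

variable {k : Type u} [Field k] (v : X ⟶ Spec (CommRingCat.of k))

lemma fromSpec_comp {U : X.Opens} (hU : IsAffineOpen U) :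
    hU.fromSpec ≫ v = Spec.map (sectionHom v U) := by
  rw [← cancel_epi hU.isoSpec.hom, ← Category.assoc, hU.isoSpec_hom_fromSpec,
    ι_comp_eq_toSpecΓ_comp, hU.isoSpec_hom]

lemma sectionHom_evaluation {U : X.Opens} (hU : IsAffineOpen U) {x : X} (hx : x ∈ U) :
    sectionHom v U ≫ X.evaluation U x hx = Spec.preimage (X.fromSpecResidueField x ≫ v) := by
  apply Spec.map_injective
  rw [Spec.map_preimage, Spec.map_comp, ← fromSpec_comp v hU, ← Category.assoc]
  congr 1
  rw [Scheme.evaluation, Spec.map_comp, Category.assoc, Scheme.fromSpecResidueField,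
    ← hU.fromSpecStalk_eq_fromSpecStalk hx]
  rfl

/-- An element of the residue field is a quotient of values of sections over `U`. These values form
a subalgebra of an algebraic extension of `k`, which is closed under inverses. -/
lemma evaluation_surjective {U : X.Opens} (hU : IsAffineOpen U) {x : X} (hx : x ∈ U)
    [Algebra k (X.residueField x)] [Algebra.IsAlgebraic k (X.residueField x)]
    (h : algebraMap k (X.residueField x) = (Spec.preimage (X.fromSpecResidueField x ≫ v)).hom) :
    Function.Surjective (X.evaluation U x hx) := by
  rw [← sectionHom_evaluation v hU hx] at h
  let T : Subalgebra k (X.residueField x) :=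
    { (X.evaluation U x hx).hom.range with
      algebraMap_mem' := fun c => by
        rw [h]
        exact ⟨sectionHom v U c, rfl⟩ }
  intro z
  obtain ⟨z, rfl⟩ := X.residue_surjective x z
  let : Algebra Γ(X, U) (X.presheaf.stalk x) := (X.presheaf.germ U x hx).hom.toAlgebra
  have hloc : IsLocalization.AtPrime (X.presheaf.stalk x) (hU.primeIdealOf ⟨x, hx⟩).asIdeal :=
    hU.isLocalization_stalk ⟨x, hx⟩
  obtain ⟨⟨b, s⟩, hbs⟩ := IsLocalization.surj (hU.primeIdealOf ⟨x, hx⟩).asIdeal.primeCompl z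
  have h1 : X.residue x z * X.evaluation U x hx s = X.evaluation U x hx b := by
    have := congrArg (X.residue x) hbs
    rwa [map_mul] at this
  have h2 : X.evaluation U x hx s ≠ 0 := by
    have := (IsLocalization.map_units (X.presheaf.stalk x) s).map (X.residue x).hom
    exact this.ne_zero
  have h3 : X.residue x z = X.evaluation U x hx b * (X.evaluation U x hx s)⁻¹ := by
    rw [← h1, mul_assoc, mul_inv_cancel₀ h2, mul_one]
  have h4 : X.residue x z ∈ T := by
    rw [h3]
    refine T.mul_mem ⟨b, rfl⟩ (T.inv_mem_of_algebraic (x := ⟨X.evaluation U x hx s, s, rfl⟩) ?_)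
    exact Algebra.IsAlgebraic.isAlgebraic _
  exact h4

end Evaluation

end SeveriBrauer

/-! ### Geometric points in homogeneous coordinates, and the fibre over a point of degree six. -/

namespace SeveriBrauer

open MvPolynomial

section PlanePoints

attribute [local instance] planeFunctionFieldAlgebra

variable {K : Type u} [Field K] {U : (plane K).Opens} (hU : IsAffineOpen U)
  [Algebra K Γ(plane K, U)]

/-- The point of the projective plane given by a `K`-point of an affine open. -/
noncomputable def pointOf (e : Γ(plane K, U) →ₐ[K] K) : plane K :=
  hU.fromSpec (⟨RingHom.ker e, RingHom.ker_isPrime _⟩ : PrimeSpectrum _)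

variable {hU} {e e' : Γ(plane K, U) →ₐ[K] K}

lemma pointOf_mem : pointOf hU e ∈ U := by
  have h : pointOf hU e ∈ Set.range hU.fromSpec := ⟨_, rfl⟩
  rwa [hU.range_fromSpec] at h

lemma pointOf_mem_basicOpen (s : Γ(plane K, U)) :
    pointOf hU e ∈ (plane K).basicOpen s ↔ e s ≠ 0 := by
  rw [pointOf, fromSpec_mem_basicOpen]
  rfl

/-- A specialization is an inclusion of kernels, and a `K`-algebra homomorphism to `K` is determined
by its kernel. -/
lemma eq_of_pointOf_specializes (h : pointOf hU e ⤳ pointOf hU e') : e = e' := by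
  refine algHom_eq_of_ker_le fun s hs => ?_
  by_contra hs'
  exact (pointOf_mem_basicOpen (hU := hU) s).mp (h.mem_open ((plane K).basicOpen s).isOpen
    ((pointOf_mem_basicOpen s).mpr hs')) hs

variable [Nonempty U]

lemma exists_hasValue {i : Fin 3} (hi : pointOf hU e ∈ planeChart K i) (j : Fin 3) :
    ∃ c, HasValue e (planeCoord K j / planeCoord K i) c := by
  have h : IsRegularAt (pointOf hU e) (planeCoord K j / planeCoord K i) := by
    have := isRegularAt_section hi (formSection K i (isHomogeneous_X K j))
    rwa [germ_formSection, aeval_X, pow_one] at this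
  obtain ⟨b, s, hs, hb⟩ := h.exists_section hU pointOf_mem
  rw [pointOf_mem_basicOpen] at hs
  exact ⟨e b / e s, b, s, hs, hb, (div_mul_cancel₀ _ hs).symm⟩

variable [IsScalarTower K Γ(plane K, U) (plane K).functionField]

/-- Translates incidence in `Proj` into vanishing at coordinates: the section `f / X i ^ d` is a
unit at the point exactly when its value there is nonzero. -/
lemma mem_asHomogeneousIdeal_iff {i : Fin 3} (hi : pointOf hU e ∈ planeChart K i) {a : Fin 3 → K}
    (ha : ∀ j, HasValue e (planeCoord K j / planeCoord K i) (a j)) {d : ℕ}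
    {f : MvPolynomial (Fin 3) K} (hf : f.IsHomogeneous d) :
    f ∈ (pointOf hU e).asHomogeneousIdeal ↔ eval a f = 0 := by
  obtain ⟨b, s, hs, hb, hv⟩ := HasValue.aeval ha f
  rw [aeval_div hf] at hb
  have h1 := mem_basicOpen_congr (X := plane K) hi pointOf_mem (b := formSection K i hf) (s := 1)
    (b' := b) (s' := s) (h := aeval (planeCoord K) f / planeCoord K i ^ d)
    (by rwa [(plane K).basicOpen_of_isUnit isUnit_one]) ((pointOf_mem_basicOpen s).mpr hs)
    (by rw [map_one, mul_one, germ_formSection]) hb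
  rw [mem_basicOpen_formSection K hf hi, pointOf_mem_basicOpen, hv, not_iff_comm, not_not] at h1
  exact h1.symm.trans (by simp [hs])

lemma HasValue.eq_one {i : Fin 3} {a : Fin 3 → K}
    (ha : ∀ j, HasValue e (planeCoord K j / planeCoord K i) (a j)) : a i = 1 := by
  have h := ha i
  rw [div_self ((isProjCoord_planeCoord K).ne_zero i)] at h
  refine HasValue.unique ((plane K).germToFunctionField_injective U) h ?_
  have h' := HasValue.of_algebraMap (L := (plane K).functionField) e 1
  rwa [map_one, map_one] at h'

/-- A point of the projective plane is determined by its homogeneous coordinates. -/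
lemma pointOf_eq_of_proportional {i i' : Fin 3} (hi : pointOf hU e ∈ planeChart K i)
    (hi' : pointOf hU e' ∈ planeChart K i') {a a' : Fin 3 → K}
    (ha : ∀ j, HasValue e (planeCoord K j / planeCoord K i) (a j))
    (ha' : ∀ j, HasValue e' (planeCoord K j / planeCoord K i') (a' j))
    (h : ∀ i j, a i * a' j = a j * a' i) : pointOf hU e = pointOf hU e' := by
  have h1 : ∀ j, a' j = a' i * a j := fun j => by
    have := h i j
    rw [HasValue.eq_one ha, one_mul] at this
    rw [this, mul_comm]
  have hc : a' i ≠ 0 := fun hc => by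
    have := h1 i'
    rw [HasValue.eq_one ha', hc, zero_mul] at this
    exact one_ne_zero this
  have key : ∀ (d : ℕ) (f : MvPolynomial (Fin 3) K), f.IsHomogeneous d →
      (f ∈ (pointOf hU e).asHomogeneousIdeal ↔ f ∈ (pointOf hU e').asHomogeneousIdeal) := by
    intro d f hf
    refine (mem_asHomogeneousIdeal_iff hi ha hf).trans
      (Iff.trans ?_ (mem_asHomogeneousIdeal_iff hi' ha' hf).symm)
    have h2 := aeval_mul_left hf (a' i) a
    rw [show (fun j => a' i * a j) = a' from funext fun j => (h1 j).symm] at h2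
    change eval a' f = a' i ^ d * eval a f at h2
    rw [h2]
    simp [hc]
  refine ProjectiveSpectrum.ext (HomogeneousIdeal.ext ?_)
  refine Ideal.ext fun f => ?_
  have h3 : ∀ I : HomogeneousIdeal (grading K), f ∈ I.toIdeal ↔
      ∀ d, ((DirectSum.decompose (grading K) f d : grading K d) : MvPolynomial (Fin 3) K) ∈ I :=
    fun I => I.isHomogeneous.mem_iff
  refine (h3 _).trans (Iff.trans ?_ (h3 _).symm)
  exact forall_congr' fun d => key d _ (DirectSum.decompose (grading K) f d).2

end PlanePoints

section Fibre

attribute [local instance] planeFunctionFieldAlgebra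

variable {k K : Type u} [Field k] [Field K] [Algebra k K] [IsAlgClosure k K] {Y : Scheme.{u}}
  [IsIntegral Y] {v : Y ⟶ Spec (CommRingCat.of k)} {m : plane K ⟶ Y}

/-- The geometric points over a closed point of degree six. If they are in special position, the
projective plane has projective coordinates that are defined over the function field of `Y`. -/
theorem exists_fibre (h2 : (2 : k) ≠ 0) (h3 : (3 : k) ≠ 0)
    (hm : IsPullback m (planeHom K) v (Spec.map (CommRingCat.ofHom (algebraMap k K))))
    (hη : m (genericPoint (plane K)) = genericPoint Y) {x : Y} (hx : IsClosed {x})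
    [Algebra k (Y.residueField x)]
    (hκ : algebraMap k (Y.residueField x) = (Spec.preimage (Y.fromSpecResidueField x ≫ v)).hom)
    (h6 : Module.finrank k (Y.residueField x) = 6) :
    ∃ y : Fin 6 → plane K, Function.Injective y ∧ Set.range y = m ⁻¹' {x} ∧
      (∀ i, IsClosed {y i}) ∧
      (((∃ i j l, i ≠ j ∧ i ≠ l ∧ j ≠ l ∧ ∃ f : MvPolynomial (Fin 3) K, f.IsHomogeneous 1 ∧ f ≠ 0 ∧
          f ∈ (y i).asHomogeneousIdeal ∧ f ∈ (y j).asHomogeneousIdeal ∧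
          f ∈ (y l).asHomogeneousIdeal) ∨
        ∃ f : MvPolynomial (Fin 3) K, f.IsHomogeneous 2 ∧ f ≠ 0 ∧
          ∀ i, f ∈ (y i).asHomogeneousIdeal) →
        ∃ Z : Fin 3 → MvPolynomial (Fin 3) K, (∀ i, (Z i).IsHomogeneous 1) ∧
          LinearIndependent K Z ∧ ∀ i, aeval (planeCoord K) (Z i) / aeval (planeCoord K) (Z 0) ∈
            Set.range (functionFieldMap m hη)) := by
  have := isAffineHom_of_isPullback hm
  have := surjective_of_isPullback hm
  have : IsAlgClosed K := IsAlgClosure.isAlgClosed k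
  have : Algebra.IsAlgebraic k K := IsAlgClosure.isAlgebraic
  obtain ⟨W, hW, hxW, -⟩ := exists_isAffineOpen_mem_and_subset (x := x) (U := ⊤) trivial
  have i1 : Nonempty W := ⟨⟨x, hxW⟩⟩
  have i2 : Nonempty (m ⁻¹ᵁ W) := nonempty_preimage m W
  let : Algebra k Γ(Y, W) := (sectionHom v W).hom.toAlgebra
  let : Algebra K Γ(plane K, m ⁻¹ᵁ W) := (sectionHom (planeHom K) (m ⁻¹ᵁ W)).hom.toAlgebra
  let : Algebra Γ(Y, W) Γ(plane K, m ⁻¹ᵁ W) := (m.app W).hom.toAlgebra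
  let : Algebra k Γ(plane K, m ⁻¹ᵁ W) := ((sectionHom v W) ≫ m.app W).hom.toAlgebra
  have : IsScalarTower k Γ(Y, W) Γ(plane K, m ⁻¹ᵁ W) := .of_algebraMap_eq' rfl
  have : IsScalarTower k K Γ(plane K, m ⁻¹ᵁ W) :=
    .of_algebraMap_eq' (congrArg CommRingCat.Hom.hom (sectionHom_comp_app _ hm.w W))
  let : Algebra k Y.functionField := (functionFieldHom v).hom.toAlgebra
  let : Algebra Y.functionField (plane K).functionField := (functionFieldMap m hη).hom.toAlgebra
  let : Algebra k (plane K).functionField :=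
    (functionFieldHom v ≫ functionFieldMap m hη).hom.toAlgebra
  let : Algebra Γ(Y, W) (plane K).functionField :=
    (Y.germToFunctionField W ≫ functionFieldMap m hη).hom.toAlgebra
  have : IsScalarTower Γ(Y, W) Y.functionField (plane K).functionField := .of_algebraMap_eq' rfl
  have : IsScalarTower Γ(Y, W) Γ(plane K, m ⁻¹ᵁ W) (plane K).functionField :=
    .of_algebraMap_eq' (congrArg CommRingCat.Hom.hom (germToFunctionField_functionFieldMap hη W))
  have : IsScalarTower K Γ(plane K, m ⁻¹ᵁ W) (plane K).functionField :=
    .of_algebraMap_eq' (congrArg CommRingCat.Hom.hom (sectionHom_germToFunctionField _ _)).symm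
  have : IsScalarTower k Y.functionField (plane K).functionField := .of_algebraMap_eq' rfl
  have : IsScalarTower k K (plane K).functionField :=
    .of_algebraMap_eq' (congrArg CommRingCat.Hom.hom (functionFieldHom_functionFieldMap hm.w hη))
  have : IsScalarTower k Γ(Y, W) Y.functionField :=
    .of_algebraMap_eq' (congrArg CommRingCat.Hom.hom (sectionHom_germToFunctionField v W)).symm
  have : IsScalarTower k Γ(Y, W) (plane K).functionField :=
    .of_algebraMap_eq' (by
      rw [IsScalarTower.algebraMap_eq k Y.functionField, IsScalarTower.algebraMap_eq k Γ(Y, W)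
        Y.functionField]
      rfl)
  have : IsScalarTower k Γ(plane K, m ⁻¹ᵁ W) (plane K).functionField :=
    .of_algebraMap_eq' (by
      rw [IsScalarTower.algebraMap_eq k Γ(Y, W) (plane K).functionField,
        IsScalarTower.algebraMap_eq k Γ(Y, W) Γ(plane K, m ⁻¹ᵁ W), ← RingHom.comp_assoc,
        ← IsScalarTower.algebraMap_eq Γ(Y, W), ← IsScalarTower.algebraMap_eq k])
  have hW' : IsAffineOpen (m ⁻¹ᵁ W) := hW.preimage m
  have p1 : Algebra.IsPushout k Γ(Y, W) K Γ(plane K, m ⁻¹ᵁ W) :=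
    isPushout_algebra_sections hm hW rfl rfl rfl
  have : IsFractionRing Γ(Y, W) Y.functionField :=
    functionField_isFractionRing_of_isAffineOpen Y W hW
  have : IsFractionRing Γ(plane K, m ⁻¹ᵁ W) (plane K).functionField :=
    functionField_isFractionRing_of_isAffineOpen (plane K) _ hW'
  have p2 : Algebra.IsPushout k Y.functionField K (plane K).functionField :=
    isPushout_fractionField (A := Γ(Y, W)) (B := Γ(plane K, m ⁻¹ᵁ W))
  have hfin : FiniteDimensional k (Y.residueField x) := FiniteDimensional.of_finrank_pos (by omega)
  have hsep := isSeparable_of_finrank_eq_six h2 h3 h6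
  let E := Y.residueField x →ₐ[k] K
  -- Separability makes the number of embeddings into `K` equal to the degree.
  have hE : Fintype.card E = 6 := by
    rw [AlgHom.card, h6]
  let : MulAction (K ≃ₐ[k] K) E := embeddingAction
  have : MulAction.IsPretransitive (K ≃ₐ[k] K) E := isPretransitive_embeddingAction
  let π : Γ(Y, W) →ₐ[k] Y.residueField x :=
    { (Y.evaluation W x hxW).hom with
      commutes' := fun c => by
        rw [hκ, ← sectionHom_evaluation v hW hxW]
        rfl }
  have hπ : Function.Surjective π := evaluation_surjective v hW hxW hκ
  let e : E → Γ(plane K, m ⁻¹ᵁ W) →ₐ[K] K := fun ε => extendPoint (ε.comp π)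
  have he : ∀ ε s, e ε (m.app W s) = ε (π s) := fun ε s => extendPoint_algebraMap (ε.comp π) s
  have hxs : ∀ s, x ∈ Y.basicOpen s ↔ π s ≠ 0 := fun s =>
    (Y.evaluation_ne_zero_iff_mem_basicOpen x hxW s).symm
  have hms : ∀ z s, m z ∈ Y.basicOpen s ↔ z ∈ (plane K).basicOpen (m.app W s) := fun z s => by
    rw [← Scheme.preimage_basicOpen]
    rfl
  have hinj : ∀ ε ε', e ε = e ε' → ε = ε' := fun ε ε' h =>
    extendPoint_comp_injective (B := Γ(plane K, m ⁻¹ᵁ W)) hπ (congrArg RingHom.ker h).le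
  have hmem : ∀ ε, m (pointOf hW' (e ε)) = x := fun ε => by
    refine eq_of_forall_mem_basicOpen_iff hW
      (show pointOf hW' (e ε) ∈ m ⁻¹ᵁ W from pointOf_mem) hxW fun s => ?_
    rw [hms, pointOf_mem_basicOpen, he, hxs, map_ne_zero]
  have hex : ∀ z, m z = x → ∃ ε, pointOf hW' (e ε) = z := fun z hz => by
    have hzW : z ∈ m ⁻¹ᵁ W := by
      change m z ∈ W
      rwa [hz]
    rw [← SetLike.mem_coe, ← hW'.range_fromSpec] at hzW
    obtain ⟨(q : PrimeSpectrum _), rfl⟩ := hzW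
    obtain ⟨ε, hε⟩ := exists_ker_extendPoint_eq (K := K) hπ q.asIdeal (Ideal.ext fun s => by
      have h := hms (hW'.fromSpec q) s
      rw [hz, hxs] at h
      exact (not_iff_not.mp (h.trans (fromSpec_mem_basicOpen hW' q _))).symm)
    exact ⟨ε, congrArg hW'.fromSpec (PrimeSpectrum.ext hε)⟩
  choose i hi using fun ε => exists_mem_planeChart K (pointOf hW' (e ε))
  choose a ha using fun ε j => exists_hasValue (hi ε) j
  have hdist : ∀ ε ε', ε ≠ ε' → ∃ i j, a ε i * a ε' j ≠ a ε j * a ε' i := fun ε ε' hne => by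
    by_contra! H
    exact hne (hinj _ _ (eq_of_pointOf_specializes (hU := hW') (specializes_of_eq
      (pointOf_eq_of_proportional (hi ε) (hi ε') (ha ε) (ha ε') H))))
  let q : Fin 6 ≃ E := (Fintype.equivFinOfCardEq hE).symm
  refine ⟨fun n => pointOf hW' (e (q n)), fun n n' h => ?_, ?_, fun n => ?_, fun H => ?_⟩
  · exact q.injective (hinj _ _ (eq_of_pointOf_specializes (specializes_of_eq h)))
  · ext z
    constructor
    · rintro ⟨n, rfl⟩
      exact hmem _
    · intro hz
      obtain ⟨ε, hε⟩ := hex z hz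
      exact ⟨q.symm ε, by simpa using hε⟩
  -- A specialization of a point of the fibre lies over `x`, since `x` is closed, and between points
  -- of the fibre there are only trivial specializations.
  · rw [← closure_subset_iff_isClosed]
    intro z hz
    have hz' := specializes_iff_mem_closure.mpr hz
    obtain ⟨ε, rfl⟩ := hex z (by
      have h1 := hz'.map m.continuous
      rw [hmem, specializes_iff_mem_closure, hx.closure_eq] at h1
      exact h1)
    exact Set.mem_singleton_iff.mpr
      (congrArg (pointOf hW') (eq_of_pointOf_specializes hz').symm)
  -- The rings of sections over all nonempty affine opens of `Y`. Their spans describe the regular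
  -- bivector fields, as required for the descent of cubic forms.
  · let S : {W : Y.Opens // IsAffineOpen W ∧ Nonempty W} → Subalgebra k Y.functionField := fun W =>
      have := W.2.2
      { (Y.germToFunctionField W.1).hom.range with
        algebraMap_mem' := fun c =>
          ⟨sectionHom v W.1 c, ConcreteCategory.congr_hom (sectionHom_germToFunctionField v W.1) c⟩ }
    refine exists_coord_of_special (k := k) (A := Γ(Y, W)) (B := Γ(plane K, m ⁻¹ᵁ W)) h3
      (isProjCoord_planeCoord K) S
      (fun β hβ => hβ.forall_chart_iff hm hη (fun W => S W) fun W => rfl)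
      (IsFractionRing.injective _ _) hE (fun ε => ε.comp π) (fun σ ε => rfl) ha hdist ?_
    refine H.imp ?_ ?_
    · rintro ⟨n₁, n₂, n₃, h12, h13, h23, f, hf, hf0, hf1, hf2, hf3⟩
      rw [mem_asHomogeneousIdeal_iff (hi _) (ha _) hf] at hf1 hf2 hf3
      exact ⟨q n₁, q n₂, q n₃, q.injective.ne h12, q.injective.ne h13, q.injective.ne h23,
        fun hn => hf0 (hn f hf hf1 hf2 hf3)⟩
    · rintro ⟨f, hf, hf0, h⟩
      refine ⟨f, hf, hf0, fun ε => ?_⟩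
      have h1 := h (q.symm ε)
      rw [mem_asHomogeneousIdeal_iff (hi _) (ha _) hf, q.apply_symm_apply] at h1
      exact h1

end Fibre

end SeveriBrauer

/-! ### Recognizing `K ⊗ A`, and invertible linear substitutions. -/

namespace SeveriBrauer

open MvPolynomial

section Span

variable {k K A B F L : Type u} [Field k] [Field K] [CommRing A] [CommRing B] [Field F] [Field L]
  [Algebra k K] [Algebra k A] [Algebra k B] [Algebra A B] [Algebra K B] [Algebra A F] [Algebra B L]
  [Algebra k F] [Algebra K L] [Algebra F L] [Algebra k L]
  [IsScalarTower k A B] [IsScalarTower k K B] [IsScalarTower k A F] [IsScalarTower k K L]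
  [IsScalarTower k F L] [IsScalarTower K B L]

open TensorProduct in
/-- A form of `K ⊗ A` inside `K ⊗ F` is determined by its `K`-span. -/
lemma isPushout_of_span [Algebra.IsPushout k F K L]
    (hABL : ∀ a, algebraMap B L (algebraMap A B a) = algebraMap F L (algebraMap A F a))
    (hA : Function.Injective (algebraMap A F)) (hB : Function.Injective (algebraMap B L))
    (h : Set.range (algebraMap B L) ⊆
      Submodule.span K (algebraMap F L '' Set.range (algebraMap A F))) :
    Algebra.IsPushout k A K B := by
  let Φ : K ⊗[k] A →ₐ[K] B := Algebra.TensorProduct.lift (Algebra.ofId K B)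
    (IsScalarTower.toAlgHom k A B) fun _ _ => Commute.all _ _
  have hΦ : ∀ c a, Φ (c ⊗ₜ a) = algebraMap K B c * algebraMap A B a := fun c a =>
    Algebra.TensorProduct.lift_tmul _ _ _ _ _
  have hp : Algebra.IsPushout k K F L := Algebra.IsPushout.symm inferInstance
  let j : A →ₗ[k] F := (IsScalarTower.toAlgHom k A F).toLinearMap
  have hj : ∀ z, algebraMap B L (Φ z) = Algebra.IsPushout.equiv k K F L (j.lTensor K z) := by
    intro z
    induction z with
    | zero => simp
    | add x y hx hy => simp [hx, hy]
    | tmul c a =>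
      rw [hΦ, LinearMap.lTensor_tmul, Algebra.IsPushout.equiv_tmul, map_mul, hABL,
        ← IsScalarTower.algebraMap_apply]
      rfl
  -- By `hj` the map is a restriction of `K ⊗ F ≃ L`; flatness of `K` keeps `K ⊗ A` inside `K ⊗ F`.
  have hinj : Function.Injective Φ := by
    have h1 : Function.Injective (j.lTensor K) := Module.Flat.lTensor_preserves_injective_linearMap j hA
    intro z z' hz
    refine h1 ((Algebra.IsPushout.equiv k K F L).injective ?_)
    rw [← hj, ← hj, hz]
  have hsurj : Function.Surjective Φ := by
    intro b
    have hb : algebraMap B L b ∈ (Φ.toLinearMap.range).map (IsScalarTower.toAlgHom K B L).toLinearMap := by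
      refine Submodule.span_le.mpr ?_ (h ⟨b, rfl⟩)
      rintro _ ⟨_, ⟨a, rfl⟩, rfl⟩
      exact ⟨_, ⟨1 ⊗ₜ a, rfl⟩, by
        refine (congrArg (algebraMap B L) (hΦ 1 a)).trans ?_
        rw [map_one, one_mul, hABL]⟩
    obtain ⟨_, ⟨z, rfl⟩, hz⟩ := hb
    exact ⟨z, hB hz⟩
  refine Algebra.IsPushout.symm ⟨IsBaseChange.of_equiv (LinearEquiv.ofBijective Φ.toLinearMap
    ⟨hinj, hsurj⟩) fun a => ?_⟩
  refine (hΦ 1 a).trans ?_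
  rw [map_one, one_mul]
  rfl

end Span

section Substitution

variable {K : Type u} [Field K] {Z : Fin 3 → MvPolynomial (Fin 3) K}
  (hZ : ∀ i, (Z i).IsHomogeneous 1) (hli : LinearIndependent K Z)
include hZ hli

/-- Independent linear forms span all linear forms, so the substitution has an inverse, again
linear. -/
lemma exists_aeval_eq_X : ∃ W : Fin 3 → MvPolynomial (Fin 3) K, (∀ i, (W i).IsHomogeneous 1) ∧
    ∀ i, aeval Z (W i) = X i := by
  choose c hc using exists_X_eq_sum hZ hli
  refine ⟨fun i => ∑ l, c i l • X l, fun i => ?_, fun i => ?_⟩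
  · refine IsHomogeneous.sum _ _ 1 fun l _ => ?_
    rw [smul_eq_C_mul]
    exact (isHomogeneous_X K l).C_mul _
  · rw [map_sum, hc i]
    simp_rw [map_smul, aeval_X]

lemma exists_aeval_eq_of_linearIndependent {d : ℕ} {f : MvPolynomial (Fin 3) K}
    (hf : f.IsHomogeneous d) :
    ∃ g : MvPolynomial (Fin 3) K, g.IsHomogeneous d ∧ aeval Z g = f := by
  obtain ⟨W, hW, h⟩ := exists_aeval_eq_X hZ hli
  refine ⟨aeval W f, by simpa using hf.aeval W hW, ?_⟩
  rw [comp_aeval_apply]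
  simp_rw [h]
  exact aeval_X_left_apply f

lemma eq_zero_of_aeval_eq_zero {d : ℕ} {f : MvPolynomial (Fin 3) K}
    (hf : f.IsHomogeneous d) (h0 : aeval Z f = 0) : f = 0 := by
  obtain ⟨W, hW, h⟩ := exists_aeval_eq_X hZ hli
  have hWli : LinearIndependent K W := by
    refine LinearIndependent.of_comp (aeval Z).toLinearMap ?_
    rw [show (aeval Z).toLinearMap ∘ W = X from funext h]
    exact linearIndependent_X
  obtain ⟨g, hg, rfl⟩ := exists_aeval_eq_of_linearIndependent hW hWli hf
  rw [comp_aeval_apply] at h0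
  simp_rw [h] at h0
  rw [show g = 0 from (aeval_X_left_apply g).symm.trans h0, map_zero]

lemma irrelevant_le_span_of_linearIndependent : (HomogeneousIdeal.irrelevant (grading K)).toIdeal ≤
    Ideal.span (Set.range Z) := by
  refine (irrelevant_le_span_X K).trans (Ideal.span_le.mpr ?_)
  rintro _ ⟨i, rfl⟩
  obtain ⟨c, hc⟩ := exists_X_eq_sum hZ hli i
  rw [SetLike.mem_coe, hc]
  refine Ideal.sum_mem _ fun l _ => ?_
  rw [smul_eq_C_mul]
  exact Ideal.mul_mem_left _ _ (Ideal.subset_span ⟨l, rfl⟩)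

end Substitution

end SeveriBrauer

/-! ### Morphisms between projective planes given by linear forms. -/

namespace SeveriBrauer

open MvPolynomial

section Pullback

variable {R S : Type u} [CommRing R] [CommRing S] {X Y : Scheme.{u}}
  {g : X ⟶ Spec (CommRingCat.of R)} {v : Y ⟶ Spec (CommRingCat.of S)} {m : X ⟶ Y}
  {ρ : CommRingCat.of S ⟶ CommRingCat.of R}

/-- A square over affine bases is a pullback if it is so on the sections over an affine cover. -/
lemma isPullback_of_isPushout_sections [IsAffineHom m] (hmg : m ≫ v = g ≫ Spec.map ρ) {ι : Type*}
    {U : ι → Y.Opens} (hU : ∀ i, IsAffineOpen (U i)) (hcov : ⨆ i, U i = ⊤)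
    (h : ∀ i, IsPushout (sectionHom v (U i)) ρ (m.app (U i)) (sectionHom g (m ⁻¹ᵁ U i))) :
    IsPullback m g v (Spec.map ρ) := by
  let c : X ⟶ pullback v (Spec.map ρ) := pullback.lift m g hmg
  have hP := IsPullback.of_hasPullback v (Spec.map ρ)
  have hcm : c ≫ pullback.fst v (Spec.map ρ) = m := pullback.lift_fst _ _ _
  have hcg : c ≫ pullback.snd v (Spec.map ρ) = g := pullback.lift_snd _ _ _
  have h' : ∀ i, IsPushout (sectionHom v (U i)) ρ 
      ((pullback.fst v (Spec.map ρ)).app (U i) ≫ c.app (pullback.fst v (Spec.map ρ) ⁻¹ᵁ U i))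
      (sectionHom (c ≫ pullback.snd v (Spec.map ρ)) (c ⁻¹ᵁ pullback.fst v (Spec.map ρ) ⁻¹ᵁ U i)) := by
    intro i
    have h1 := h i
    rw [← hcg] at h1
    clear_value c
    subst hcm
    exact h1
  have : IsAffineHom (c ≫ pullback.fst v (Spec.map ρ)) := by rwa [hcm]
  have : IsAffineHom (pullback.fst v (Spec.map ρ)) :=
    MorphismProperty.of_isPullback hP.flip (inferInstance : IsAffineHom (Spec.map ρ))
  have : IsAffineHom c := IsAffineHom.of_comp c (pullback.fst v (Spec.map ρ))
  have hc : IsIso c := by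
    refine IsZariskiLocalAtTarget.of_iSup_eq_top (P := MorphismProperty.isomorphisms Scheme)
      (fun i => pullback.fst v (Spec.map ρ) ⁻¹ᵁ U i) ?_ fun i => ?_
    · rw [← Scheme.Hom.preimage_iSup, hcov]
      rfl
    · refine (isIso_morphismRestrict_iff_isIso_app c ((hU i).preimage _)).mpr ?_
      have h1 := isPushout_sections (pullback.snd v (Spec.map ρ)) hP (hU i)
      -- Over each chart both squares of rings are pushouts of the same maps, so the comparison on
      -- sections is the canonical isomorphism between them.
      have h2 : c.app (pullback.fst v (Spec.map ρ) ⁻¹ᵁ U i) =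
          (h1.isoIsPushout _ _ (h' i)).hom := by
        apply h1.hom_ext
        · rw [IsPushout.inl_isoIsPushout_hom]
        · rw [IsPushout.inr_isoIsPushout_hom]
          have h3 := sectionHom_comp_app (ρ := 𝟙 _) (m := c) (g := c ≫ pullback.snd v (Spec.map ρ))
            (v := pullback.snd v (Spec.map ρ)) (by simp) (pullback.fst v (Spec.map ρ) ⁻¹ᵁ U i)
          rwa [Category.id_comp] at h3
      rw [h2]
      infer_instance
  exact IsPullback.of_iso hP (asIso c).symm (Iso.refl _) (Iso.refl _) (Iso.refl _)
    (by simp [← hcm]) (by simp [← hcg]) (by simp) (by simp)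

end Pullback

section Linear

variable {k K : Type u} [Field k] [Field K] [Algebra k K] {Z : Fin 3 → MvPolynomial (Fin 3) K}

/-- The homomorphism of graded rings `k[X₀, X₁, X₂] ⟶ K[X₀, X₁, X₂]` given by linear forms. -/
noncomputable def substitution (k : Type u) [Field k] [Algebra k K]
    (hZ : ∀ i, (Z i).IsHomogeneous 1) : grading k →+*ᵍ grading K where
  __ := (aeval Z : MvPolynomial (Fin 3) k →ₐ[k] MvPolynomial (Fin 3) K).toRingHom
  map_mem {d f} hf := by
    have h := IsHomogeneous.aeval (φ := f) (m := d) hf Z hZ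
    rwa [one_mul] at h

lemma substitution_X (hZ : ∀ i, (Z i).IsHomogeneous 1) (i : Fin 3) :
    substitution k hZ (X i) = Z i :=
  aeval_X _ _

/-- Independent linear forms have no common zero; this makes the morphism defined on the whole
plane. -/
lemma irrelevant_le_map_substitution (hZ : ∀ i, (Z i).IsHomogeneous 1)
    (hli : LinearIndependent K Z) : HomogeneousIdeal.irrelevant (grading K) ≤
      (HomogeneousIdeal.irrelevant (grading k)).map (substitution k hZ) := by
  refine show (HomogeneousIdeal.irrelevant (grading K)).toIdeal ≤ _ from ((irrelevant_le_span_of_linearIndependent hZ hli).trans ?_)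
  refine Ideal.span_le.mpr ?_
  rintro _ ⟨i, rfl⟩
  rw [← substitution_X (k := k) hZ]
  exact Ideal.mem_map_of_mem _ (HomogeneousIdeal.mem_irrelevant_of_mem _ one_pos (X_mem_grading k i))

/-- The morphism between projective planes given by linear forms. -/
noncomputable def linearMap (k : Type u) [Field k] [Algebra k K] (hZ : ∀ i, (Z i).IsHomogeneous 1)
    (hli : LinearIndependent K Z) : plane K ⟶ plane k :=
  Proj.map (substitution k hZ) (irrelevant_le_map_substitution hZ hli)

lemma linearMap_planeHom (hZ : ∀ i, (Z i).IsHomogeneous 1) (hli : LinearIndependent K Z) :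
    linearMap k hZ hli ≫ planeHom k =
      planeHom K ≫ Spec.map (CommRingCat.ofHom (algebraMap k K)) := by
  have key : ∀ {i : ℕ} (hi : 0 < i) {s : MvPolynomial (Fin 3) k} (hs : s ∈ grading k i),
      Proj.awayι (grading K) (substitution k hZ s) ((substitution k hZ).map_mem hs) hi ≫
        linearMap k hZ hli ≫ planeHom k =
      Proj.awayι (grading K) (substitution k hZ s) ((substitution k hZ).map_mem hs) hi ≫
        planeHom K ≫ Spec.map (CommRingCat.ofHom (algebraMap k K)) := by
    intro i hi s hs
    rw [linearMap, Proj.awayι_comp_map_assoc _ _ hi _ hs]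
    simp only [Category.assoc, Proj.awayι_toSpecZero_assoc, ← Spec.map_comp]
    congr 1
    ext c
    change Localization.mk (aeval Z (C c)) ⟨aeval Z 1, _⟩ =
      Localization.mk (C (algebraMap k K c)) ⟨1, _⟩
    congr 1
    · exact aeval_C _ _
    · exact Subtype.ext (map_one _)
  exact (Proj.mapAffineOpenCover _
    (irrelevant_le_map_substitution (k := k) hZ hli)).openCover.hom_ext _ _
    fun s => key s.1.2 s.2.2

lemma isHomogeneous_substitution (hZ : ∀ i, (Z i).IsHomogeneous 1) {d : ℕ}
    {f : MvPolynomial (Fin 3) k} (hf : f.IsHomogeneous d) :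
    (substitution k hZ f).IsHomogeneous d :=
  (substitution k hZ).map_mem hf

lemma linearMap_app_formSection (hZ : ∀ i, (Z i).IsHomogeneous 1) (hli : LinearIndependent K Z)
    (j : Fin 3) {d : ℕ} {f : MvPolynomial (Fin 3) k} (hf : f.IsHomogeneous d) :
    (linearMap k hZ hli).app (planeChart k j) (formSection k j hf) =
      linearSection (isHomogeneous_substitution hZ (isHomogeneous_X k j))
        (isHomogeneous_substitution hZ hf) := by
  have h := ConcreteCategory.congr_hom (Proj.awayToSection_comp_appLE (substitution k hZ)
    (irrelevant_le_map_substitution hZ hli) (X_mem_grading k j)) 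
    (HomogeneousLocalization.Away.mk (grading k) (X_mem_grading k j) d f (by simpa using hf))
  rw [← Scheme.Hom.appLE_eq_app]
  refine h.trans (congrArg (Proj.awayToSection (grading K) _) ?_)
  exact HomogeneousLocalization.Away.map_mk (substitution k hZ) _ (X_mem_grading k j) d f _

instance (hZ : ∀ i, (Z i).IsHomogeneous 1) (hli : LinearIndependent K Z) (j : Fin 3) :
    Nonempty (linearMap k hZ hli ⁻¹ᵁ planeChart k j) :=
  nonempty_basicOpen K (by
    rw [substitution_X]
    exact hli.ne_zero j)

lemma isAffineHom_linearMap (hZ : ∀ i, (Z i).IsHomogeneous 1) (hli : LinearIndependent K Z) :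
    IsAffineHom (linearMap k hZ hli) := by
  refine isAffineHom_of_forall_exists_isAffineOpen _ fun y => ?_
  obtain ⟨j, hj⟩ := exists_mem_planeChart k y
  exact ⟨_, hj, isAffineOpen_planeChart k j, Proj.isAffineOpen_basicOpen _ _
    (isHomogeneous_substitution hZ (isHomogeneous_X k j)) one_pos⟩

attribute [local instance] planeFunctionFieldAlgebra

lemma germ_linearMap_app [Algebra k (plane K).functionField]
    [IsScalarTower k K (plane K).functionField] (hZ : ∀ i, (Z i).IsHomogeneous 1)
    (hli : LinearIndependent K Z) (j : Fin 3) {d : ℕ} {f : MvPolynomial (Fin 3) k}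
    (hf : f.IsHomogeneous d) :
    (plane K).germToFunctionField _ ((linearMap k hZ hli).app (planeChart k j)
      (formSection k j hf)) = aeval (fun i => aeval (planeCoord K) (Z i)) f /
        aeval (planeCoord K) (Z j) ^ d := by
  rw [linearMap_app_formSection]
  have : Nonempty (Proj.basicOpen (grading K) (substitution k hZ (X j))) :=
    inferInstanceAs (Nonempty (linearMap k hZ hli ⁻¹ᵁ planeChart k j))
  refine (germ_linearSection _ _).trans ?_
  rw [substitution_X]
  congr 1
  exact comp_aeval_apply _ ((aeval (planeCoord K)).restrictScalars k) f

variable {F : Type u} [Field F] [Algebra k F] [Algebra F (plane K).functionField]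
  [Algebra k (plane K).functionField]
  [IsScalarTower k F (plane K).functionField] [IsScalarTower k K (plane K).functionField]

/-- The pullback of a form of degree 0 with coefficients in `k` is a polynomial over `k` in the
ratios `Z i / Z j`, which lie in `F`. -/
lemma germ_linearMap_app_mem_range (hZ : ∀ i, (Z i).IsHomogeneous 1) (hli : LinearIndependent K Z)
    (hF : ∀ i, aeval (planeCoord K) (Z i) / aeval (planeCoord K) (Z 0) ∈
      Set.range (algebraMap F (plane K).functionField)) (j : Fin 3) (s : Γ(plane k, planeChart k j)) :
    (plane K).germToFunctionField _ ((linearMap k hZ hli).app (planeChart k j) s) ∈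
      Set.range (algebraMap F (plane K).functionField) := by
  obtain ⟨d, f, hf, rfl⟩ := exists_linearSection k (isHomogeneous_X k j) s
  rw [germ_linearMap_app]
  choose ζ hζ using hF
  have h0 : ∀ i, aeval (planeCoord K) (Z i) ≠ 0 := fun i =>
    (isProjCoord_planeCoord K).aeval_ne_zero (hZ i) (hli.ne_zero i)
  refine ⟨aeval (fun i => ζ i / ζ j) f, ?_⟩
  rw [← IsScalarTower.coe_toAlgHom' k F, comp_aeval_apply]
  simp only [IsScalarTower.coe_toAlgHom', map_div₀, hζ]
  rw [← aeval_div hf]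
  congr 2
  ext1 i
  field_simp [h0]

/-- A morphism to the projective plane given by linear forms whose ratios lie in `F` induces
homomorphisms from the coordinate rings to `F`. -/
lemma exists_chartHom (hZ : ∀ i, (Z i).IsHomogeneous 1) (hli : LinearIndependent K Z)
    (hF : ∀ i, aeval (planeCoord K) (Z i) / aeval (planeCoord K) (Z 0) ∈
      Set.range (algebraMap F (plane K).functionField)) (j : Fin 3) :
    ∃ θ : Γ(plane k, planeChart k j) →+* F, ∀ s, algebraMap F (plane K).functionField (θ s) =
      (plane K).germToFunctionField _ ((linearMap k hZ hli).app (planeChart k j) s) := by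
  let e := RingEquiv.ofBijective (algebraMap F (plane K).functionField).rangeRestrict
    ⟨fun x y h => (algebraMap F (plane K).functionField).injective (congrArg Subtype.val h),
      RingHom.rangeRestrict_surjective _⟩
  let f := ((linearMap k hZ hli).app (planeChart k j) ≫ (plane K).germToFunctionField _).hom
  refine ⟨(e.symm : _ →+* F).comp (f.codRestrict (algebraMap F (plane K).functionField).range fun s =>
    germ_linearMap_app_mem_range hZ hli hF j s), fun s => ?_⟩
  exact congrArg Subtype.val (e.apply_symm_apply _)

/-- The map to the projective plane over `k` given by independent linear forms over `K` is a base
change of `Spec K ⟶ Spec k`. -/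
lemma isPullback_linearMap [Algebra.IsPushout k F K (plane K).functionField]
    (hZ : ∀ i, (Z i).IsHomogeneous 1) (hli : LinearIndependent K Z)
    (hF : ∀ i, aeval (planeCoord K) (Z i) / aeval (planeCoord K) (Z 0) ∈
      Set.range (algebraMap F (plane K).functionField)) :
    IsPullback (linearMap k hZ hli) (planeHom K) (planeHom k)
      (Spec.map (CommRingCat.ofHom (algebraMap k K))) := by
  have := isAffineHom_linearMap (k := k) hZ hli
  refine isPullback_of_isPushout_sections (linearMap_planeHom hZ hli) (isAffineOpen_planeChart k)
    (Proj.iSup_basicOpen_eq_top (grading k) _ (irrelevant_le_span_X k)) fun j => ?_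
  obtain ⟨θ, hθ⟩ := exists_chartHom (k := k) hZ hli hF j
  let U := planeChart k j
  let V := linearMap k hZ hli ⁻¹ᵁ U
  let : Algebra k Γ(plane k, U) := (sectionHom (planeHom k) U).hom.toAlgebra
  let : Algebra K Γ(plane K, V) := (sectionHom (planeHom K) V).hom.toAlgebra
  let : Algebra Γ(plane k, U) Γ(plane K, V) := ((linearMap k hZ hli).app U).hom.toAlgebra
  let : Algebra k Γ(plane K, V) :=
    (sectionHom (planeHom k) U ≫ (linearMap k hZ hli).app U).hom.toAlgebra
  let : Algebra Γ(plane k, U) F := θ.toAlgebra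
  have : IsScalarTower k Γ(plane k, U) Γ(plane K, V) := .of_algebraMap_eq' rfl
  have : IsScalarTower k K Γ(plane K, V) := .of_algebraMap_eq'
    (congrArg CommRingCat.Hom.hom (sectionHom_comp_app _ (linearMap_planeHom hZ hli) U))
  have : IsScalarTower K Γ(plane K, V) (plane K).functionField :=
    .of_algebraMap_eq' (congrArg CommRingCat.Hom.hom (sectionHom_germToFunctionField _ V)).symm
  have : IsScalarTower k Γ(plane k, U) F := .of_algebraMap_eq fun c => by
    apply (algebraMap F (plane K).functionField).injective
    refine Eq.trans ?_ (hθ _).symm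
    rw [← IsScalarTower.algebraMap_apply, IsScalarTower.algebraMap_apply k K,
      IsScalarTower.algebraMap_apply K Γ(plane K, V), ← IsScalarTower.algebraMap_apply k K]
    rfl
  have hinj : ∀ (X : Scheme.{u}) [IsIntegral X] (W : X.Opens) [Nonempty W],
      Function.Injective (X.germToFunctionField W) := fun X _ W _ =>
    germ_injective_of_isIntegral X _ _
  have hV : Function.Injective (algebraMap Γ(plane K, V) (plane K).functionField) :=
    hinj (plane K) V
  have hU : Function.Injective (algebraMap Γ(plane k, U) F) := by
    refine (injective_iff_map_eq_zero _).mpr fun s hs => ?_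
    obtain ⟨d, f, hf, rfl⟩ := exists_linearSection k (isHomogeneous_X k j) s
    have h1 := hθ (formSection k j hf)
    rw [show θ _ = 0 from hs, map_zero, germ_linearMap_app, eq_comm, div_eq_zero_iff,
      or_iff_left (pow_ne_zero _ ((isProjCoord_planeCoord K).aeval_ne_zero (hZ j) (hli.ne_zero j))),
      ← aeval_map_algebraMap K, ← comp_aeval_apply] at h1
    have h2 := (isProjCoord_planeCoord K).inj _ _
      (by simpa using (hf.map (algebraMap k K)).aeval Z hZ) h1
    have h3 := eq_zero_of_aeval_eq_zero hZ hli (hf.map (algebraMap k K)) h2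
    have h4 : f = 0 := map_injective _ (algebraMap k K).injective (h3.trans (map_zero _).symm)
    subst h4
    apply hinj (plane k) U
    rw [germ_formSection, map_zero, map_zero, zero_div]
  have hspan : Set.range (algebraMap Γ(plane K, V) (plane K).functionField) ⊆
      Submodule.span K (algebraMap F (plane K).functionField ''
        Set.range (algebraMap Γ(plane k, U) F)) := by
    rintro _ ⟨s, rfl⟩
    obtain ⟨d, f, hf, rfl⟩ := exists_linearSection K
      (isHomogeneous_substitution hZ (isHomogeneous_X k j)) s
    obtain ⟨g, hg, rfl⟩ := exists_aeval_eq_of_linearIndependent hZ hli hf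
    have h1 : algebraMap Γ(plane K, V) (plane K).functionField (linearSection
        (isHomogeneous_substitution hZ (isHomogeneous_X k j)) hf) =
        aeval (fun i => aeval (planeCoord K) (Z i)) g / aeval (planeCoord K) (Z j) ^ d := by
      have : Nonempty (Proj.basicOpen (grading K) (substitution k hZ (X j))) :=
        inferInstanceAs (Nonempty V)
      refine (germ_linearSection _ _).trans ?_
      rw [substitution_X, comp_aeval_apply]
    -- Monomials with coefficient 1 come from the plane over `k`, so their pullbacks lie in `F`; the
    -- coefficients in `K` become scalars of the span.
    rw [h1, g.as_sum, map_sum, Finset.sum_div]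
    refine Submodule.sum_mem _ fun m hm => ?_
    have hmon : (monomial m (1 : k)).IsHomogeneous d := isHomogeneous_monomial 1 (by
      rw [← hg (mem_support_iff.mp hm), Finsupp.degree_eq_weight_one]
      rfl)
    have h2 : aeval (fun i => aeval (planeCoord K) (Z i)) (monomial m (coeff m g)) /
        aeval (planeCoord K) (Z j) ^ d = coeff m g • (algebraMap F (plane K).functionField
          (algebraMap Γ(plane k, U) F (formSection k j hmon))) := by
      refine Eq.trans ?_ (congrArg _ (hθ _).symm)
      rw [germ_linearMap_app, aeval_monomial, aeval_monomial, map_one, one_mul, Algebra.smul_def,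
        mul_div_assoc]
    rw [h2]
    exact Submodule.smul_mem _ _ (Submodule.subset_span ⟨_, ⟨_, rfl⟩, rfl⟩)
  have h := isPushout_of_span (k := k) (K := K) (A := Γ(plane k, U)) (B := Γ(plane K, V)) (F := F)
    (L := (plane K).functionField) (fun s => (hθ s).symm) hU hV hspan
  exact CommRingCat.isPushout_iff_isPushout.mpr h

end Linear

end SeveriBrauer

/-! ### Faithfully flat descent of morphisms and isomorphisms. -/

namespace SeveriBrauer

section Descent

/-- Two morphisms to a separated scheme are equal if they agree on a scheme-theoretically dense
part. -/
lemma ext_of_isSchemeTheoreticallyDominant {W X Y S : Scheme.{u}} {f g : X ⟶ Y} (s : Y ⟶ S)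
    [IsSeparated s] (h : f ≫ s = g ≫ s) (j : W ⟶ X) [IsSchemeTheoreticallyDominant j]
    (hj : j ≫ f = j ≫ g) : f = g := by
  let X' : Over S := Over.mk (f ≫ s)
  let Y' : Over S := Over.mk s
  let W' : Over S := Over.mk (j ≫ f ≫ s)
  let f' : X' ⟶ Y' := Over.homMk f
  let g' : X' ⟶ Y' := Over.homMk g
  let j' : W' ⟶ X' := Over.homMk j
  have : IsSeparated Y'.hom := ‹_›
  have hl : (equalizer.lift j' (by ext1; exact hj) : W' ⟶ equalizer f' g').left ≫
      (equalizer.ι f' g').left = j := by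
    rw [← Over.comp_left, equalizer.lift_ι]
    rfl
  -- The equalizer is a closed subscheme by separatedness, and it contains a scheme-theoretically
  -- dense part, so its ideal is zero.
  have : IsIso (equalizer.ι f' g').left := by
    rw [IsClosedImmersion.isIso_iff_ker_eq_bot, eq_bot_iff, ← j.ker_eq_bot, ← hl]
    exact Scheme.Hom.le_ker_comp _ _
  rw [← cancel_epi (equalizer.ι f' g').left]
  exact congr($(equalizer.condition f' g').left)

variable {X Y : Scheme.{u}} [IsIntegral X] [IsIntegral Y] {m : X ⟶ Y}

lemma fromSpecStalk_comp {R : Type u} [CommRing R] (g : X ⟶ Spec (CommRingCat.of R)) :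
    X.fromSpecStalk (genericPoint X) ≫ g = Spec.map (functionFieldHom g) := by
  have hg : g = X.toSpecΓ ≫ Spec.map ((Scheme.ΓSpecIso (CommRingCat.of R)).inv ≫ g.appTop) := by
    rw [Spec.map_comp, ← Scheme.toSpecΓ_naturality_assoc, toSpecΓ_SpecMap_ΓSpecIso_inv,
      Category.comp_id]
  rw [hg, Scheme.fromSpecStalk_toSpecΓ_assoc, ← Spec.map_comp, ← hg]
  congr 1
  have : Nonempty (⊤ : X.Opens) := ⟨⟨genericPoint X, trivial⟩⟩
  rw [← sectionHom_germToFunctionField g ⊤, sectionHom, Scheme.germToFunctionField]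
  simp

lemma fromSpecStalk_comp_eq (h : m (genericPoint X) = genericPoint Y) :
    X.fromSpecStalk (genericPoint X) ≫ m =
      Spec.map (functionFieldMap m h) ≫ Y.fromSpecStalk (genericPoint Y) := by
  rw [functionFieldMap, Spec.map_comp, Category.assoc, Scheme.SpecMap_stalkSpecializes_fromSpecStalk,
    Scheme.SpecMap_stalkMap_fromSpecStalk]

variable {k K : Type u} [Field k] [Field K] [Algebra k K] {g : X ⟶ Spec (CommRingCat.of K)}
  {v : Y ⟶ Spec (CommRingCat.of k)}
  (hm : IsPullback m g v (Spec.map (CommRingCat.ofHom (algebraMap k K))))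
  (hη : m (genericPoint X) = genericPoint Y)
include hm

/-- The function field of `X ×ₖ K` is `K ⊗ₖ k(X)`. -/
lemma isPushout_functionField [Algebra.IsAlgebraic k K] :
    IsPushout (functionFieldHom v) (CommRingCat.ofHom (algebraMap k K)) (functionFieldMap m hη)
      (functionFieldHom g) := by
  have := isAffineHom_of_isPullback hm
  have := surjective_of_isPullback hm
  obtain ⟨W, hW, hηW, -⟩ := exists_isAffineOpen_mem_and_subset (x := genericPoint Y) (U := ⊤) trivial
  have i1 : Nonempty W := ⟨⟨_, hηW⟩⟩
  have i2 : Nonempty (m ⁻¹ᵁ W) := nonempty_preimage m W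
  let : Algebra k Γ(Y, W) := (sectionHom v W).hom.toAlgebra
  let : Algebra K Γ(X, m ⁻¹ᵁ W) := (sectionHom g (m ⁻¹ᵁ W)).hom.toAlgebra
  let : Algebra Γ(Y, W) Γ(X, m ⁻¹ᵁ W) := (m.app W).hom.toAlgebra
  let : Algebra k Γ(X, m ⁻¹ᵁ W) := ((sectionHom v W) ≫ m.app W).hom.toAlgebra
  have : IsScalarTower k Γ(Y, W) Γ(X, m ⁻¹ᵁ W) := .of_algebraMap_eq' rfl
  have : IsScalarTower k K Γ(X, m ⁻¹ᵁ W) :=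
    .of_algebraMap_eq' (congrArg CommRingCat.Hom.hom (sectionHom_comp_app _ hm.w W))
  let : Algebra k Y.functionField := (functionFieldHom v).hom.toAlgebra
  let : Algebra K X.functionField := (functionFieldHom g).hom.toAlgebra
  let : Algebra Y.functionField X.functionField := (functionFieldMap m hη).hom.toAlgebra
  let : Algebra k X.functionField := (functionFieldHom v ≫ functionFieldMap m hη).hom.toAlgebra
  let : Algebra Γ(Y, W) X.functionField :=
    (Y.germToFunctionField W ≫ functionFieldMap m hη).hom.toAlgebra
  have : IsScalarTower Γ(Y, W) Y.functionField X.functionField := .of_algebraMap_eq' rfl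
  have : IsScalarTower Γ(Y, W) Γ(X, m ⁻¹ᵁ W) X.functionField :=
    .of_algebraMap_eq' (congrArg CommRingCat.Hom.hom (germToFunctionField_functionFieldMap hη W))
  have : IsScalarTower K Γ(X, m ⁻¹ᵁ W) X.functionField :=
    .of_algebraMap_eq' (congrArg CommRingCat.Hom.hom (sectionHom_germToFunctionField _ _)).symm
  have : IsScalarTower k Y.functionField X.functionField := .of_algebraMap_eq' rfl
  have : IsScalarTower k K X.functionField :=
    .of_algebraMap_eq' (congrArg CommRingCat.Hom.hom (functionFieldHom_functionFieldMap hm.w hη))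
  have : IsScalarTower k Γ(Y, W) Y.functionField :=
    .of_algebraMap_eq' (congrArg CommRingCat.Hom.hom (sectionHom_germToFunctionField v W)).symm
  have : IsScalarTower k Γ(Y, W) X.functionField :=
    .of_algebraMap_eq' (by
      rw [IsScalarTower.algebraMap_eq k Y.functionField, IsScalarTower.algebraMap_eq k Γ(Y, W)
        Y.functionField]
      rfl)
  have : IsScalarTower k Γ(X, m ⁻¹ᵁ W) X.functionField :=
    .of_algebraMap_eq' (by
      rw [IsScalarTower.algebraMap_eq k Γ(Y, W) X.functionField,
        IsScalarTower.algebraMap_eq k Γ(Y, W) Γ(X, m ⁻¹ᵁ W), ← RingHom.comp_assoc,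
        ← IsScalarTower.algebraMap_eq Γ(Y, W), ← IsScalarTower.algebraMap_eq k])
  have p1 : Algebra.IsPushout k Γ(Y, W) K Γ(X, m ⁻¹ᵁ W) :=
    isPushout_algebra_sections hm hW rfl rfl rfl
  have : IsFractionRing Γ(Y, W) Y.functionField :=
    functionField_isFractionRing_of_isAffineOpen Y W hW
  have : IsFractionRing Γ(X, m ⁻¹ᵁ W) X.functionField :=
    functionField_isFractionRing_of_isAffineOpen X _ (hW.preimage m)
  exact CommRingCat.isPushout_iff_isPushout.mpr
    (isPushout_fractionField (A := Γ(Y, W)) (B := Γ(X, m ⁻¹ᵁ W)))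

/-- Because `K` is algebraic over `k`, the fibre of `m` over the generic point of `Y` is just the
generic point of `X`. -/
lemma isPullback_fromSpecStalk [Algebra.IsAlgebraic k K] :
    IsPullback (X.fromSpecStalk (genericPoint X)) (Spec.map (functionFieldMap m hη)) m
      (Y.fromSpecStalk (genericPoint Y)) := by
  refine IsPullback.of_right (h₁₂ := g) (h₂₂ := v) ?_ (fromSpecStalk_comp_eq hη) hm.flip
  rw [fromSpecStalk_comp, fromSpecStalk_comp]
  exact (isPullback_SpecMap_of_isPushout _ _ _ _ (isPushout_functionField hm hη)).flip

/-- A morphism from `X ×ₖ K` to a separated scheme descends to `X` if it does so generically. -/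
lemma exists_comp_eq_of_isPullback [Algebra.IsAlgebraic k K] [IsSeparated g] {T : Scheme.{u}}
    {s : T ⟶ Spec (CommRingCat.of k)} [IsSeparated s] {p : X ⟶ T}
    (hp : p ≫ s = g ≫ Spec.map (CommRingCat.ofHom (algebraMap k K)))
    {w : Spec Y.functionField ⟶ T}
    (hw : X.fromSpecStalk (genericPoint X) ≫ p = Spec.map (functionFieldMap m hη) ≫ w) :
    ∃ φ : Y ⟶ T, m ≫ φ = p ∧ φ ≫ s = v := by
  have := flat_of_isPullback hm
  have := surjective_of_isPullback hm
  have := isAffineHom_of_isPullback hm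
  let η := X.fromSpecStalk (genericPoint X)
  have h1 : IsDominant η := by
    refine ⟨?_⟩
    have h := genericPoint_spec X
    refine Dense.mono ?_ (dense_iff_closure_eq.mpr h)
    rintro _ rfl
    rw [Scheme.range_fromSpecStalk]
    exact specializes_rfl
  have h2 : QuasiCompact η := by
    have : QuasiCompact (η ≫ g) := by
      rw [fromSpecStalk_comp]
      infer_instance
    exact QuasiCompact.of_comp η g
  have h3 : IsSchemeTheoreticallyDominant η := .of_isDominant η
  -- The descent datum: `p` agrees on the two projections of `X ×_Y X`. It suffices to check this on
  -- the base change of the generic point along a flat projection, which remains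
  -- scheme-theoretically dense.
  have h4 : pullback.fst m m ≫ p = pullback.snd m m ≫ p := by
    have hc := pullback.condition (f := m) (g := m)
    refine ext_of_isSchemeTheoreticallyDominant s ?_ (pullback.fst (pullback.snd m m) η) ?_
    · rw [Category.assoc, Category.assoc, hp, ← hm.w, reassoc_of% hc]
    · have hc' := pullback.condition (f := pullback.snd m m) (g := η)
      have hη' := isPullback_fromSpecStalk hm hη
      -- There the first projection also factors through the generic point. Both compositions with
      -- `p` then factor through `w` and the function field of `Y`, where they coincide.
      let q := hη'.lift (pullback.fst (pullback.snd m m) η ≫ pullback.fst m m)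
        (pullback.snd (pullback.snd m m) η ≫ Spec.map (functionFieldMap m hη)) (by
          rw [Category.assoc, Category.assoc, hc, reassoc_of% hc', fromSpecStalk_comp_eq hη])
      have e1 : pullback.fst (pullback.snd m m) η ≫ pullback.fst m m = q ≫ η :=
        (hη'.lift_fst _ _ _).symm
      have e2 : q ≫ Spec.map (functionFieldMap m hη) =
          pullback.snd (pullback.snd m m) η ≫ Spec.map (functionFieldMap m hη) := hη'.lift_snd _ _ _
      rw [reassoc_of% e1, reassoc_of% hc', hw, reassoc_of% e2]
  have h5 : ∀ {Z : Scheme.{u}} (a b : Z ⟶ X), a ≫ m = b ≫ m → a ≫ p = b ≫ p := fun a b hab => by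
    rw [← pullback.lift_fst a b hab, Category.assoc, h4, pullback.lift_snd_assoc]
  -- A flat, surjective, quasi-compact morphism is an effective epimorphism.
  refine ⟨EffectiveEpi.desc m p h5, EffectiveEpi.fac m p h5, ?_⟩
  rw [← cancel_epi m, ← Category.assoc, EffectiveEpi.fac, hp, hm.w]

/-- A morphism is an isomorphism if it becomes so over an extension of the base field. -/
lemma isIso_of_isPullback {T : Scheme.{u}} {s : T ⟶ Spec (CommRingCat.of k)} {p : X ⟶ T}
    (hp : IsPullback p g s (Spec.map (CommRingCat.ofHom (algebraMap k K)))) {φ : Y ⟶ T}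
    (h1 : m ≫ φ = p) (h2 : φ ≫ s = v) : IsIso φ := by
  -- Both `Y` and `T` become `X` over `K`, so the base change of `φ` along the faithfully flat `p`
  -- is the identity.
  have hs : IsPullback m (𝟙 X) φ p := by
    refine IsPullback.of_bot ?_ ?_ hp
    · rwa [Category.id_comp, h2]
    · rw [h1, Category.id_comp]
  have := isAffineHom_of_isPullback hp
  exact MorphismProperty.of_isPullback_of_descendsAlong (P := MorphismProperty.isomorphisms Scheme)
    (Q := @Surjective ⊓ @Flat ⊓ @QuasiCompact) hs.flip
    ⟨⟨surjective_of_isPullback hp, flat_of_isPullback hp⟩, inferInstance⟩ inferInstance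

end Descent

end SeveriBrauer

/-! ### Triviality from linear forms with ratios in the function field. -/

namespace SeveriBrauer

open MvPolynomial

section Triviality

attribute [local instance] planeFunctionFieldAlgebra

variable {k K : Type u} [Field k] [Field K] [Algebra k K] [Algebra.IsAlgebraic k K] {Y : Scheme.{u}}
  [IsIntegral Y] {v : Y ⟶ Spec (CommRingCat.of k)} {m : plane K ⟶ Y}

instance (K : Type u) [Field K] : IsSeparated (planeHom K) := by
  have := Proj.isSeparated (grading K)
  infer_instance

/-- A form of the projective plane whose function field contains the ratios of three independent
linear forms is isomorphic to the projective plane. -/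
theorem exists_isIso_of_linearForms
    (hm : IsPullback m (planeHom K) v (Spec.map (CommRingCat.ofHom (algebraMap k K))))
    (hη : m (genericPoint (plane K)) = genericPoint Y) {Z : Fin 3 → MvPolynomial (Fin 3) K}
    (hZ : ∀ i, (Z i).IsHomogeneous 1) (hli : LinearIndependent K Z)
    (hF : ∀ i, aeval (planeCoord K) (Z i) / aeval (planeCoord K) (Z 0) ∈
      Set.range (functionFieldMap m hη)) :
    ∃ φ : Y ⟶ plane k, IsIso φ ∧ φ ≫ planeHom k = v := by
  let : Algebra k Y.functionField := (functionFieldHom v).hom.toAlgebra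
  let : Algebra Y.functionField (plane K).functionField := (functionFieldMap m hη).hom.toAlgebra
  let : Algebra k (plane K).functionField :=
    (functionFieldHom v ≫ functionFieldMap m hη).hom.toAlgebra
  have : IsScalarTower k Y.functionField (plane K).functionField := .of_algebraMap_eq' rfl
  have : IsScalarTower k K (plane K).functionField :=
    .of_algebraMap_eq' (congrArg CommRingCat.Hom.hom (functionFieldHom_functionFieldMap hm.w hη))
  have : Algebra.IsPushout k Y.functionField K (plane K).functionField :=
    CommRingCat.isPushout_iff_isPushout.mp (isPushout_functionField hm hη)
  have hp := isPullback_linearMap (k := k) (F := Y.functionField) hZ hli hF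
  -- Pullback of functions on one chart lands in the function field of `Y`. Hence the morphism is
  -- generically defined over `Y`, which suffices for the descent.
  obtain ⟨θ, hθ⟩ : ∃ θ : Γ(plane k, planeChart k 0) ⟶ Y.functionField,
      (linearMap k hZ hli).app (planeChart k 0) ≫ (plane K).germToFunctionField _ =
        θ ≫ functionFieldMap m hη := by
    obtain ⟨θ, hθ⟩ := exists_chartHom (k := k) (F := Y.functionField) hZ hli hF 0
    exact ⟨CommRingCat.ofHom (R := Γ(plane k, planeChart k 0)) (S := Y.functionField) θ, by ext s; exact (hθ s).symm⟩
  have hU := isAffineOpen_planeChart k 0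
  have := isAffineHom_linearMap (k := k) hZ hli
  have hV := hU.preimage (linearMap k hZ hli)
  have hw : (plane K).fromSpecStalk (genericPoint (plane K)) ≫ linearMap k hZ hli =
      Spec.map (functionFieldMap m hη) ≫ Spec.map θ ≫ hU.fromSpec := by
    have hmem : genericPoint (plane K) ∈ linearMap k hZ hli ⁻¹ᵁ planeChart k 0 :=
      ((genericPoint_spec (plane K)).mem_open_set_iff (linearMap k hZ hli ⁻¹ᵁ planeChart k 0).isOpen).mpr
        (by simpa using (inferInstance : Nonempty (linearMap k hZ hli ⁻¹ᵁ planeChart k 0)))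
    rw [← hV.fromSpecStalk_eq_fromSpecStalk hmem, IsAffineOpen.fromSpecStalk, Category.assoc,
      ← hU.SpecMap_appLE_fromSpec _ hV le_rfl, ← Spec.map_comp_assoc, ← Spec.map_comp_assoc,
      Scheme.Hom.appLE_eq_app]
    exact congrArg (fun f => Spec.map f ≫ hU.fromSpec) hθ
  obtain ⟨φ, h1, h2⟩ := exists_comp_eq_of_isPullback hm hη (linearMap_planeHom hZ hli) hw
  exact ⟨φ, isIso_of_isPullback hm hp h1 h2, h2⟩

end Triviality

end SeveriBrauer

/-! ### The theorem. -/

theorem mainTheorem4 {k : Type u} [Field k] (h2 : (2 : k) ≠ 0) (h3 : (3 : k) ≠ 0)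
    (V : Over (Spec (CommRingCat.of k)))
    (hV : SeveriBrauer.IsSeveriBrauerSurface V) (hnt : ¬ SeveriBrauer.IsTrivial V)
    (x : V.left) (hx : IsClosed ({x} : Set V.left)) (hdeg : SeveriBrauer.pointDegree V x = 6)
    (e : SeveriBrauer.geometricFibre V ≅ SeveriBrauer.projPlane (AlgebraicClosure k)) :
    ∃ y : Fin 6 → (SeveriBrauer.projPlane (AlgebraicClosure k)).left,
      Function.Injective y ∧
      Set.range y = (e.inv.left ≫ SeveriBrauer.geometricProj V) ⁻¹' {x} ∧
      (∀ i, IsClosed ({y i} : Set (SeveriBrauer.projPlane (AlgebraicClosure k)).left)) ∧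
      (∀ i j l, i ≠ j → i ≠ l → j ≠ l →
        ¬ ∃ L, SeveriBrauer.IsLine L ∧ y i ∈ L ∧ y j ∈ L ∧ y l ∈ L) ∧
      ¬ ∃ C, SeveriBrauer.IsConic C ∧ ∀ i, y i ∈ C := by
  let K := AlgebraicClosure k
  let m : SeveriBrauer.plane K ⟶ V.left := e.inv.left ≫ SeveriBrauer.geometricProj V
  -- Transport of the defining pullback square along `e`, which replaces the geometric fibre by the
  -- plane.
  have hm : IsPullback m (SeveriBrauer.planeHom K) V.hom
      (Spec.map (CommRingCat.ofHom (algebraMap k K))) := by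
    refine IsPullback.of_iso (IsPullback.of_hasPullback V.hom (SeveriBrauer.specAlgClosure k))
      ((Over.forget _).mapIso e) (Iso.refl _) (Iso.refl _) (Iso.refl _) ?_ ?_ ?_ ?_
    · exact (Category.comp_id _).trans
        (Iso.hom_inv_id_assoc ((Over.forget _).mapIso e) (SeveriBrauer.geometricProj V)).symm
    · exact (Category.comp_id _).trans (Over.w e.hom).symm
    · exact (Category.comp_id _).trans (Category.id_comp _).symm
    · exact (Category.comp_id _).trans (Category.id_comp _).symm
  have := SeveriBrauer.flat_of_isPullback hm
  have := SeveriBrauer.surjective_of_isPullback hm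
  have := SeveriBrauer.isIntegral_of_flat_surjective m
  have hη := SeveriBrauer.map_genericPoint m
  let : Algebra k (V.left.residueField x) := (SeveriBrauer.residueFieldHom V x).toAlgebra
  obtain ⟨y, hy, hfib, hcl, H⟩ := SeveriBrauer.exists_fibre h2 h3 hm hη hx rfl hdeg
  -- Special position would provide linear forms with ratios in the function field, and with them an
  -- isomorphism of `V` with the plane over `k`.
  have hgen : ¬ _ := fun h => hnt (by
    obtain ⟨Z, hZ, hli, hF⟩ := H h
    obtain ⟨φ, hφ, hφv⟩ := SeveriBrauer.exists_isIso_of_linearForms hm hη hZ hli hF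
    exact ⟨Over.isoMk (@asIso _ _ _ _ φ hφ) hφv⟩)
  have hmem : ∀ (f : MvPolynomial (Fin 3) K) (z : SeveriBrauer.plane K),
      z ∈ ProjectiveSpectrum.zeroLocus (SeveriBrauer.grading K) {f} → f ∈ z.asHomogeneousIdeal :=
    fun f z h => h rfl
  refine ⟨y, hy, hfib, hcl, ?_, ?_⟩
  · rintro i j l hij hil hjl ⟨_, ⟨f, hf0, hf, rfl⟩, hi, hj, hl⟩
    exact hgen (Or.inl ⟨i, j, l, hij, hil, hjl, f, hf, hf0, hmem f _ hi, hmem f _ hj, hmem f _ hl⟩)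
  · rintro ⟨_, ⟨f, hf0, hf, rfl⟩, h⟩
    exact hgen (Or.inr ⟨f, hf, hf0, fun i => hmem f _ (h i)⟩)
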